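/- Let $q\in L^2(\mathbb R)$ be real valued with $\int_{\mathbb R}(1+|x|)|q(x)|\,dx<\infty$, and let $M=(m_{jk})$ be a real $2\times2$ matrix with $\det M=1$ and $m_{12}=0$. Consider $$\ell y:=-y''+qy=\zeta^2y\ \text{ on }(-\infty,0)\cup(0,\infty),\qquad \begin{pmatrix}y(0^+)\\y'(0^+)\end{pmatrix}=M\begin{pmatrix}y(0^-)\\y'(0^-)\end{pmatrix},\qquad(1)$$ and the operator $Ly=\ell y$ in $L^2(\mathbb R)$ whose domain consists of those $y\in L^2(\mathbb R)$ with $\ell y\in L^2(\mathbb R)$ such that $y,y'$ are locally absolutely continuous on each half-line and $y$ satisfies the transfer condition in (1). Let $f_{+,M}(x,\zeta)$ and $f_{-,M}(x,\zeta)$ be the Jost solutions, i.e. the solutions of (1) with $e^{-i\zeta x}f_{+,M}(x,\zeta)\to1$ as $x\to\infty$ and $e^{i\zeta x}f_{-,M}(x,\zeta)\to1$ as $x\to-\infty$. For real $\xi\ne0$ let $A(\xi),B(\xi)$ be the unique coefficients with $$f_{-,M}(x,\xi)=A(\xi)\overline{f_{+,M}(x,\xi)}+B(\xi)f_{+,M}(x,\xi)\qquad(x\neq0),$$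 and let $R(\xi)=B(\xi)/A(\xi)$ be the reflection coefficient. Then the eigenvalues of $L$ are finitely many numbers $-\eta_1^2,\dots,-\eta_N^2$ with $0<\eta_1<\dots<\eta_N$ (where $N\ge 0$), $|R(\xi)|<1$ for all real $\xi\neq0$, and the scattering data $\{R(\xi),\eta_1,\dots,\eta_N\}$ determine $M$ up to $m_{21}$ and a sign: if $(q',M')$ satisfies the same assumptions (including $m'_{12}=0$) and has the same scattering data, then $(m'_{11},m'_{22})=\pm(m_{11},m_{22})$. Specifically, the limit $C_2=\lim_{|\xi|\to\infty}R(\xi)$ exists, is real with $-1<C_2<1$, and for some sign $\varepsilon\in\{1,-1\}$ $$m_{11}=\varepsilon\sqrt{\frac{1+C_2}{1-C_2}},\qquad m_{22}=\varepsilon\sqrt{\frac{1-C_2}{1+C_2}}.$$ Moreover $A$ extends to a function that is continuous on $\{\zeta\ne0:\operatorname{Im}\zeta\ge0\}$ and analytic in $\{\operatorname{Im}\zeta>0\}$, and for $\operatorname{Im}\zeta>0$ it is given, with the same sign $\varepsilon$ and an absolutely convergent integral, by $$A(\zeta)=\frac{\varepsilon}{\sqrt{1-C_2^2}}\prod_{j=1}^{N}\frac{\zeta-i\eta_j}{\zeta+i\eta_j}\,\exp\left[\frac1{2\pi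 i}\int_{-\infty}^{\infty}\frac{\log|1-C_2^2|-\log(1-|R(\xi)|^2)}{\xi-\zeta}\,d\xi\right].$$ -/

import Mathlib

open Set Filter Topology MeasureTheory

/-- Standing assumptions on the real potential: `q ∈ L²(ℝ)` and `∫ (1 + |x|) |q(x)| dx < ∞`. -/
structure AdmissiblePotential (q : ℝ → ℝ) : Prop where
  memLp_two : MemLp q 2 volume
  integrable_moment : Integrable (fun x : ℝ => (1 + |x|) * q x) volume

/-- The differential expression `ℓ y = -y'' + q y`. It is only used for functions `y` whose
derivative is locally absolutely continuous off the origin, so that `y''` exists almost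
everywhere. -/
noncomputable def schrodingerExpr (q : ℝ → ℝ) (y : ℝ → ℂ) (x : ℝ) : ℂ :=
  -(deriv (deriv y) x) + (q x : ℂ) * y x

/-- `y` and `y'` are absolutely continuous on every compact interval contained in `(-∞, 0)` or in
`(0, ∞)`. (The existence of the one-sided limits at the origin is part of
`TransferCondition`.) -/
def PiecewiseAC (y : ℝ → ℂ) : Prop :=
  ∀ a b : ℝ, a ≤ b → (b < 0 ∨ 0 < a) →
    AbsolutelyContinuousOnInterval y a b ∧ AbsolutelyContinuousOnInterval (deriv y) a b

/-- The point transfer condition at the origin: the one-sided limits of `y` and `y'` at `0` exist,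
and `(y(0⁺), y'(0⁺))ᵀ = M (y(0⁻), y'(0⁻))ᵀ`. -/
def TransferCondition (M : Matrix (Fin 2) (Fin 2) ℝ) (y : ℝ → ℂ) : Prop :=
  ∃ l r : Fin 2 → ℂ,
    Tendsto y (𝓝[<] 0) (𝓝 (l 0)) ∧ Tendsto (deriv y) (𝓝[<] 0) (𝓝 (l 1)) ∧
    Tendsto y (𝓝[>] 0) (𝓝 (r 0)) ∧ Tendsto (deriv y) (𝓝[>] 0) (𝓝 (r 1)) ∧
    r = Matrix.mulVec (M.map (fun t : ℝ => (t : ℂ))) l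

/-- `y` is a solution of `-y'' + q y = μ y` on `(-∞, 0) ∪ (0, ∞)` satisfying the transfer
condition with matrix `M`. The value of `y` at the point `0` is irrelevant. -/
def IsTransferSolution (q : ℝ → ℝ) (M : Matrix (Fin 2) (Fin 2) ℝ) (μ : ℂ) (y : ℝ → ℂ) : Prop :=
  PiecewiseAC y ∧ TransferCondition M y ∧ ∀ᵐ x ∂volume, schrodingerExpr q y x = μ * y x

/-- Membership in the domain `D(L)` of the operator `L y = ℓ y` in `L²(ℝ)`. -/
def MemDomain (q : ℝ → ℝ) (M : Matrix (Fin 2) (Fin 2) ℝ) (y : ℝ → ℂ) : Prop :=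
  MemLp y 2 volume ∧ MemLp (schrodingerExpr q y) 2 volume ∧ PiecewiseAC y ∧ TransferCondition M y

/-- The set of eigenvalues of the operator `L` in `L²(ℝ)`. -/
def eigenvalueSet (q : ℝ → ℝ) (M : Matrix (Fin 2) (Fin 2) ℝ) : Set ℂ :=
  {μ | ∃ y : ℝ → ℂ, MemDomain q M y ∧ (∀ᵐ x ∂volume, schrodingerExpr q y x = μ * y x) ∧
    ¬ (∀ᵐ x ∂volume, y x = 0)}

/-- `f` is the Jost solution `f_{+,M}(·, ζ)`: it solves the transfer problem with `μ = ζ²` and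
`e^{-iζx} f(x) → 1` as `x → ∞`. -/
def IsJostPlus (q : ℝ → ℝ) (M : Matrix (Fin 2) (Fin 2) ℝ) (ζ : ℂ) (f : ℝ → ℂ) : Prop :=
  IsTransferSolution q M (ζ ^ 2) f ∧
    Tendsto (fun x : ℝ => Complex.exp (-(Complex.I * ζ * x)) * f x) atTop (𝓝 1)

/-- `f` is the Jost solution `f_{-,M}(·, ζ)`: it solves the transfer problem with `μ = ζ²` and
`e^{iζx} f(x) → 1` as `x → -∞`. -/
def IsJostMinus (q : ℝ → ℝ) (M : Matrix (Fin 2) (Fin 2) ℝ) (ζ : ℂ) (f : ℝ → ℂ) : Prop :=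
  IsTransferSolution q M (ζ ^ 2) f ∧
    Tendsto (fun x : ℝ => Complex.exp (Complex.I * ζ * x) * f x) atBot (𝓝 1)

/-- The Jost solution `f_{+,M}(·, ζ)`. -/
noncomputable def jostPlus (q : ℝ → ℝ) (M : Matrix (Fin 2) (Fin 2) ℝ) (ζ : ℂ) : ℝ → ℂ :=
  Classical.epsilon (IsJostPlus q M ζ)

/-- The Jost solution `f_{-,M}(·, ζ)`. -/
noncomputable def jostMinus (q : ℝ → ℝ) (M : Matrix (Fin 2) (Fin 2) ℝ) (ζ : ℂ) : ℝ → ℂ :=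
  Classical.epsilon (IsJostMinus q M ζ)

/-- The pair `(A, B)` satisfies `f_{-,M}(x, ξ) = A conj(f_{+,M}(x, ξ)) + B f_{+,M}(x, ξ)` for all
`x ≠ 0`. -/
def IsConnectionPair (q : ℝ → ℝ) (M : Matrix (Fin 2) (Fin 2) ℝ) (ξ : ℝ) (p : ℂ × ℂ) : Prop :=
  ∀ x : ℝ, x ≠ 0 → jostMinus q M ξ x =
    p.1 * (starRingEnd ℂ) (jostPlus q M ξ x) + p.2 * jostPlus q M ξ x

/-- The (unique, for real `ξ ≠ 0`) pair of connection coefficients `(A(ξ), B(ξ))`. -/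
noncomputable def connectionPair (q : ℝ → ℝ) (M : Matrix (Fin 2) (Fin 2) ℝ) (ξ : ℝ) : ℂ × ℂ :=
  Classical.epsilon (IsConnectionPair q M ξ)

/-- The coefficient `A(ξ)`, `ξ ∈ ℝ \ {0}`. -/
noncomputable def coeffA (q : ℝ → ℝ) (M : Matrix (Fin 2) (Fin 2) ℝ) (ξ : ℝ) : ℂ :=
  (connectionPair q M ξ).1

/-- The coefficient `B(ξ)`, `ξ ∈ ℝ \ {0}`. -/
noncomputable def coeffB (q : ℝ → ℝ) (M : Matrix (Fin 2) (Fin 2) ℝ) (ξ : ℝ) : ℂ :=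
  (connectionPair q M ξ).2

/-- The reflection coefficient `R(ξ) = B(ξ) / A(ξ)`, `ξ ∈ ℝ \ {0}`. -/
noncomputable def reflectionCoeff (q : ℝ → ℝ) (M : Matrix (Fin 2) (Fin 2) ℝ) (ξ : ℝ) : ℂ :=
  coeffB q M ξ / coeffA q M ξ

/-- `A` extends the function `a` on `ℝ \ {0}` to the closed upper half-plane without the origin:
it is continuous there, analytic in the open upper half-plane, and equal to `a` on `ℝ \ {0}`.
These properties determine `A` on the closed upper half-plane without the origin. -/
structure IsUpperExtension (a : ℝ → ℂ) (A : ℂ → ℂ) : Prop where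
  analytic : DifferentiableOn ℂ A {ζ : ℂ | 0 < ζ.im}
  continuousOn : ContinuousOn A {ζ : ℂ | 0 ≤ ζ.im ∧ ζ ≠ 0}
  boundary : ∀ ξ : ℝ, ξ ≠ 0 → A (ξ : ℂ) = a ξ

/-- The integrand `(log |1 - C²| - log (1 - |R(ξ)|²)) / (ξ - ζ)` of the Cauchy integral. -/
noncomputable def cauchyIntegrand (R : ℝ → ℂ) (C : ℝ) (ζ : ℂ) (ξ : ℝ) : ℂ :=
  ((Real.log |1 - C ^ 2| - Real.log (1 - ‖R ξ‖ ^ 2) : ℝ) : ℂ) / ((ξ : ℂ) - ζ)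

/-! Folding the line at the origin turns the transfer problem into two equations u'' = (p - ζ²)u on
(0, ∞), where p is the right half of q or its reflected left half. The finite first moment makes the
Volterra series for the amplitude m of the Jost solution e^{iζx}m converge uniformly on Im ζ ≥ 0.
Its data at the origin, a = `jostA` and v = `jostV`, are therefore continuous there and analytic
inside, with a = 1 + O(1/|ζ|) and v = iζa + O(1).

Since m₁₂ = 0 and m₁₁m₂₂ = 1, the two Jost solutions have Wronskian W = m₁₁a_L v_R + m₂₂v_L a_R -
m₂₁a_L a_R (`jostW`), and Cramer's rule gives A = W/(2iζ) and an analogous quotient for B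
(`connectionPair_eq`). At high real energy A → (m₁₁ + m₂₂)/2 and B → (m₁₁ - m₂₂)/2, while m₂₁ enters
only at lower order. Hence C₂ = (m₁₁ - m₂₂)/(m₁₁ + m₂₂) = 1 - 2/(m₁₁² + 1), which fixes m₁₁².
Constancy of Wronskians gives |A|² - |B|² = 1, so |R| < 1 and 1 - |R|² = |A|⁻².

A square-integrable solution is a multiple of the Jost solution on each half-line, so the
eigenvalues are the ζ² at the zeros of W in Im ζ > 0 (`eigenvalueSet_eq`). Green's identity puts
these zeros on the imaginary axis. Combined with the relation `jostW_plucker` it also shows that W'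
at such a zero is a nonzero multiple of c²∫|f_R|² + ∫|f_L|², with c the real ratio of the two Jost
solutions, so the zeros are simple. If W(0) = 0, the same relation with the low-energy limit
`tendsto_jost_bracket_zero` puts c² + 1 in place of this sum. Thus |A| is bounded below near 0 and
the zeros are finite in number (`finite_jostZeros`).

Dividing A by its limit (m₁₁ + m₂₂)/2 = ε/√(1 - C₂²) and by the Blaschke product of its zeros leaves
a zero-free function whose log-modulus is O(|z|^{-1/2}) on the closed half-plane minus 0. The
Poisson formula reproduces such a log-modulus (`log_norm_eq_poisson`), so the function is the
exponential of a Cauchy integral of its boundary log-modulus (`eq_exp_cauchyInt`), and there |A| is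
expressed through |R|. -/

section HalfLineSolutions

/-! ### Absolutely continuous complex functions -/

theorem AbsolutelyContinuousOnInterval.congr_uIcc {f g : ℝ → ℂ} {a b : ℝ}
    (hf : AbsolutelyContinuousOnInterval f a b) (h : EqOn f g (uIcc a b)) :
    AbsolutelyContinuousOnInterval g a b := by
  rw [absolutelyContinuousOnInterval_iff] at hf ⊢
  intro ε hε
  obtain ⟨δ, hδ, H⟩ := hf ε hε
  refine ⟨δ, hδ, fun E hE hlt => ?_⟩
  refine lt_of_eq_of_lt (Finset.sum_congr rfl fun i hi => ?_) (H E hE hlt)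
  rw [h (hE.1 i hi).1, h (hE.1 i hi).2]

theorem AbsolutelyContinuousOnInterval.complex_ofReal {g : ℝ → ℝ} {a b : ℝ}
    (hg : AbsolutelyContinuousOnInterval g a b) :
    AbsolutelyContinuousOnInterval (fun x => (g x : ℂ)) a b := by
  unfold AbsolutelyContinuousOnInterval at hg ⊢
  simpa [Complex.isometry_ofReal.dist_eq] using hg

theorem AbsolutelyContinuousOnInterval.complex_mul {f g : ℝ → ℂ} {a b : ℝ}
    (hf : AbsolutelyContinuousOnInterval f a b) (hg : AbsolutelyContinuousOnInterval g a b) :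
    AbsolutelyContinuousOnInterval (fun x => f x * g x) a b :=
  hf.smul hg

theorem AbsolutelyContinuousOnInterval.const_complex (c : ℂ) (a b : ℝ) :
    AbsolutelyContinuousOnInterval (fun _ => c) a b :=
  (LipschitzOnWith.absolutelyContinuousOnInterval (K := 0)
    ((LipschitzWith.const c).lipschitzOnWith))

theorem absolutelyContinuousOnInterval_integral_complex {f : ℝ → ℂ} {a b c : ℝ}
    (hf : IntervalIntegrable f volume a b) (hc : c ∈ uIcc a b) :
    AbsolutelyContinuousOnInterval (fun x => ∫ t in c..x, f t) a b := by
  have hre : IntervalIntegrable (fun t => (f t).re) volume a b :=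
    ⟨hf.1.re, hf.2.re⟩
  have him : IntervalIntegrable (fun t => (f t).im) volume a b :=
    ⟨hf.1.im, hf.2.im⟩
  have h1 := (hre.absolutelyContinuousOnInterval_intervalIntegral hc).complex_ofReal
  have h2 := ((him.absolutelyContinuousOnInterval_intervalIntegral hc).complex_ofReal).const_smul
    Complex.I
  refine (h1.add h2).congr_uIcc fun x hx => ?_
  have hsub : uIcc c x ⊆ uIcc a b := uIcc_subset_uIcc hc hx
  have e1 : IntervalIntegrable (fun t => ((f t).re : ℂ)) volume c x := by
    have := hre.mono_set hsub
    exact ⟨this.1.ofReal, this.2.ofReal⟩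
  have e2 : IntervalIntegrable (fun t => ((f t).im : ℂ)) volume c x := by
    have := him.mono_set hsub
    exact ⟨this.1.ofReal, this.2.ofReal⟩
  simp only [Pi.add_apply, smul_eq_mul]
  rw [← intervalIntegral.integral_ofReal, ← intervalIntegral.integral_ofReal,
    ← intervalIntegral.integral_const_mul, ← intervalIntegral.integral_add e1 (e2.const_mul _)]
  refine intervalIntegral.integral_congr fun t _ => ?_
  rw [mul_comm Complex.I]
  exact Complex.re_add_im (f t)

/-- Subtracting the primitive of `g` from `u` leaves an absolutely continuous function with zero
derivative almost everywhere, which is constant. This form lets `g` be any a.e. derivative, such as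
the right-hand side of the differential equation. -/
theorem AbsolutelyContinuousOnInterval.sub_eq_integral {u g : ℝ → ℂ} {a b : ℝ}
    (hu : AbsolutelyContinuousOnInterval u a b)
    (hd : ∀ᵐ x, x ∈ uIcc a b → HasDerivAt u (g x) x)
    (hg : IntervalIntegrable g volume a b) : u b - u a = ∫ t in a..b, g t := by
  have h1 := absolutelyContinuousOnInterval_integral_complex hg (c := a) (by simp)
  have h2 : ∀ᵐ x, x ∈ uIcc a b → HasDerivAt (u - fun x => ∫ t in a..x, g t) 0 x := by
    filter_upwards [hd, hg.ae_hasDerivAt_integral] with x hx1 hx2 hx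
    simpa using (hx1 hx).sub (hx2 hx a (by simp))
  obtain ⟨C, hC⟩ := (hu.sub h1).const_of_ae_hasDerivAt_zero h2
  have ha := hC a (by simp)
  have hb := hC b (by simp)
  simp only [Pi.sub_apply, intervalIntegral.integral_same, sub_zero] at ha hb
  rw [ha, ← hb]; ring

theorem absolutelyContinuousOnInterval_of_hasDerivAt {u u' : ℝ → ℂ} {a b : ℝ}
    (hd : ∀ x ∈ uIcc a b, HasDerivAt u (u' x) x) (hc : ContinuousOn u' (uIcc a b)) :
    AbsolutelyContinuousOnInterval u a b := by
  obtain ⟨C, hC⟩ := isCompact_uIcc.exists_bound_of_continuousOn hc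
  refine LipschitzOnWith.absolutelyContinuousOnInterval (K := C.toNNReal) ?_
  refine Convex.lipschitzOnWith_of_nnnorm_hasDerivWithin_le (convex_uIcc a b)
    (fun x hx => (hd x hx).hasDerivWithinAt) fun x hx => ?_
  rw [← NNReal.coe_le_coe, coe_nnnorm]
  exact (hC x hx).trans (Real.le_coe_toNNReal C)

/-! ### Solutions of `u'' = P u` on the half-line `(0, ∞)` -/

/-- `u` is a solution of `u'' = P u` on `(0, ∞)` with derivative `u'`. -/
structure IsHalfSol (P u u' : ℝ → ℂ) : Prop where
  hasDerivAt : ∀ x, 0 < x → HasDerivAt u (u' x) x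
  ac : ∀ a b, 0 < a → a ≤ b → AbsolutelyContinuousOnInterval u' a b
  eq : ∀ᵐ x, 0 < x → HasDerivAt u' (P x * u x) x

namespace IsHalfSol
variable {P Q u u' v v' : ℝ → ℂ}

theorem continuousOn (h : IsHalfSol P u u') : ContinuousOn u (Ioi 0) :=
  fun x hx => (h.hasDerivAt x hx).continuousAt.continuousWithinAt

theorem continuousOn_deriv (h : IsHalfSol P u u') : ContinuousOn u' (Ioi 0) := by
  intro x hx
  have hx : 0 < x := hx
  have := (h.ac (x / 2) (2 * x) (by linarith) (by linarith)).continuousOn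
  rw [uIcc_of_le (by linarith)] at this
  exact (this.continuousAt (Icc_mem_nhds (by linarith) (by linarith))).continuousWithinAt

theorem ac_self (h : IsHalfSol P u u') {a b : ℝ} (ha : 0 < a) (hab : a ≤ b) :
    AbsolutelyContinuousOnInterval u a b := by
  have hsub : uIcc a b ⊆ Ioi 0 := by
    rw [uIcc_of_le hab]; exact fun x hx => lt_of_lt_of_le ha hx.1
  exact absolutelyContinuousOnInterval_of_hasDerivAt (fun x hx => h.hasDerivAt x (hsub hx))
    (h.continuousOn_deriv.mono hsub)

theorem const_mul (c : ℂ) (h : IsHalfSol P u u') :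
    IsHalfSol P (fun x => c * u x) (fun x => c * u' x) where
  hasDerivAt x hx := (h.hasDerivAt x hx).const_mul c
  ac a b ha hab := (h.ac a b ha hab).const_smul c
  eq := by
    filter_upwards [h.eq] with x hx h0
    have := (hx h0).const_mul c
    rwa [mul_left_comm] at this

theorem add (h : IsHalfSol P u u') (k : IsHalfSol P v v') :
    IsHalfSol P (fun x => u x + v x) (fun x => u' x + v' x) where
  hasDerivAt x hx := (h.hasDerivAt x hx).add (k.hasDerivAt x hx)
  ac a b ha hab := (h.ac a b ha hab).add (k.ac a b ha hab)
  eq := by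
    filter_upwards [h.eq, k.eq] with x hx kx h0
    rw [mul_add]
    exact (hx h0).add (kx h0)

theorem conj (h : IsHalfSol P u u') :
    IsHalfSol (fun x => (starRingEnd ℂ) (P x)) (fun x => (starRingEnd ℂ) (u x))
      (fun x => (starRingEnd ℂ) (u' x)) where
  hasDerivAt x hx := (h.hasDerivAt x hx).star
  ac a b ha hab := by
    have := h.ac a b ha hab
    unfold AbsolutelyContinuousOnInterval at this ⊢
    simpa [Complex.dist_conj_conj] using this
  eq := by
    filter_upwards [h.eq] with x hx h0
    rw [← map_mul]
    exact (hx h0).star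

/-- Green's identity for two spectral parameters. -/
theorem green_of_le (h : IsHalfSol P u u') (k : IsHalfSol Q v v') {c : ℂ} {a b : ℝ} (ha : 0 < a)
    (hab : a ≤ b) (hPQ : ∀ x, a ≤ x → x ≤ b → Q x - P x = c) :
    (u b * v' b - u' b * v b) - (u a * v' a - u' a * v a) = c * ∫ t in a..b, u t * v t := by
  have hsub : uIcc a b ⊆ Ioi 0 := by
    rw [uIcc_of_le hab]; exact fun x hx => lt_of_lt_of_le ha hx.1
  have hac : AbsolutelyContinuousOnInterval (fun x => u x * v' x - u' x * v x) a b :=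
    ((h.ac_self ha hab).complex_mul (k.ac a b ha hab)).sub
      ((h.ac a b ha hab).complex_mul (k.ac_self ha hab))
  rw [← intervalIntegral.integral_const_mul]
  refine hac.sub_eq_integral (g := fun t => c * (u t * v t)) ?_ ?_
  · filter_upwards [h.eq, k.eq] with x hx kx hxs
    have h0 : 0 < x := hsub hxs
    have := ((h.hasDerivAt x h0).mul (kx h0)).sub ((hx h0).mul (k.hasDerivAt x h0))
    rw [uIcc_of_le hab] at hxs
    rw [← hPQ x hxs.1 hxs.2]
    convert! this using 1
    ring
  · refine ContinuousOn.intervalIntegrable ?_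
    exact continuousOn_const.mul ((h.continuousOn.mono hsub).mul (k.continuousOn.mono hsub))

/-- The Wronskian of two solutions of the same equation is constant. -/
theorem wronskian_eq (h : IsHalfSol P u u') (k : IsHalfSol P v v') {a b : ℝ} (ha : 0 < a)
    (hb : 0 < b) : u a * v' a - u' a * v a = u b * v' b - u' b * v b := by
  rcases le_total a b with hab | hab
  · have := h.green_of_le k ha hab (c := 0) (by simp)
    rw [zero_mul] at this
    exact (sub_eq_zero.1 this).symm
  · have := h.green_of_le k hb hab (c := 0) (by simp)
    rw [zero_mul] at this
    exact sub_eq_zero.1 this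

end IsHalfSol

end HalfLineSolutions

section ParametricIntegrals

/-! ### Parametric integrals of holomorphic functions -/

/-- Only the integrand has to be dominated, not its derivative: Cauchy's estimate on discs of radius
`r` turns `bound` into the Lipschitz constant `bound / r` near `z`. -/
theorem differentiableOn_integral_of_dominated {μ : Measure ℝ} {F : ℂ → ℝ → ℂ} {U : Set ℂ}
    (hU : IsOpen U) (hmeas : ∀ z ∈ U, AEStronglyMeasurable (F z) μ)
    (hd : ∀ᵐ t ∂μ, DifferentiableOn ℂ (fun z => F z t) U) {bound : ℝ → ℝ}
    (hb : ∀ᵐ t ∂μ, ∀ z ∈ U, ‖F z t‖ ≤ bound t) (hint : Integrable bound μ) :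
    DifferentiableOn ℂ (fun z => ∫ t, F z t ∂μ) U := by
  intro z hz
  obtain ⟨R, hR, hball⟩ := Metric.isOpen_iff.1 hU z hz
  set r := R / 2 with hr
  have hr0 : 0 < r := by positivity
  have hcl : ∀ w ∈ Metric.ball z r, Metric.closedBall w r ⊆ U := fun w hw y hy => by
    apply hball
    have h1 := Metric.mem_ball.1 hw
    have h2 := Metric.mem_closedBall.1 hy
    refine Metric.mem_ball.2 (lt_of_le_of_lt (dist_triangle y w z) ?_)
    linarith
  have hderiv : ∀ᵐ t ∂μ, ∀ w ∈ Metric.ball z r, HasDerivAt (fun y => F y t)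
      (deriv (fun y => F y t) w) w := by
    filter_upwards [hd] with t ht w hw
    exact (ht.differentiableAt (hU.mem_nhds (hcl w hw (Metric.mem_closedBall_self hr0.le)))
      ).hasDerivAt
  -- The z-derivative is measurable in t as a limit of difference quotients; the steps r/(n+2) keep
  -- the shifted point inside `U`.
  have hmd : AEStronglyMeasurable (fun t => deriv (fun y => F y t) z) μ := by
    have hu : Tendsto (fun n : ℕ => ((r / (n + 2) : ℝ) : ℂ)) atTop (𝓝[≠] 0) := by
      refine tendsto_nhdsWithin_iff.2 ⟨?_, Eventually.of_forall fun n => ?_⟩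
      · have : Tendsto (fun n : ℕ => (r / (n + 2) : ℝ)) atTop (𝓝 0) := by
          refine Tendsto.div_atTop tendsto_const_nhds ?_
          exact tendsto_atTop_add_const_right _ _ tendsto_natCast_atTop_atTop
        exact_mod_cast (Complex.continuous_ofReal.tendsto 0).comp this
      · have : (r / (n + 2) : ℝ) ≠ 0 := by positivity
        exact Complex.ofReal_ne_zero.2 this
    refine aestronglyMeasurable_of_tendsto_ae atTop
      (f := fun (n : ℕ) t => (((r / (n + 2) : ℝ) : ℂ))⁻¹ •
        (F (z + ((r / (n + 2) : ℝ) : ℂ)) t - F z t)) (fun n => ?_) ?_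
    · have hz' : z + ((r / (n + 2) : ℝ) : ℂ) ∈ U := ?_
      · exact ((hmeas _ hz').sub (hmeas z hz)).const_smul (((r / (n + 2) : ℝ) : ℂ))⁻¹
      apply hball
      rw [Metric.mem_ball, dist_self_add_left, Complex.norm_real, Real.norm_eq_abs,
        abs_of_pos (by positivity)]
      rw [div_lt_iff₀ (by positivity)]
      have : (0 : ℝ) ≤ n := by positivity
      nlinarith
    · filter_upwards [hderiv] with t ht
      exact (hasDerivAt_iff_tendsto_slope_zero.1 (ht z (Metric.mem_ball_self hr0))).comp hu
  have key := hasDerivAt_integral_of_dominated_loc_of_lip (μ := μ) (F := F) (x₀ := z)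
    (F' := fun t => deriv (fun y => F y t) z)
    (bound := fun t => bound t / r) (Metric.ball_mem_nhds z hr0) ?_ ?_ hmd ?_
    (hint.div_const r) ?_
  · exact key.2.differentiableAt.differentiableWithinAt
  · filter_upwards [hU.mem_nhds hz] with w hw using hmeas w hw
  · exact hint.mono' (hmeas z hz) (by filter_upwards [hb] with t ht using ht z hz)
  · filter_upwards [hd, hderiv, hb] with t htd ht htb
    have h0 : 0 ≤ bound t := (norm_nonneg _).trans (htb z hz)
    refine Convex.lipschitzOnWith_of_nnnorm_hasDerivWithin_le (convex_ball z r)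
      (fun w hw => (ht w hw).hasDerivWithinAt) fun w hw => ?_
    rw [← NNReal.coe_le_coe, coe_nnnorm, Real.coe_nnabs, abs_of_nonneg (by positivity)]
    refine Complex.norm_deriv_le_of_forall_mem_sphere_norm_le hr0 ?_ fun y hy =>
      htb y (hcl w hw (Metric.sphere_subset_closedBall hy))
    exact (htd.mono (hcl w hw)).diffContOnCl_ball Subset.rfl
  · filter_upwards [hderiv] with t ht using ht z (Metric.mem_ball_self hr0)

/-! ### Iterated tail integrals -/

theorem integrable_Ioi_mul_tail_pow {k : ℝ → ℝ} (hk : Integrable k) (h0 : ∀ t, 0 ≤ k t) (n : ℕ) :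
    Integrable (fun t => k t * (∫ s in Ioi t, k s) ^ n) := by
  have hc : Continuous fun t => ∫ s in Ioi t, k s := by
    have : (fun t => ∫ s in Ioi t, k s) = fun t => (∫ s in Ioi 0, k s) - ∫ s in (0 : ℝ)..t, k s := by
      ext t
      have := intervalIntegral.integral_interval_add_Ioi' (a := 0) (b := t) (f := k) (μ := volume)
        hk.intervalIntegrable hk.integrableOn
      linarith
    rw [this]
    exact continuous_const.sub (intervalIntegral.continuous_primitive
      (fun _ _ => hk.intervalIntegrable) 0)
  refine hk.mul_bdd (c := (∫ s, k s) ^ n) (hc.pow n).aestronglyMeasurable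
    (Eventually.of_forall fun t => ?_)
  rw [norm_pow, Real.norm_eq_abs, abs_of_nonneg (setIntegral_nonneg measurableSet_Ioi
    fun s _ => h0 s)]
  exact pow_le_pow_left₀ (setIntegral_nonneg measurableSet_Ioi fun s _ => h0 s)
    (setIntegral_le_integral hk (Eventually.of_forall h0)) n

/-- The tail J has J' = -k almost everywhere, so k Jⁿ is the derivative of -Jⁿ⁺¹/(n+1). Integrate up
to T and drop the nonnegative term at T. This is the source of the factorials in the Volterra
series. -/
theorem integral_Ioi_mul_tail_pow_le {k : ℝ → ℝ} (hk : Integrable k) (h0 : ∀ t, 0 ≤ k t) (n : ℕ)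
    (x : ℝ) : ∫ t in Ioi x, k t * (∫ s in Ioi t, k s) ^ n ≤
      (∫ s in Ioi x, k s) ^ (n + 1) / (n + 1) := by
  set J := fun t => ∫ s in Ioi t, k s with hJ
  have hJ0 : ∀ t, 0 ≤ J t := fun t => setIntegral_nonneg measurableSet_Ioi fun s _ => h0 s
  refine le_of_tendsto (intervalIntegral_tendsto_integral_Ioi x
    (integrable_Ioi_mul_tail_pow hk h0 n).integrableOn tendsto_id) ?_
  filter_upwards [eventually_ge_atTop x] with T hT
  simp only [id]
  have hJeq : ∀ t, J t = J x - ∫ s in x..t, k s := by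
    intro t
    have := intervalIntegral.integral_interval_add_Ioi' (a := x) (b := t) (f := k) (μ := volume)
      hk.intervalIntegrable hk.integrableOn
    simp only [hJ]; linarith
  have hac : AbsolutelyContinuousOnInterval J x T := by
    have := (hk.intervalIntegrable (a := x) (b := T)
      ).absolutelyContinuousOnInterval_intervalIntegral (c := x) (by simp)
    have h2 : J = fun t => J x - ∫ s in x..t, k s := funext hJeq
    rw [h2]
    exact (LipschitzOnWith.absolutelyContinuousOnInterval (K := 0)
      ((LipschitzWith.const (J x)).lipschitzOnWith)).sub this
  have hpow : ∀ j : ℕ, AbsolutelyContinuousOnInterval (fun t => J t ^ (j + 1)) x T := by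
    intro j
    induction j with
    | zero => simpa using hac
    | succ j ih => simpa only [pow_succ] using ih.fun_mul hac
  have hde : ∀ᵐ t, deriv (fun t => J t ^ (n + 1)) t = -((n + 1) * (k t * J t ^ n)) := by
    filter_upwards [_root_.LocallyIntegrable.ae_hasDerivAt_integral hk.locallyIntegrable] with t ht
    have h1 : HasDerivAt J (-k t) t := by
      have h2 : J = fun t => J x - ∫ s in x..t, k s := funext hJeq
      rw [h2]
      simpa using (ht x).const_sub (J x)
    rw [(h1.fun_pow (n + 1)).deriv]
    push_cast
    ring
  have hF := (hpow n).integral_deriv_eq_sub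
  rw [intervalIntegral.integral_congr_ae (hde.mono fun t ht _ => ht),
    intervalIntegral.integral_neg, intervalIntegral.integral_const_mul] at hF
  rw [le_div_iff₀ (by positivity)]
  have := pow_nonneg (hJ0 T) (n + 1)
  linarith

end ParametricIntegrals

section Volterra

/-! ### The Volterra kernel of the Jost equation -/

theorem norm_exp_jost_le {ζ : ℂ} (hζ : 0 ≤ ζ.im) {s : ℝ} (hs : 0 ≤ s) :
    ‖Complex.exp (2 * Complex.I * ζ * s)‖ ≤ 1 := by
  rw [Complex.norm_exp, Real.exp_le_one_iff]
  simp
  positivity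

/-- The kernel `∫₀^{s⁺} e^{2iζσ} dσ`. -/
noncomputable def jostKernel (ζ : ℂ) (s : ℝ) : ℂ :=
  ∫ σ in (0 : ℝ)..max s 0, Complex.exp (2 * Complex.I * ζ * σ)

theorem continuous_exp_jost (ζ : ℂ) :
    Continuous fun σ : ℝ => Complex.exp (2 * Complex.I * ζ * σ) := by fun_prop

theorem jostKernel_of_nonpos (ζ : ℂ) {s : ℝ} (hs : s ≤ 0) : jostKernel ζ s = 0 := by
  simp [jostKernel, max_eq_right hs]

theorem jostKernel_of_ne_zero {ζ : ℂ} (hζ : ζ ≠ 0) (s : ℝ) :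
    jostKernel ζ s = (Complex.exp (2 * Complex.I * ζ * (max s 0 : ℝ)) - 1) / (2 * Complex.I * ζ) := by
  rw [jostKernel, integral_exp_mul_complex (by simp [hζ])]
  simp

/-- Factoring out the entire function (e^w - 1)/w removes the apparent singularity at ζ = 0, so
analyticity in ζ and joint continuity hold there as well. -/
theorem jostKernel_eq_dslope (ζ : ℂ) (s : ℝ) :
    jostKernel ζ s = (max s 0 : ℝ) *
      dslope Complex.exp 0 (2 * Complex.I * ζ * (max s 0 : ℝ)) := by
  rcases eq_or_ne ζ 0 with rfl | hζ
  · simp [jostKernel, dslope_same]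
  · rw [jostKernel_of_ne_zero hζ]
    have h := sub_smul_dslope Complex.exp 0 (2 * Complex.I * ζ * (max s 0 : ℝ))
    rw [Complex.exp_zero, sub_zero, smul_eq_mul] at h
    have h2 : (2 * Complex.I * ζ) ≠ 0 := by simp [hζ]
    rw [← h]
    field_simp

theorem differentiable_dslope_exp : Differentiable ℂ (dslope Complex.exp 0) := by
  have := (Complex.differentiableOn_dslope (c := (0 : ℂ)) (s := univ) univ_mem (f := Complex.exp)).2
    Complex.differentiable_exp.differentiableOn
  exact differentiableOn_univ.1 this

theorem differentiable_jostKernel (s : ℝ) : Differentiable ℂ fun ζ => jostKernel ζ s := by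
  simp only [jostKernel_eq_dslope]
  have := differentiable_dslope_exp
  fun_prop

theorem continuous_jostKernel : Continuous fun z : ℂ × ℝ => jostKernel z.1 z.2 := by
  simp only [jostKernel_eq_dslope]
  have := differentiable_dslope_exp.continuous
  fun_prop

theorem norm_jostKernel_sub_le {ζ : ℂ} (hζ : 0 ≤ ζ.im) (s s' : ℝ) :
    ‖jostKernel ζ s - jostKernel ζ s'‖ ≤ |s - s'| := by
  have hc := continuous_exp_jost ζ
  rw [jostKernel, jostKernel, intervalIntegral.integral_interval_sub_left
    (hc.intervalIntegrable _ _) (hc.intervalIntegrable _ _)]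
  refine (intervalIntegral.norm_integral_le_of_norm_le_const (C := 1) fun σ hσ => ?_).trans ?_
  · refine norm_exp_jost_le hζ ?_
    have := hσ.1
    exact le_trans (le_min (le_max_right _ _) (le_max_right _ _)) this.le
  · rw [one_mul]
    exact abs_max_sub_max_le_abs _ _ _

theorem norm_jostKernel_le {ζ : ℂ} (hζ : 0 ≤ ζ.im) (s : ℝ) : ‖jostKernel ζ s‖ ≤ max s 0 := by
  rcases le_total s 0 with h | h
  · rw [jostKernel_of_nonpos ζ h]; simp
  · have := norm_jostKernel_sub_le hζ s 0
    rw [jostKernel_of_nonpos ζ le_rfl, sub_zero, sub_zero, abs_of_nonneg h] at this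
    exact this.trans (le_max_left _ _)

/-- Complements `norm_jostKernel_le`: the linear bound is uniform down to ζ = 0 but costs a first
moment, while this one needs only integrability of p and yields the 1/|ζ| decay at high energy. -/
theorem norm_jostKernel_le_inv {ζ : ℂ} (hζ : 0 ≤ ζ.im) (h0 : ζ ≠ 0) (s : ℝ) :
    ‖jostKernel ζ s‖ ≤ 1 / ‖ζ‖ := by
  rw [jostKernel_of_ne_zero h0, norm_div]
  have h1 : ‖Complex.exp (2 * Complex.I * ζ * (max s 0 : ℝ)) - 1‖ ≤ 2 := by
    refine (norm_sub_le _ _).trans ?_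
    have := norm_exp_jost_le hζ (le_max_right s 0)
    rw [norm_one]; linarith
  have h2 : ‖2 * Complex.I * ζ‖ = 2 * ‖ζ‖ := by simp
  have h3 : 0 < ‖ζ‖ := norm_pos_iff.2 h0
  rw [h2, div_le_div_iff₀ (by positivity) h3]
  nlinarith

theorem hasDerivAt_jostKernel (ζ : ℂ) {s : ℝ} (hs : s ≠ 0) :
    HasDerivAt (jostKernel ζ) (if 0 < s then Complex.exp (2 * Complex.I * ζ * s) else 0) s := by
  rcases lt_or_gt_of_ne hs with h | h
  · rw [if_neg (not_lt.2 h.le)]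
    refine (hasDerivAt_const s (0 : ℂ)).congr_of_eventuallyEq ?_
    filter_upwards [Iio_mem_nhds h] with t ht using jostKernel_of_nonpos ζ (le_of_lt ht)
  · rw [if_pos h]
    have hc := continuous_exp_jost ζ
    have := intervalIntegral.integral_hasDerivAt_right (hc.intervalIntegrable 0 s)
      hc.stronglyMeasurable.stronglyMeasurableAtFilter hc.continuousAt
    refine this.congr_of_eventuallyEq ?_
    filter_upwards [Ioi_mem_nhds h] with t ht
    rw [jostKernel, max_eq_left (le_of_lt ht)]

/-- For a real potential this becomes the symmetry ζ ↦ -conj ζ of all Jost data. It sends real ξ to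
-ξ and fixes the imaginary axis, where the data are thus real. -/
theorem jostKernel_conj (ζ : ℂ) (s : ℝ) :
    jostKernel (-(starRingEnd ℂ) ζ) s = (starRingEnd ℂ) (jostKernel ζ s) := by
  rw [jostKernel, jostKernel, intervalIntegral.integral_of_le (le_max_right _ _),
    intervalIntegral.integral_of_le (le_max_right _ _), ← integral_conj]
  congr 1; ext σ
  rw [← Complex.exp_conj]
  simp [map_ofNat]

/-! ### The Jost solution on the half-line -/

/-- A complex potential with integrable first moment. -/
structure HasMoment (p : ℝ → ℂ) : Prop where
  meas : AEStronglyMeasurable p volume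
  int : Integrable (fun t : ℝ => (1 + |t|) * ‖p t‖) volume

namespace HasMoment
variable {p : ℝ → ℂ}

theorem integrable (hp : HasMoment p) : Integrable p := by
  refine hp.int.mono' hp.meas (Eventually.of_forall fun t => ?_)
  nlinarith [norm_nonneg (p t), abs_nonneg t]

theorem integrable_abs_mul (hp : HasMoment p) : Integrable (fun t => |t| * ‖p t‖) := by
  refine hp.int.mono' (continuous_abs.aestronglyMeasurable.mul hp.meas.norm)
    (Eventually.of_forall fun t => ?_)
  rw [norm_mul, norm_norm, Real.norm_eq_abs, abs_abs]
  nlinarith [norm_nonneg (p t), abs_nonneg t]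

end HasMoment

/-- Picard iterates of the Jost equation. -/
noncomputable def jostIter (p : ℝ → ℂ) (ζ : ℂ) : ℕ → ℝ → ℂ
  | 0, _ => 1
  | n + 1, x => ∫ t in Ioi (0 : ℝ), jostKernel ζ (t - max x 0) * (p t * jostIter p ζ n t)

/-- The tail of the first moment. -/
noncomputable def momentTail (p : ℝ → ℂ) (x : ℝ) : ℝ := ∫ t in Ioi x, |t| * ‖p t‖

variable {p : ℝ → ℂ}

theorem momentTail_nonneg (x : ℝ) : 0 ≤ momentTail p x :=
  setIntegral_nonneg measurableSet_Ioi fun t _ => by positivity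

theorem momentTail_anti (hp : HasMoment p) : Antitone (momentTail p) := fun x y hxy =>
  setIntegral_mono_set hp.integrable_abs_mul.integrableOn
    (Eventually.of_forall fun t => by positivity) (Ioi_subset_Ioi hxy).eventuallyLE

theorem norm_jostKernel_shift_le {ζ : ℂ} (hζ : 0 ≤ ζ.im) {t : ℝ} (ht : 0 < t) (x : ℝ) :
    ‖jostKernel ζ (t - max x 0)‖ ≤ |t| := by
  refine (norm_jostKernel_le hζ _).trans ?_
  rw [abs_of_pos ht]
  exact max_le (by linarith [le_max_right x 0]) ht.le

/-- Continuity and the factorial bound are proved together, because dominated convergence for one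
iterate uses both for the previous one. The kernel vanishes for t ≤ x, so the integral can be taken
over a domain independent of x when proving continuity and over the tail beyond x when estimating.
-/
theorem jostIter_aux (hp : HasMoment p) (n : ℕ) :
    ContinuousOn (fun z : ℂ × ℝ => jostIter p z.1 n z.2) ({ζ : ℂ | 0 ≤ ζ.im} ×ˢ univ) ∧
    ∀ ζ : ℂ, 0 ≤ ζ.im → ∀ x, ‖jostIter p ζ n x‖ ≤ momentTail p (max x 0) ^ n / n.factorial := by
  induction n with
  | zero => simp [jostIter, continuousOn_const]
  | succ n ih =>
    obtain ⟨ihc, ihb⟩ := ih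
    have hcx : ∀ ζ : ℂ, 0 ≤ ζ.im → Continuous (jostIter p ζ n) := fun ζ hζ => by
      have : Continuous fun x : ℝ => ((ζ, x) : ℂ × ℝ) := by fun_prop
      exact ihc.comp_continuous this fun x => ⟨hζ, mem_univ _⟩
    have hb0 : ∀ ζ : ℂ, 0 ≤ ζ.im → ∀ x, ‖jostIter p ζ n x‖ ≤ momentTail p 0 ^ n / n.factorial :=
      fun ζ hζ x => (ihb ζ hζ x).trans (by
        gcongr
        · exact momentTail_nonneg _
        · exact momentTail_anti hp (le_max_right _ _))
    have hmeas : ∀ ζ : ℂ, 0 ≤ ζ.im → ∀ x, AEStronglyMeasurable (fun t =>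
        jostKernel ζ (t - max x 0) * (p t * jostIter p ζ n t)) (volume.restrict (Ioi 0)) :=
      fun ζ hζ x => by
        have h1 : Continuous fun t => jostKernel ζ (t - max x 0) := by
          have : Continuous fun t : ℝ => ((ζ, t - max x 0) : ℂ × ℝ) := by fun_prop
          exact continuous_jostKernel.comp this
        exact h1.aestronglyMeasurable.mul (hp.meas.restrict.mul (hcx ζ hζ).aestronglyMeasurable)
    constructor
    · simp only [jostIter]
      refine continuousOn_of_dominated
        (bound := fun t => |t| * ‖p t‖ * (momentTail p 0 ^ n / n.factorial)) ?_ ?_ ?_ ?_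
      · rintro ⟨ζ, x⟩ ⟨hζ, -⟩
        exact hmeas ζ hζ x
      · rintro ⟨ζ, x⟩ ⟨hζ, -⟩
        filter_upwards [ae_restrict_mem measurableSet_Ioi] with t ht
        rw [norm_mul, norm_mul, mul_assoc]
        have h1 := norm_jostKernel_shift_le hζ ht x
        have h2 := hb0 ζ hζ t
        gcongr
      · exact (hp.integrable_abs_mul.mul_const _).integrableOn
      · refine Eventually.of_forall fun t => ?_
        have h1 : Continuous fun z : ℂ × ℝ => jostKernel z.1 (t - max z.2 0) := by
          have : Continuous fun z : ℂ × ℝ => ((z.1, t - max z.2 0) : ℂ × ℝ) := by fun_prop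
          exact continuous_jostKernel.comp this
        have h2 : Continuous fun z : ℂ × ℝ => ((z.1, t) : ℂ × ℝ) := by fun_prop
        refine h1.continuousOn.mul (continuousOn_const.mul ?_)
        exact ihc.comp h2.continuousOn fun z hz => ⟨hz.1, mem_univ _⟩
    · intro ζ hζ x
      set x₀ := max x 0 with hx₀
      have hx0 : 0 ≤ x₀ := le_max_right _ _
      have hk0 : ∀ t, (0 : ℝ) ≤ |t| * ‖p t‖ := fun t => by positivity
      have hbi := integrable_Ioi_mul_tail_pow hp.integrable_abs_mul hk0 n
      have key := integral_Ioi_mul_tail_pow_le hp.integrable_abs_mul hk0 n x₀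
      have e1 : jostIter p ζ (n + 1) x =
          ∫ t in Ioi x₀, jostKernel ζ (t - x₀) * (p t * jostIter p ζ n t) := by
        simp only [jostIter]
        refine (setIntegral_eq_of_subset_of_forall_sdiff_eq_zero measurableSet_Ioi
          (Ioi_subset_Ioi hx0) fun t ht => ?_)
        rw [jostKernel_of_nonpos ζ (sub_nonpos.2 (not_lt.1 ht.2)), zero_mul]
      rw [e1]
      refine (norm_integral_le_of_norm_le (g := fun t => |t| * ‖p t‖ * momentTail p t ^ n *
        (1 / n.factorial)) (hbi.mul_const _).integrableOn ?_).trans ?_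
      · filter_upwards [ae_restrict_mem measurableSet_Ioi] with t ht
        have ht0 : 0 < t := lt_of_le_of_lt hx0 ht
        have h1 : ‖jostKernel ζ (t - x₀)‖ ≤ |t| := norm_jostKernel_shift_le hζ ht0 x
        have h2 := ihb ζ hζ t
        rw [max_eq_left ht0.le] at h2
        rw [norm_mul, norm_mul]
        calc ‖jostKernel ζ (t - x₀)‖ * (‖p t‖ * ‖jostIter p ζ n t‖)
            ≤ |t| * (‖p t‖ * (momentTail p t ^ n / n.factorial)) := by gcongr
          _ = _ := by ring
      · rw [integral_mul_const]
        refine (mul_le_mul_of_nonneg_right key (by positivity)).trans (le_of_eq ?_)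
        rw [Nat.factorial_succ]
        push_cast
        rw [div_mul_div_comm, mul_one]
        rfl

theorem norm_jostIter_le (hp : HasMoment p) {ζ : ℂ} (hζ : 0 ≤ ζ.im) (n : ℕ) (x : ℝ) :
    ‖jostIter p ζ n x‖ ≤ momentTail p 0 ^ n / n.factorial :=
  ((jostIter_aux hp n).2 ζ hζ x).trans (by
    gcongr
    · exact momentTail_nonneg _
    · exact momentTail_anti hp (le_max_right _ _))

theorem continuous_jostIter (hp : HasMoment p) {ζ : ℂ} (hζ : 0 ≤ ζ.im) (n : ℕ) :
    Continuous (jostIter p ζ n) := by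
  have : Continuous fun x : ℝ => ((ζ, x) : ℂ × ℝ) := by fun_prop
  exact (jostIter_aux hp n).1.comp_continuous this fun x => ⟨hζ, mem_univ _⟩

theorem aestronglyMeasurable_jostIntegrand (hp : HasMoment p) (ζ : ℂ) (x : ℝ) {g : ℝ → ℂ}
    (hg : Continuous g) : AEStronglyMeasurable (fun t =>
      jostKernel ζ (t - max x 0) * (p t * g t)) (volume.restrict (Ioi 0)) := by
  have h1 : Continuous fun t => jostKernel ζ (t - max x 0) := by
    have : Continuous fun t : ℝ => ((ζ, t - max x 0) : ℂ × ℝ) := by fun_prop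
    exact continuous_jostKernel.comp this
  exact h1.aestronglyMeasurable.mul (hp.meas.restrict.mul hg.aestronglyMeasurable)

theorem differentiableOn_jostIter (hp : HasMoment p) (n : ℕ) (x : ℝ) :
    DifferentiableOn ℂ (fun ζ => jostIter p ζ n x) {ζ : ℂ | 0 < ζ.im} := by
  induction n generalizing x with
  | zero => simp [jostIter]
  | succ n ih =>
    simp only [jostIter]
    refine differentiableOn_integral_of_dominated
      (bound := fun t => |t| * ‖p t‖ * (momentTail p 0 ^ n / n.factorial))
      (isOpen_lt continuous_const Complex.continuous_im) (fun ζ hζ => ?_) ?_ ?_ ?_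
    · exact aestronglyMeasurable_jostIntegrand hp ζ x (continuous_jostIter hp (le_of_lt hζ) n)
    · refine Eventually.of_forall fun t => ?_
      exact (differentiable_jostKernel _).differentiableOn.mul ((ih t).const_mul _)
    · filter_upwards [ae_restrict_mem measurableSet_Ioi] with t ht ζ hζ
      have hζ' : 0 ≤ ζ.im := le_of_lt hζ
      rw [norm_mul, norm_mul, mul_assoc]
      have h1 := norm_jostKernel_shift_le hζ' ht x
      have h2 := norm_jostIter_le hp hζ' n t
      gcongr
    · exact (hp.integrable_abs_mul.mul_const _).integrableOn

theorem jostIter_conj (hp : ∀ t, (starRingEnd ℂ) (p t) = p t) (ζ : ℂ) (n : ℕ) (x : ℝ) :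
    jostIter p (-(starRingEnd ℂ) ζ) n x = (starRingEnd ℂ) (jostIter p ζ n x) := by
  induction n generalizing x with
  | zero => simp [jostIter]
  | succ n ih =>
    simp only [jostIter, ← integral_conj, map_mul, jostKernel_conj, ih, hp]

/-- The amplitude `m` of the Jost solution `e^{iζx} m(x, ζ)` on the half-line `x ≥ 0`. -/
noncomputable def jostM (p : ℝ → ℂ) (ζ : ℂ) (x : ℝ) : ℂ := ∑' n, jostIter p ζ n x

theorem summable_jostBound (p : ℝ → ℂ) :
    Summable fun n : ℕ => momentTail p 0 ^ n / n.factorial :=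
  Real.summable_pow_div_factorial _

theorem jostM_continuousOn (hp : HasMoment p) :
    ContinuousOn (fun z : ℂ × ℝ => jostM p z.1 z.2) ({ζ : ℂ | 0 ≤ ζ.im} ×ˢ univ) :=
  continuousOn_tsum (fun n => (jostIter_aux hp n).1) (summable_jostBound p)
    fun n z hz => norm_jostIter_le hp hz.1 n z.2

theorem continuous_jostM (hp : HasMoment p) {ζ : ℂ} (hζ : 0 ≤ ζ.im) : Continuous (jostM p ζ) := by
  have : Continuous fun x : ℝ => ((ζ, x) : ℂ × ℝ) := by fun_prop
  exact (jostM_continuousOn hp).comp_continuous this fun x => ⟨hζ, mem_univ _⟩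

theorem continuousOn_jostM_spectral (hp : HasMoment p) (x : ℝ) :
    ContinuousOn (fun ζ => jostM p ζ x) {ζ : ℂ | 0 ≤ ζ.im} := by
  have : Continuous fun ζ : ℂ => ((ζ, x) : ℂ × ℝ) := by fun_prop
  exact (jostM_continuousOn hp).comp this.continuousOn fun ζ hζ => ⟨hζ, mem_univ _⟩

theorem differentiableOn_jostM (hp : HasMoment p) (x : ℝ) :
    DifferentiableOn ℂ (fun ζ => jostM p ζ x) {ζ : ℂ | 0 < ζ.im} :=
  Complex.differentiableOn_tsum_of_summable_norm (summable_jostBound p)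
    (fun n => differentiableOn_jostIter hp n x) (isOpen_lt continuous_const Complex.continuous_im)
    fun n _ hζ => norm_jostIter_le hp (le_of_lt hζ) n x

theorem norm_jostM_le (hp : HasMoment p) {ζ : ℂ} (hζ : 0 ≤ ζ.im) (x : ℝ) :
    ‖jostM p ζ x‖ ≤ Real.exp (momentTail p 0) := by
  rw [Real.exp_eq_exp_ℝ, NormedSpace.exp_eq_tsum_div]
  exact tsum_of_norm_bounded (summable_jostBound p).hasSum fun n => norm_jostIter_le hp hζ n x

theorem jostM_conj (hp : ∀ t, (starRingEnd ℂ) (p t) = p t) (ζ : ℂ) (x : ℝ) :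
    jostM p (-(starRingEnd ℂ) ζ) x = (starRingEnd ℂ) (jostM p ζ x) := by
  simp only [jostM, Complex.conj_tsum, jostIter_conj hp]

theorem jostM_eq (hp : HasMoment p) {ζ : ℂ} (hζ : 0 ≤ ζ.im) (x : ℝ) :
    jostM p ζ x = 1 + ∫ t in Ioi (0 : ℝ), jostKernel ζ (t - max x 0) * (p t * jostM p ζ t) := by
  have hs : ∀ y, Summable fun n => jostIter p ζ n y := fun y =>
    Summable.of_norm_bounded (summable_jostBound p) fun n => norm_jostIter_le hp hζ n y
  rw [jostM, (hs x).tsum_eq_zero_add]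
  congr 1
  have key := hasSum_integral_of_dominated_convergence (μ := volume.restrict (Ioi (0 : ℝ)))
    (F := fun n t => jostKernel ζ (t - max x 0) * (p t * jostIter p ζ n t))
    (f := fun t => jostKernel ζ (t - max x 0) * (p t * jostM p ζ t))
    (fun n t => |t| * ‖p t‖ * (momentTail p 0 ^ n / n.factorial)) (fun n => ?_) (fun n => ?_)
    (Eventually.of_forall fun t => (summable_jostBound p).mul_left _) ?_ ?_
  · exact key.tsum_eq
  · exact aestronglyMeasurable_jostIntegrand hp ζ x (continuous_jostIter hp hζ n)
  · filter_upwards [ae_restrict_mem measurableSet_Ioi] with t ht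
    rw [norm_mul, norm_mul, mul_assoc]
    have h1 := norm_jostKernel_shift_le hζ ht x
    have h2 := norm_jostIter_le hp hζ n t
    gcongr
  · simp only [tsum_mul_left]
    exact (hp.integrable_abs_mul.mul_const _).integrableOn
  · exact Eventually.of_forall fun t => ((hs t).hasSum.mul_left _).mul_left _

end Volterra

/-! ### The Jost solution on the half-line: derivative, asymptotics, differential equation. -/

section JostSolution

theorem tendsto_integral_Ioi_atTop {g : ℝ → ℝ} (hg : Integrable g) :
    Tendsto (fun x => ∫ t in Ioi x, g t) atTop (𝓝 0) := by
  have h1 := intervalIntegral_tendsto_integral_Ioi 0 hg.integrableOn tendsto_id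
  have h2 : (fun x => ∫ t in Ioi x, g t) =
      fun x => (∫ t in Ioi 0, g t) - ∫ t in (0 : ℝ)..id x, g t := by
    ext x
    have := intervalIntegral.integral_interval_add_Ioi' (a := 0) (b := x) (f := g) (μ := volume)
      hg.intervalIntegrable hg.integrableOn
    simp only [id]; linarith
  rw [h2]
  simpa using (tendsto_const_nhds (x := ∫ t in Ioi 0, g t)).sub h1

theorem hasDerivAt_cexp_mul_ofReal (c : ℂ) (x : ℝ) :
    HasDerivAt (fun x : ℝ => Complex.exp (c * x)) (Complex.exp (c * x) * c) x := by
  simpa using ((hasDerivAt_id x).ofReal_comp.const_mul c).cexp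

theorem absolutelyContinuousOnInterval_cexp_mul (c : ℂ) (a b : ℝ) :
    AbsolutelyContinuousOnInterval (fun x : ℝ => Complex.exp (c * x)) a b :=
  absolutelyContinuousOnInterval_of_hasDerivAt (fun x _ => hasDerivAt_cexp_mul_ofReal c x)
    (by fun_prop)

variable {p : ℝ → ℂ}

/-- The derivative of `jostM` in the space variable. -/
noncomputable def jostN (p : ℝ → ℂ) (ζ : ℂ) (x : ℝ) : ℂ :=
  -∫ t in Ioi (max x 0), Complex.exp (2 * Complex.I * ζ * (t - max x 0 : ℝ)) * (p t * jostM p ζ t)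

theorem integrable_mul_jostM (hp : HasMoment p) {ζ : ℂ} (hζ : 0 ≤ ζ.im) :
    Integrable fun t => p t * jostM p ζ t :=
  hp.integrable.mul_bdd (c := Real.exp (momentTail p 0))
    (continuous_jostM hp hζ).aestronglyMeasurable
    (Eventually.of_forall fun t => norm_jostM_le hp hζ t)

theorem norm_jostN_integrand_le (hp : HasMoment p) {ζ : ℂ} (hζ : 0 ≤ ζ.im) {x t : ℝ} (ht : x < t) :
    ‖Complex.exp (2 * Complex.I * ζ * (t - x : ℝ)) * (p t * jostM p ζ t)‖ ≤
      ‖p t‖ * Real.exp (momentTail p 0) := by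
  rw [norm_mul, norm_mul]
  have h1 := norm_exp_jost_le hζ (sub_nonneg.2 ht.le)
  have h2 := norm_jostM_le hp hζ t
  calc _ ≤ 1 * (‖p t‖ * Real.exp (momentTail p 0)) := by gcongr
    _ = _ := one_mul _

theorem norm_jostN_le (hp : HasMoment p) {ζ : ℂ} (hζ : 0 ≤ ζ.im) (x : ℝ) :
    ‖jostN p ζ x‖ ≤ (∫ t in Ioi (max x 0), ‖p t‖) * Real.exp (momentTail p 0) := by
  rw [jostN, norm_neg, ← integral_mul_const]
  refine norm_integral_le_of_norm_le (hp.integrable.norm.mul_const _).integrableOn ?_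
  filter_upwards [ae_restrict_mem measurableSet_Ioi] with t ht
  exact norm_jostN_integrand_le hp hζ ht

theorem tendsto_jostN (hp : HasMoment p) {ζ : ℂ} (hζ : 0 ≤ ζ.im) :
    Tendsto (jostN p ζ) atTop (𝓝 0) := by
  have h := (tendsto_integral_Ioi_atTop hp.integrable.norm).mul_const (Real.exp (momentTail p 0))
  rw [zero_mul] at h
  refine squeeze_zero_norm' ?_ h
  filter_upwards [eventually_ge_atTop 0] with x hx
  simpa [max_eq_left hx] using norm_jostN_le hp hζ x

theorem aestronglyMeasurable_jostN_integrand (hp : HasMoment p) {ζ : ℂ} (hζ : 0 ≤ ζ.im) (x : ℝ)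
    (s : Set ℝ) : AEStronglyMeasurable (fun t : ℝ =>
      Complex.exp (2 * Complex.I * ζ * (t - x : ℝ)) * (p t * jostM p ζ t)) (volume.restrict s) := by
  have : Continuous fun t : ℝ => Complex.exp (2 * Complex.I * ζ * (t - x : ℝ)) := by fun_prop
  exact this.aestronglyMeasurable.mul (integrable_mul_jostM hp hζ).aestronglyMeasurable.restrict

theorem continuousOn_jostN_spectral (hp : HasMoment p) (x : ℝ) :
    ContinuousOn (fun ζ => jostN p ζ x) {ζ : ℂ | 0 ≤ ζ.im} := by
  refine ContinuousOn.neg (continuousOn_of_dominated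
    (bound := fun t => ‖p t‖ * Real.exp (momentTail p 0)) ?_ ?_ ?_ ?_)
  · intro ζ hζ
    exact aestronglyMeasurable_jostN_integrand hp hζ _ _
  · intro ζ hζ
    filter_upwards [ae_restrict_mem measurableSet_Ioi] with t ht
    exact norm_jostN_integrand_le hp hζ ht
  · exact (hp.integrable.norm.mul_const _).integrableOn
  · refine Eventually.of_forall fun t => ContinuousOn.mul ?_
      (continuousOn_const.mul (continuousOn_jostM_spectral hp t))
    fun_prop

theorem differentiableOn_jostN (hp : HasMoment p) (x : ℝ) :
    DifferentiableOn ℂ (fun ζ => jostN p ζ x) {ζ : ℂ | 0 < ζ.im} := by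
  refine DifferentiableOn.neg (differentiableOn_integral_of_dominated
    (bound := fun t => ‖p t‖ * Real.exp (momentTail p 0))
    (isOpen_lt continuous_const Complex.continuous_im) ?_ ?_ ?_ ?_)
  · intro ζ hζ
    exact aestronglyMeasurable_jostN_integrand hp (le_of_lt hζ) _ _
  · refine Eventually.of_forall fun t => DifferentiableOn.mul ?_
      ((differentiableOn_jostM hp t).const_mul _)
    fun_prop
  · filter_upwards [ae_restrict_mem measurableSet_Ioi] with t ht ζ hζ
    exact norm_jostN_integrand_le hp (le_of_lt hζ) ht
  · exact (hp.integrable.norm.mul_const _).integrableOn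

theorem jostN_conj (hp : ∀ t, (starRingEnd ℂ) (p t) = p t) (ζ : ℂ) (x : ℝ) :
    jostN p (-(starRingEnd ℂ) ζ) x = (starRingEnd ℂ) (jostN p ζ x) := by
  simp only [jostN, ← integral_conj, map_mul, jostM_conj hp, hp, map_neg, ← Complex.exp_conj,
    Complex.conj_ofReal, Complex.conj_I, map_ofNat]
  congr 2; ext t; congr 2; ring

theorem norm_jostM_sub_one_le_tail (hp : HasMoment p) {ζ : ℂ} (hζ : 0 ≤ ζ.im) {x : ℝ}
    (hx : 0 ≤ x) : ‖jostM p ζ x - 1‖ ≤ momentTail p x * Real.exp (momentTail p 0) := by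
  rw [jostM_eq hp hζ, add_sub_cancel_left, max_eq_left hx]
  have e1 : ∫ t in Ioi (0 : ℝ), jostKernel ζ (t - x) * (p t * jostM p ζ t) =
      ∫ t in Ioi x, jostKernel ζ (t - x) * (p t * jostM p ζ t) :=
    setIntegral_eq_of_subset_of_forall_sdiff_eq_zero measurableSet_Ioi (Ioi_subset_Ioi hx)
      fun t ht => by rw [jostKernel_of_nonpos ζ (sub_nonpos.2 (not_lt.1 ht.2)), zero_mul]
  rw [e1, momentTail, ← integral_mul_const]
  refine norm_integral_le_of_norm_le (hp.integrable_abs_mul.mul_const _).integrableOn ?_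
  filter_upwards [ae_restrict_mem measurableSet_Ioi] with t ht
  have h1 := norm_jostKernel_shift_le hζ (lt_of_le_of_lt hx (mem_Ioi.1 ht)) x
  rw [max_eq_left hx] at h1
  rw [norm_mul, norm_mul, mul_assoc]
  have h2 := norm_jostM_le hp hζ t
  gcongr

theorem tendsto_jostM (hp : HasMoment p) {ζ : ℂ} (hζ : 0 ≤ ζ.im) :
    Tendsto (jostM p ζ) atTop (𝓝 1) := by
  have h := (tendsto_integral_Ioi_atTop hp.integrable_abs_mul).mul_const
    (Real.exp (momentTail p 0))
  rw [zero_mul] at h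
  rw [tendsto_iff_norm_sub_tendsto_zero]
  refine squeeze_zero' (Eventually.of_forall fun x => norm_nonneg _) ?_ h
  filter_upwards [eventually_ge_atTop 0] with x hx using norm_jostM_sub_one_le_tail hp hζ hx

theorem norm_jostM_sub_one_le (hp : HasMoment p) {ζ : ℂ} (hζ : 0 ≤ ζ.im) (h0 : ζ ≠ 0) (x : ℝ) :
    ‖jostM p ζ x - 1‖ ≤ (∫ t in Ioi 0, ‖p t‖) * Real.exp (momentTail p 0) / ‖ζ‖ := by
  rw [jostM_eq hp hζ, add_sub_cancel_left, mul_div_assoc, ← integral_mul_const]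
  refine norm_integral_le_of_norm_le (hp.integrable.norm.mul_const _).integrableOn ?_
  refine Eventually.of_forall fun t => ?_
  have h1 := norm_jostKernel_le_inv hζ h0 (t - max x 0)
  have h2 := norm_jostM_le hp hζ t
  rw [norm_mul, norm_mul]
  calc ‖jostKernel ζ (t - max x 0)‖ * (‖p t‖ * ‖jostM p ζ t‖)
      ≤ 1 / ‖ζ‖ * (‖p t‖ * Real.exp (momentTail p 0)) := by gcongr
    _ = _ := by ring

/-- Differentiation under the Volterra integral. As a function of x the kernel is Lipschitz with a
single corner at x = t, and for given x this concerns only a null set of t. -/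
theorem hasDerivAt_jostM (hp : HasMoment p) {ζ : ℂ} (hζ : 0 ≤ ζ.im) {x : ℝ} (hx : 0 < x) :
    HasDerivAt (jostM p ζ) (jostN p ζ x) x := by
  have key := hasDerivAt_integral_of_dominated_loc_of_lip (𝕜 := ℝ) (x₀ := x) (s := Ioi 0)
    (μ := volume.restrict (Ioi (0 : ℝ)))
    (F := fun y t => jostKernel ζ (t - max y 0) * (p t * jostM p ζ t))
    (F' := fun t => (Ioi x).indicator (fun t =>
      -(Complex.exp (2 * Complex.I * ζ * (t - x : ℝ)) * (p t * jostM p ζ t))) t)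
    (bound := fun t => ‖p t * jostM p ζ t‖) (Ioi_mem_nhds hx) ?_ ?_ ?_ ?_ ?_ ?_
  · have h2 := key.2.const_add 1
    have e1 : (fun y => 1 + ∫ t in Ioi (0 : ℝ), jostKernel ζ (t - max y 0) *
        (p t * jostM p ζ t)) = jostM p ζ := by
      ext y; exact (jostM_eq hp hζ y).symm
    rw [e1] at h2
    refine h2.congr_deriv ?_
    rw [setIntegral_indicator measurableSet_Ioi, Ioi_inter_Ioi, max_eq_right hx.le, jostN,
      max_eq_left hx.le, integral_neg]
  · exact Eventually.of_forall fun y =>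
      aestronglyMeasurable_jostIntegrand hp ζ y (continuous_jostM hp hζ)
  · refine ((hp.integrable_abs_mul.mul_const (Real.exp (momentTail p 0))).integrableOn).mono'
      (aestronglyMeasurable_jostIntegrand hp ζ x (continuous_jostM hp hζ)) ?_
    filter_upwards [ae_restrict_mem measurableSet_Ioi] with t ht
    rw [norm_mul, norm_mul, mul_assoc]
    have h1 := norm_jostKernel_shift_le hζ ht x
    have h2 := norm_jostM_le hp hζ t
    gcongr
  · exact ((aestronglyMeasurable_jostN_integrand hp hζ x _).neg).indicator measurableSet_Ioi
  · refine Eventually.of_forall fun t => LipschitzOnWith.of_dist_le_mul fun y hy y' hy' => ?_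
    rw [dist_eq_norm, ← sub_mul, norm_mul, Real.coe_nnabs, abs_norm, mul_comm]
    gcongr
    refine (norm_jostKernel_sub_le hζ _ _).trans (le_of_eq ?_)
    rw [max_eq_left (le_of_lt hy), max_eq_left (le_of_lt hy'), Real.dist_eq, abs_sub_comm]
    congr 1; ring
  · exact (integrable_mul_jostM hp hζ).norm.integrableOn
  · have hne : ∀ᵐ t ∂(volume.restrict (Ioi (0 : ℝ))), t ≠ x :=
      ae_restrict_of_ae (Measure.ae_ne volume x)
    filter_upwards [hne] with t ht
    have h1 := hasDerivAt_jostKernel ζ (sub_ne_zero.2 ht)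
    have h2 : HasDerivAt (fun y : ℝ => t - y) (-1) x := by
      simpa using (hasDerivAt_id x).const_sub t
    have h3 := (h1.scomp x h2).mul_const (p t * jostM p ζ t)
    have h4 : HasDerivAt (fun y => jostKernel ζ (t - max y 0) * (p t * jostM p ζ t))
        ((-1 : ℝ) • (if 0 < t - x then Complex.exp (2 * Complex.I * ζ * (t - x : ℝ)) else 0) *
          (p t * jostM p ζ t)) x := by
      refine h3.congr_of_eventuallyEq ?_
      filter_upwards [Ioi_mem_nhds hx] with y hy
      rw [max_eq_left (le_of_lt hy)]; rfl
    refine h4.congr_deriv ?_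
    by_cases htx : x < t
    · rw [indicator_of_mem (mem_Ioi.2 htx), if_pos (sub_pos.2 htx)]
      simp
    · rw [indicator_of_notMem (fun h => htx (mem_Ioi.1 h)), if_neg (by simpa using htx)]
      simp

theorem integrableOn_exp_mul_jostM (hp : HasMoment p) {ζ : ℂ} (hζ : 0 ≤ ζ.im) :
    IntegrableOn (fun t : ℝ => Complex.exp (2 * Complex.I * ζ * t) * (p t * jostM p ζ t))
      (Ioi 0) := by
  refine ((hp.integrable.norm.mul_const (Real.exp (momentTail p 0))).integrableOn).mono' ?_ ?_
  · simpa using aestronglyMeasurable_jostN_integrand hp hζ 0 (Ioi 0)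
  · filter_upwards [ae_restrict_mem measurableSet_Ioi] with t ht
    simpa using norm_jostN_integrand_le hp hζ ht

/-- Pulling out e^{-2iζx} leaves a primitive of an integrable function. Continuity up to 0, absolute
continuity and the a.e. derivative of `jostN` are all read off from this form. -/
theorem jostN_eq (hp : HasMoment p) {ζ : ℂ} (hζ : 0 ≤ ζ.im) {x : ℝ} (hx : 0 ≤ x) :
    jostN p ζ x = -(Complex.exp (-(2 * Complex.I * ζ * x)) *
      ((∫ t in Ioi (0 : ℝ), Complex.exp (2 * Complex.I * ζ * t) * (p t * jostM p ζ t)) -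
        ∫ t in (0 : ℝ)..x, Complex.exp (2 * Complex.I * ζ * t) * (p t * jostM p ζ t))) := by
  have h := intervalIntegral.integral_interval_add_Ioi (μ := volume)
    (integrableOn_exp_mul_jostM hp hζ)
    ((integrableOn_exp_mul_jostM hp hζ).mono_set (Ioi_subset_Ioi hx))
  rw [← h, add_sub_cancel_left, jostN, max_eq_left hx, ← integral_const_mul]
  congr 2; ext t
  have h5 : Complex.exp (2 * Complex.I * ζ * (t - x : ℝ)) =
      Complex.exp (-(2 * Complex.I * ζ * x)) * Complex.exp (2 * Complex.I * ζ * t) := by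
    rw [← Complex.exp_add]; congr 1; push_cast; ring
  rw [h5]; ring

theorem intervalIntegrable_exp_mul_jostM (hp : HasMoment p) {ζ : ℂ} (hζ : 0 ≤ ζ.im) {a b : ℝ}
    (ha : 0 ≤ a) (hb : 0 ≤ b) : IntervalIntegrable
      (fun t : ℝ => Complex.exp (2 * Complex.I * ζ * t) * (p t * jostM p ζ t)) volume a b := by
  rw [intervalIntegrable_iff]
  refine (integrableOn_exp_mul_jostM hp hζ).mono_set fun t ht => ?_
  exact lt_of_le_of_lt (le_min ha hb) ht.1

theorem continuousOn_jostN (hp : HasMoment p) {ζ : ℂ} (hζ : 0 ≤ ζ.im) :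
    ContinuousOn (jostN p ζ) (Ici 0) := by
  have h1 : ContinuousOn (fun x : ℝ => -(Complex.exp (-(2 * Complex.I * ζ * x)) *
      ((∫ t in Ioi (0 : ℝ), Complex.exp (2 * Complex.I * ζ * t) * (p t * jostM p ζ t)) -
        ∫ t in (0 : ℝ)..x, Complex.exp (2 * Complex.I * ζ * t) * (p t * jostM p ζ t)))) (Ici 0) := by
    refine (ContinuousOn.mul (by fun_prop) (continuousOn_const.sub ?_)).neg
    intro x hx
    have hx : 0 ≤ x := hx
    have := intervalIntegral.continuousOn_primitive_interval
      (μ := volume) (a := 0) (b := x + 1)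
      (f := fun t : ℝ => Complex.exp (2 * Complex.I * ζ * t) * (p t * jostM p ζ t)) ?_
    · rw [uIcc_of_le (by linarith)] at this
      refine (this x ⟨hx, by linarith⟩).mono_of_mem_nhdsWithin ?_
      refine mem_nhdsWithin.2 ⟨Iio (x + 1), isOpen_Iio, by simp, fun y hy => ⟨hy.2, le_of_lt hy.1⟩⟩
    · rw [uIcc_of_le (by linarith), integrableOn_Icc_iff_integrableOn_Ioc]
      exact (integrableOn_exp_mul_jostM hp hζ).mono_set fun t ht => ht.1
  exact h1.congr fun x hx => jostN_eq hp hζ hx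

theorem jostN_ac (hp : HasMoment p) {ζ : ℂ} (hζ : 0 ≤ ζ.im) {a b : ℝ} (ha : 0 < a) (hab : a ≤ b) :
    AbsolutelyContinuousOnInterval (jostN p ζ) a b := by
  have h1 := absolutelyContinuousOnInterval_integral_complex
    (intervalIntegrable_exp_mul_jostM hp hζ (a := 0) (b := b) le_rfl (ha.le.trans hab))
    (c := 0) (by simp)
  have h2 := h1.mono (c := a) (d := b) (by
    rw [uIcc_of_le hab, uIcc_of_le (ha.le.trans hab)]
    exact Icc_subset_Icc_left ha.le)
  have h3 : AbsolutelyContinuousOnInterval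
      (fun x : ℝ => Complex.exp (-(2 * Complex.I * ζ * x))) a b := by
    simpa only [neg_mul] using absolutelyContinuousOnInterval_cexp_mul (-(2 * Complex.I * ζ)) a b
  refine (h3.complex_mul ((AbsolutelyContinuousOnInterval.const_complex (∫ t in Ioi (0 : ℝ),
    Complex.exp (2 * Complex.I * ζ * t) * (p t * jostM p ζ t)) a b).sub h2)
    ).neg.congr_uIcc fun x hx => ?_
  rw [uIcc_of_le hab] at hx
  rw [jostN_eq hp hζ (ha.le.trans hx.1)]
  rfl

theorem ae_hasDerivAt_jostN (hp : HasMoment p) {ζ : ℂ} (hζ : 0 ≤ ζ.im) :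
    ∀ᵐ x : ℝ, 0 < x → HasDerivAt (jostN p ζ)
      (-(2 * Complex.I * ζ) * jostN p ζ x + p x * jostM p ζ x) x := by
  -- Quantifying over the countably many intervals [0, N] gives one null set for the whole
  -- half-line.
  have hae : ∀ᵐ x : ℝ, ∀ N : ℕ, x ∈ uIcc (0 : ℝ) N → HasDerivAt (fun x => ∫ t in (0 : ℝ)..x,
      Complex.exp (2 * Complex.I * ζ * t) * (p t * jostM p ζ t))
      (Complex.exp (2 * Complex.I * ζ * x) * (p x * jostM p ζ x)) x := by
    rw [ae_all_iff]
    intro N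
    filter_upwards [(intervalIntegrable_exp_mul_jostM hp hζ (a := 0) (b := N) le_rfl
      (Nat.cast_nonneg N)).ae_hasDerivAt_integral] with x hx hxN
    exact hx hxN 0 (by simp)
  filter_upwards [hae] with x hx h0
  obtain ⟨N, hN⟩ := exists_nat_ge x
  have h1 := hx N (by rw [uIcc_of_le (Nat.cast_nonneg N)]; exact ⟨h0.le, hN⟩)
  have h2 : HasDerivAt (fun x : ℝ => Complex.exp (-(2 * Complex.I * ζ * x)))
      (Complex.exp (-(2 * Complex.I * ζ * x)) * (-(2 * Complex.I * ζ))) x := by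
    simpa only [neg_mul] using hasDerivAt_cexp_mul_ofReal (-(2 * Complex.I * ζ)) x
  have h3 := (h2.mul (h1.const_sub (∫ t in Ioi (0 : ℝ), Complex.exp (2 * Complex.I * ζ * t) *
    (p t * jostM p ζ t)))).neg
  have h4 := h3.congr_of_eventuallyEq (f₁ := jostN p ζ) (by
    filter_upwards [Ioi_mem_nhds h0] with y hy
    rw [jostN_eq hp hζ (le_of_lt hy)]
    rfl)
  refine h4.congr_deriv ?_
  rw [jostN_eq hp hζ h0.le]
  have h5 : Complex.exp (-(2 * Complex.I * ζ * x)) * Complex.exp (2 * Complex.I * ζ * x) = 1 := by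
    rw [← Complex.exp_add]; simp
  linear_combination (p x * jostM p ζ x) * h5

/-- The Jost solution on the half-line. -/
noncomputable def jostF (p : ℝ → ℂ) (ζ : ℂ) (x : ℝ) : ℂ :=
  Complex.exp (Complex.I * ζ * x) * jostM p ζ x

/-- The derivative of the Jost solution on the half-line. -/
noncomputable def jostF' (p : ℝ → ℂ) (ζ : ℂ) (x : ℝ) : ℂ :=
  Complex.exp (Complex.I * ζ * x) * (Complex.I * ζ * jostM p ζ x + jostN p ζ x)

theorem isHalfSol_jostF (hp : HasMoment p) {ζ : ℂ} (hζ : 0 ≤ ζ.im) :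
    IsHalfSol (fun x => p x - ζ ^ 2) (jostF p ζ) (jostF' p ζ) where
  hasDerivAt x hx := by
    have := (hasDerivAt_cexp_mul_ofReal (Complex.I * ζ) x).mul (hasDerivAt_jostM hp hζ hx)
    convert! this using 1
    rw [jostF']; ring
  ac a b ha hab := by
    have h3 : AbsolutelyContinuousOnInterval
        (fun x : ℝ => Complex.exp (Complex.I * ζ * x)) a b :=
      absolutelyContinuousOnInterval_cexp_mul _ a b
    have hsub : uIcc a b ⊆ Ioi 0 := by
      rw [uIcc_of_le hab]; exact fun x hx => lt_of_lt_of_le ha hx.1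
    have h4 : AbsolutelyContinuousOnInterval (jostM p ζ) a b :=
      absolutelyContinuousOnInterval_of_hasDerivAt
        (fun x hx => hasDerivAt_jostM hp hζ (hsub hx))
        ((continuousOn_jostN hp hζ).mono (hsub.trans Ioi_subset_Ici_self))
    exact h3.complex_mul ((h4.const_smul (Complex.I * ζ)).add (jostN_ac hp hζ ha hab))
  eq := by
    filter_upwards [ae_hasDerivAt_jostN hp hζ] with x hx h0
    have := (hasDerivAt_cexp_mul_ofReal (Complex.I * ζ) x).mul
      (((hasDerivAt_jostM hp hζ h0).const_mul (Complex.I * ζ)).add (hx h0))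
    refine this.congr_deriv ?_
    rw [jostF]
    simp only [Pi.add_apply]
    linear_combination (Complex.exp (Complex.I * ζ * x) * ζ ^ 2 * jostM p ζ x) * Complex.I_sq

end JostSolution

/-! ### Data of half-line solutions at the origin and their dependence on ζ. -/

section InitialData

variable {p : ℝ → ℂ}

/-! ### Initial data at the origin -/

/-- The pair `(u, u')` tends to `(c, d)` at `0⁺`. -/
def HasInit (u u' : ℝ → ℂ) (c d : ℂ) : Prop :=
  Tendsto u (𝓝[>] 0) (𝓝 c) ∧ Tendsto u' (𝓝[>] 0) (𝓝 d)

/-- The value of the Jost solution at the origin. -/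
noncomputable def jostA (p : ℝ → ℂ) (ζ : ℂ) : ℂ := jostM p ζ 0

/-- The derivative of the Jost solution at the origin. -/
noncomputable def jostV (p : ℝ → ℂ) (ζ : ℂ) : ℂ := Complex.I * ζ * jostM p ζ 0 + jostN p ζ 0

theorem continuous_jostF (hp : HasMoment p) {ζ : ℂ} (hζ : 0 ≤ ζ.im) : Continuous (jostF p ζ) := by
  have := continuous_jostM hp hζ
  unfold jostF
  fun_prop

theorem continuousOn_jostF' (hp : HasMoment p) {ζ : ℂ} (hζ : 0 ≤ ζ.im) :
    ContinuousOn (jostF' p ζ) (Ici 0) := by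
  have := continuous_jostM hp hζ
  have h2 := continuousOn_jostN hp hζ
  unfold jostF'
  fun_prop

theorem hasInit_jostF (hp : HasMoment p) {ζ : ℂ} (hζ : 0 ≤ ζ.im) :
    HasInit (jostF p ζ) (jostF' p ζ) (jostA p ζ) (jostV p ζ) := by
  have h1 : jostF p ζ 0 = jostA p ζ := by simp [jostF, jostA]
  have h2 : jostF' p ζ 0 = jostV p ζ := by simp [jostF', jostV]
  constructor
  · rw [← h1]
    exact ((continuous_jostF hp hζ).tendsto 0).mono_left nhdsWithin_le_nhds
  · rw [← h2]
    exact ((continuousOn_jostF' hp hζ) 0 self_mem_Ici).mono_left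
      (nhdsWithin_mono 0 Ioi_subset_Ici_self)

theorem HasInit.const_mul {u u' : ℝ → ℂ} {c d : ℂ} (k : ℂ) (h : HasInit u u' c d) :
    HasInit (fun x => k * u x) (fun x => k * u' x) (k * c) (k * d) :=
  ⟨h.1.const_mul k, h.2.const_mul k⟩

theorem HasInit.add {u u' v v' : ℝ → ℂ} {c d c' d' : ℂ} (h : HasInit u u' c d)
    (k : HasInit v v' c' d') :
    HasInit (fun x => u x + v x) (fun x => u' x + v' x) (c + c') (d + d') :=
  ⟨h.1.add k.1, h.2.add k.2⟩

theorem HasInit.wronskian {u u' v v' : ℝ → ℂ} {c d c' d' : ℂ} (h : HasInit u u' c d)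
    (k : HasInit v v' c' d') :
    Tendsto (fun x => u x * v' x - u' x * v x) (𝓝[>] 0) (𝓝 (c * d' - d * c')) :=
  (h.1.mul k.2).sub (h.2.mul k.1)

theorem IsHalfSol.wronskian_eq_init {P u u' v v' : ℝ → ℂ} {c d c' d' : ℂ}
    (hu : IsHalfSol P u u') (hv : IsHalfSol P v v') (h : HasInit u u' c d)
    (k : HasInit v v' c' d') {x : ℝ} (hx : 0 < x) :
    u x * v' x - u' x * v x = c * d' - d * c' := by
  refine tendsto_nhds_unique (tendsto_const_nhds.congr' ?_) (h.wronskian k)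
  filter_upwards [self_mem_nhdsWithin] with y hy using hu.wronskian_eq hv hx hy

/-! ### Uniqueness of the initial value problem -/

/-- The Wronskian is constant, so it may be computed at infinity: the exponentials cancel, the
amplitudes tend to 1 and their derivatives to 0. -/
theorem jostF_wronskian_neg (hp : HasMoment p) (ξ : ℝ) {x : ℝ} (hx : 0 < x) :
    jostF p ξ x * jostF' p (-ξ) x - jostF' p ξ x * jostF p (-ξ) x = -(2 * Complex.I * ξ) := by
  have h1 : (0 : ℝ) ≤ ((ξ : ℂ)).im := by simp
  have h2 : (0 : ℝ) ≤ (-(ξ : ℂ)).im := by simp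
  have hs1 := isHalfSol_jostF hp h1
  have hs2 := isHalfSol_jostF hp h2
  rw [neg_sq] at hs2
  have hlim : Tendsto (fun y => jostM p ξ y * (Complex.I * (-ξ) * jostM p (-ξ) y + jostN p (-ξ) y)
      - (Complex.I * ξ * jostM p ξ y + jostN p ξ y) * jostM p (-ξ) y) atTop
      (𝓝 (1 * (Complex.I * (-ξ) * 1 + 0) - (Complex.I * ξ * 1 + 0) * 1)) :=
    ((tendsto_jostM hp h1).mul (((tendsto_jostM hp h2).const_mul _).add (tendsto_jostN hp h2))).sub
      ((((tendsto_jostM hp h1).const_mul _).add (tendsto_jostN hp h1)).mul (tendsto_jostM hp h2))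
  have hc : Tendsto (fun _ : ℝ => jostF p ξ x * jostF' p (-ξ) x - jostF' p ξ x * jostF p (-ξ) x)
      atTop (𝓝 (jostF p ξ x * jostF' p (-ξ) x - jostF' p ξ x * jostF p (-ξ) x)) :=
    tendsto_const_nhds
  have := tendsto_nhds_unique (hc.congr' ?_) hlim
  · rw [this]; ring
  · filter_upwards [eventually_gt_atTop 0] with y hy
    rw [hs1.wronskian_eq hs2 hx hy]
    simp only [jostF, jostF']
    have : Complex.exp (Complex.I * ξ * y) * Complex.exp (Complex.I * (-ξ) * y) = 1 := by
      rw [← Complex.exp_add]; simp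
    linear_combination (jostM p ξ y * (Complex.I * (-ξ) * jostM p (-ξ) y + jostN p (-ξ) y)
      - (Complex.I * ξ * jostM p ξ y + jostN p ξ y) * jostM p (-ξ) y) * this

/-- Cutting off at X lets a spectral shift be absorbed into the potential without losing the first
moment. -/
theorem hasMoment_indicator (hp : HasMoment p) (μ : ℂ) (X : ℝ) :
    HasMoment ((Ioc 0 X).indicator fun t => p t - μ) := by
  have hm : AEStronglyMeasurable ((Ioc 0 X).indicator fun t => p t - μ) volume :=
    (hp.meas.sub aestronglyMeasurable_const).indicator measurableSet_Ioc
  refine ⟨hm, ?_⟩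
  have hb : Integrable fun t => (1 + |t|) * ‖p t‖ +
      (Ioc (0 : ℝ) X).indicator (fun _ => (1 + |X|) * ‖μ‖) t := by
    refine hp.int.add ?_
    rw [integrable_indicator_iff measurableSet_Ioc]
    exact continuous_const.integrableOn_Ioc
  have hc : Continuous fun t : ℝ => 1 + |t| := by fun_prop
  refine hb.mono' (hc.aestronglyMeasurable.mul hm.norm) (Eventually.of_forall fun t => ?_)
  have h1 : (0 : ℝ) ≤ 1 + |t| := by positivity
  rw [norm_mul, norm_norm, Real.norm_eq_abs, abs_of_nonneg h1]
  by_cases ht : t ∈ Ioc 0 X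
  · rw [indicator_of_mem ht, indicator_of_mem ht]
    have h2 : |t| ≤ |X| := by
      rw [abs_of_pos ht.1]; exact ht.2.trans (le_abs_self X)
    have h3 := norm_sub_le (p t) μ
    calc (1 + |t|) * ‖p t - μ‖ ≤ (1 + |t|) * (‖p t‖ + ‖μ‖) := by gcongr
      _ = (1 + |t|) * ‖p t‖ + (1 + |t|) * ‖μ‖ := by ring
      _ ≤ _ := by gcongr
  · rw [indicator_of_notMem ht, indicator_of_notMem ht, norm_zero, mul_zero, add_zero]
    positivity

/-- On (0, x] the equation reads u'' = (r - 1)u for the truncated potential r, whose Jost solutions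
at ζ = 1 and ζ = -1 are independent. The Wronskian of u with each of them vanishes at 0⁺, hence at
x, and independence gives u(x) = 0. The Jost construction thus replaces a Gronwall argument. -/
theorem IsHalfSol.eq_zero_of_hasInit (hp : HasMoment p) {μ : ℂ} {u u' : ℝ → ℂ}
    (hu : IsHalfSol (fun x => p x - μ) u u') (h0 : HasInit u u' 0 0) {x : ℝ} (hx : 0 < x) :
    u x = 0 := by
  set r : ℝ → ℂ := (Ioc 0 x).indicator fun t => p t - (μ - 1) with hr
  have hrm : HasMoment r := hasMoment_indicator hp (μ - 1) x
  have key : ∀ ζ : ℂ, 0 ≤ ζ.im → ζ ^ 2 = 1 →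
      u x * jostF' r ζ x - u' x * jostF r ζ x = 0 := by
    intro ζ hζ hζ2
    have hg := isHalfSol_jostF hrm hζ
    have hw := h0.wronskian (hasInit_jostF hrm hζ)
    rw [zero_mul, zero_mul, sub_zero] at hw
    refine tendsto_nhds_unique (tendsto_const_nhds.congr' ?_) hw
    filter_upwards [Ioo_mem_nhdsGT hx] with a ha
    have := hu.green_of_le hg ha.1 ha.2.le (c := 0) fun t h1 h2 => by
      rw [hr, indicator_of_mem (show t ∈ Ioc 0 x from ⟨lt_of_lt_of_le ha.1 h1, h2⟩), hζ2]
      ring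
    rw [zero_mul] at this
    exact sub_eq_zero.1 this
  have k1 := key ((1 : ℝ) : ℂ) (by simp) (by simp)
  have k2 := key (-((1 : ℝ) : ℂ)) (by simp) (by simp)
  have kw := jostF_wronskian_neg hrm 1 hx
  have h2 : u x * -(2 * Complex.I * (1 : ℝ)) = 0 := by
    linear_combination (jostF r ((1 : ℝ) : ℂ) x) * k2 - (jostF r (-((1 : ℝ) : ℂ)) x) * k1 - u x * kw
  simpa using h2

theorem IsHalfSol.eq_of_hasInit (hp : HasMoment p) {μ : ℂ} {u u' v v' : ℝ → ℂ} {c d : ℂ}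
    (hu : IsHalfSol (fun x => p x - μ) u u') (hv : IsHalfSol (fun x => p x - μ) v v')
    (h0 : HasInit u u' c d) (k0 : HasInit v v' c d) {x : ℝ} (hx : 0 < x) : u x = v x := by
  have h1 := hu.add (hv.const_mul (-1))
  have h2 := h0.add (k0.const_mul (-1))
  have := h1.eq_zero_of_hasInit hp (by simpa using h2) hx
  linear_combination this

/-- Otherwise uniqueness would make the Jost solution vanish identically, against m → 1 at infinity.
-/
theorem jostA_jostV_ne_zero (hp : HasMoment p) {ζ : ℂ} (hζ : 0 ≤ ζ.im) :
    ¬ (jostA p ζ = 0 ∧ jostV p ζ = 0) := by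
  rintro ⟨h1, h2⟩
  have h0 := hasInit_jostF hp hζ
  rw [h1, h2] at h0
  have hm : ∀ x, 0 < x → jostM p ζ x = 0 := fun x hx => by
    have := (isHalfSol_jostF hp hζ).eq_zero_of_hasInit hp h0 hx
    simpa [jostF] using this
  have hl := tendsto_jostM hp hζ
  have : Tendsto (jostM p ζ) atTop (𝓝 0) := by
    refine tendsto_const_nhds.congr' ?_
    filter_upwards [eventually_gt_atTop 0] with x hx using (hm x hx).symm
  exact one_ne_zero (tendsto_nhds_unique hl this)

/-! ### Dependence on the spectral parameter -/

theorem continuousOn_jostA (hp : HasMoment p) : ContinuousOn (jostA p) {ζ : ℂ | 0 ≤ ζ.im} :=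
  continuousOn_jostM_spectral hp 0

theorem continuousOn_jostV (hp : HasMoment p) : ContinuousOn (jostV p) {ζ : ℂ | 0 ≤ ζ.im} :=
  ContinuousOn.add (ContinuousOn.mul (by fun_prop) (continuousOn_jostM_spectral hp 0))
    (continuousOn_jostN_spectral hp 0)

theorem differentiableOn_jostA (hp : HasMoment p) : DifferentiableOn ℂ (jostA p) {ζ : ℂ | 0 < ζ.im} :=
  differentiableOn_jostM hp 0

theorem differentiableOn_jostV (hp : HasMoment p) : DifferentiableOn ℂ (jostV p) {ζ : ℂ | 0 < ζ.im} :=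
  DifferentiableOn.add (DifferentiableOn.mul (by fun_prop) (differentiableOn_jostM hp 0))
    (differentiableOn_jostN hp 0)

theorem exists_jost_bounds (hp : HasMoment p) : ∃ C : ℝ, 0 ≤ C ∧ ∀ ζ : ℂ, 0 ≤ ζ.im →
    (∀ x, ‖jostM p ζ x‖ ≤ C) ∧ (∀ x, ‖jostN p ζ x‖ ≤ C) ∧
    (ζ ≠ 0 → ‖jostA p ζ - 1‖ ≤ C / ‖ζ‖) ∧ ‖jostV p ζ - Complex.I * ζ * jostA p ζ‖ ≤ C := by
  set E := Real.exp (momentTail p 0)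
  set I₀ := ∫ t in Ioi 0, ‖p t‖
  have hI : 0 ≤ I₀ := integral_nonneg fun t => norm_nonneg _
  have hE : 0 < E := Real.exp_pos _
  have hN : ∀ ζ : ℂ, 0 ≤ ζ.im → ∀ x, ‖jostN p ζ x‖ ≤ E + I₀ * E := fun ζ hζ x => by
    refine (norm_jostN_le hp hζ x).trans ?_
    have : (∫ t in Ioi (max x 0), ‖p t‖) ≤ I₀ :=
      setIntegral_mono_set hp.integrable.norm.integrableOn
        (Eventually.of_forall fun t => norm_nonneg _)
        (Ioi_subset_Ioi (le_max_right x 0)).eventuallyLE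
    nlinarith [mul_le_mul_of_nonneg_right this hE.le]
  refine ⟨E + I₀ * E, by positivity, fun ζ hζ => ⟨fun x => ?_, hN ζ hζ, fun h0 => ?_, ?_⟩⟩
  · exact (norm_jostM_le hp hζ x).trans (le_add_of_nonneg_right (by positivity))
  · refine (norm_jostM_sub_one_le hp hζ h0 0).trans ?_
    gcongr
    exact le_add_of_nonneg_left hE.le
  · simpa [jostV, jostA] using hN ζ hζ 0

theorem jostA_conj (hp : ∀ t, (starRingEnd ℂ) (p t) = p t) (ζ : ℂ) :
    jostA p (-(starRingEnd ℂ) ζ) = (starRingEnd ℂ) (jostA p ζ) := jostM_conj hp ζ 0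

theorem jostV_conj (hp : ∀ t, (starRingEnd ℂ) (p t) = p t) (ζ : ℂ) :
    jostV p (-(starRingEnd ℂ) ζ) = (starRingEnd ℂ) (jostV p ζ) := by
  simp only [jostV, jostM_conj hp, jostN_conj hp, map_add, map_mul, Complex.conj_I]
  ring

theorem jostF_conj (hp : ∀ t, (starRingEnd ℂ) (p t) = p t) (ζ : ℂ) (x : ℝ) :
    jostF p (-(starRingEnd ℂ) ζ) x = (starRingEnd ℂ) (jostF p ζ x) := by
  simp only [jostF, jostM_conj hp, map_mul, ← Complex.exp_conj, Complex.conj_I, Complex.conj_ofReal]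
  congr 2; ring

/-- For a real potential the conjugate of the Jost solution at ξ is the one at -ξ, so this is
`jostF_wronskian_neg` evaluated at the origin. -/
theorem jost_bracket_real (hp : HasMoment p) (hr : ∀ t, (starRingEnd ℂ) (p t) = p t) (ξ : ℝ) :
    (starRingEnd ℂ) (jostA p ξ) * jostV p ξ - (starRingEnd ℂ) (jostV p ξ) * jostA p ξ =
      2 * Complex.I * ξ := by
  have h1 : (0 : ℝ) ≤ ((ξ : ℂ)).im := by simp
  have h2 : (0 : ℝ) ≤ (-(ξ : ℂ)).im := by simp
  have hs2 := isHalfSol_jostF hp h2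
  rw [neg_sq] at hs2
  have := (isHalfSol_jostF hp h1).wronskian_eq_init hs2 (hasInit_jostF hp h1) (hasInit_jostF hp h2)
    one_pos
  rw [jostF_wronskian_neg hp ξ one_pos] at this
  have ea := jostA_conj hr ξ
  have ev := jostV_conj hr ξ
  rw [Complex.conj_ofReal] at ea ev
  rw [← ea, ← ev]
  linear_combination this

theorem norm_jostF_le {ζ : ℂ} {C : ℝ}
    (hC : ∀ x, ‖jostM p ζ x‖ ≤ C) (x : ℝ) : ‖jostF p ζ x‖ ≤ C * Real.exp (-ζ.im * x) := by
  rw [jostF, norm_mul, Complex.norm_exp, mul_comm C]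
  have : (Complex.I * ζ * x).re = -ζ.im * x := by simp
  rw [this]
  gcongr
  exact hC x

theorem norm_jostF'_le {ζ : ℂ} {C : ℝ}
    (hC : ∀ x, ‖jostM p ζ x‖ ≤ C) (hN : ∀ x, ‖jostN p ζ x‖ ≤ C) (x : ℝ) :
    ‖jostF' p ζ x‖ ≤ (‖ζ‖ + 1) * C * Real.exp (-ζ.im * x) := by
  rw [jostF', norm_mul, Complex.norm_exp, mul_comm]
  have : (Complex.I * ζ * x).re = -ζ.im * x := by simp
  rw [this]
  gcongr
  refine (norm_add_le _ _).trans ?_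
  rw [norm_mul, norm_mul, Complex.norm_I, one_mul, add_mul, one_mul]
  gcongr
  · exact hC x
  · exact hN x

end InitialData

/-! ### Wronskian brackets: Green's identity, low energy, square integrability. -/

section Brackets

variable {p : ℝ → ℂ}

/-! ### Green's identity on the whole half-line -/

theorem tendsto_integral_Ioi_zero {g : ℝ → ℂ} (hg : IntegrableOn g (Ioi 0)) :
    Tendsto (fun x => ∫ t in Ioi x, g t) (𝓝[>] 0) (𝓝 (∫ t in Ioi 0, g t)) := by
  have h1 : ContinuousOn (fun x => ∫ t in (0 : ℝ)..x, g t) (Icc 0 1) := by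
    have := intervalIntegral.continuousOn_primitive_interval (μ := volume) (a := 0) (b := 1)
      (f := g) ?_
    · rwa [uIcc_of_le zero_le_one] at this
    · rw [uIcc_of_le zero_le_one, integrableOn_Icc_iff_integrableOn_Ioc]
      exact hg.mono_set fun t ht => ht.1
  have h2 : Tendsto (fun x => ∫ t in (0 : ℝ)..x, g t) (𝓝[>] 0) (𝓝 0) := by
    have := h1 0 ⟨le_rfl, zero_le_one⟩
    rw [ContinuousWithinAt, intervalIntegral.integral_same] at this
    refine this.mono_left (le_trans ?_ (nhdsWithin_mono 0 Ioc_subset_Icc_self))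
    rw [nhdsWithin_Ioc_eq_nhdsGT zero_lt_one]
  have h3 := (tendsto_const_nhds (x := ∫ t in Ioi 0, g t)).sub h2
  rw [sub_zero] at h3
  refine h3.congr' ?_
  filter_upwards [self_mem_nhdsWithin] with x hx
  rw [← intervalIntegral.integral_interval_add_Ioi hg
    (hg.mono_set (Ioi_subset_Ioi (le_of_lt hx))), add_sub_cancel_left]

/-- If `W b - W a = ∫_a^b g` on the open half-line, `W → w` at `0⁺` and `W → 0` at infinity,
then `w = -∫_0^∞ g`. -/
theorem eq_neg_integral_Ioi {W g : ℝ → ℂ} {w : ℂ} (hg : IntegrableOn g (Ioi 0))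
    (hW : ∀ a b, 0 < a → a ≤ b → W b - W a = ∫ t in a..b, g t)
    (h0 : Tendsto W (𝓝[>] 0) (𝓝 w)) (hinf : Tendsto W atTop (𝓝 0)) :
    w = -∫ t in Ioi 0, g t := by
  have h1 : ∀ a, 0 < a → W a = -∫ t in Ioi a, g t := by
    intro a ha
    have h2 := intervalIntegral_tendsto_integral_Ioi a (hg.mono_set (Ioi_subset_Ioi ha.le))
      tendsto_id
    have h3 : Tendsto (fun b => W b - W a) atTop (𝓝 (0 - W a)) := hinf.sub_const _
    have := tendsto_nhds_unique (h3.congr' ?_) h2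
    · rw [← this]; ring
    · filter_upwards [eventually_ge_atTop a] with b hb using hW a b ha hb
  refine tendsto_nhds_unique h0 ((tendsto_integral_Ioi_zero hg).neg.congr' ?_)
  filter_upwards [self_mem_nhdsWithin] with a ha using (h1 a ha).symm

theorem integrableOn_jostF_mul (hp : HasMoment p) {ζ₁ ζ₂ : ℂ} (h₁ : 0 < ζ₁.im) (h₂ : 0 < ζ₂.im) :
    IntegrableOn (fun t => jostF p ζ₁ t * jostF p ζ₂ t) (Ioi 0) := by
  obtain ⟨C, hC0, hC⟩ := exists_jost_bounds hp
  have hb : IntegrableOn (fun t => C * C * Real.exp (-(ζ₁.im + ζ₂.im) * t)) (Ioi 0) :=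
    (exp_neg_integrableOn_Ioi 0 (by positivity)).const_mul _
  refine hb.mono' ((continuous_jostF hp h₁.le).mul
    (continuous_jostF hp h₂.le)).aestronglyMeasurable (Eventually.of_forall fun t => ?_)
  rw [norm_mul]
  have e1 := norm_jostF_le (hC ζ₁ h₁.le).1 t
  have e2 := norm_jostF_le (hC ζ₂ h₂.le).1 t
  calc _ ≤ (C * Real.exp (-ζ₁.im * t)) * (C * Real.exp (-ζ₂.im * t)) := by gcongr
    _ = C * C * (Real.exp (-ζ₁.im * t) * Real.exp (-ζ₂.im * t)) := by ring
    _ = _ := by rw [← Real.exp_add]; congr 2; ring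

theorem tendsto_jost_decay {ζ : ℂ} (hζ : 0 < ζ.im) (C : ℝ) :
    Tendsto (fun x => C * Real.exp (-ζ.im * x)) atTop (𝓝 0) := by
  have h : Tendsto (fun x : ℝ => -ζ.im * x) atTop atBot := by
    simpa using tendsto_id.const_mul_atTop_of_neg (neg_lt_zero.2 hζ)
  simpa using (Real.tendsto_exp_atBot.comp h).const_mul C

theorem tendsto_jostF_zero (hp : HasMoment p) {ζ : ℂ} (hζ : 0 < ζ.im) :
    Tendsto (jostF p ζ) atTop (𝓝 0) := by
  obtain ⟨C, hC0, hC⟩ := exists_jost_bounds hp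
  exact squeeze_zero_norm (fun x => norm_jostF_le (hC ζ hζ.le).1 x) (tendsto_jost_decay hζ C)

theorem tendsto_jostF'_zero (hp : HasMoment p) {ζ : ℂ} (hζ : 0 < ζ.im) :
    Tendsto (jostF' p ζ) atTop (𝓝 0) := by
  obtain ⟨C, hC0, hC⟩ := exists_jost_bounds hp
  exact squeeze_zero_norm (fun x => norm_jostF'_le (hC ζ hζ.le).1 (hC ζ hζ.le).2.1 x)
    (tendsto_jost_decay hζ _)

/-- Exponential decay kills the boundary term at infinity. With ζ₁ = -conj ζ₂ the integral becomes a
squared norm, which locates the zeros of the Wronskian; with ζ₂ near ζ₁ the factored form gives the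
derivative of the bracket, which makes the zeros simple. -/
theorem jost_bracket_eq_integral (hp : HasMoment p) {ζ₁ ζ₂ : ℂ} (h₁ : 0 < ζ₁.im)
    (h₂ : 0 < ζ₂.im) :
    jostA p ζ₁ * jostV p ζ₂ - jostV p ζ₁ * jostA p ζ₂ =
      (ζ₂ ^ 2 - ζ₁ ^ 2) * ∫ t in Ioi 0, jostF p ζ₁ t * jostF p ζ₂ t := by
  have key := eq_neg_integral_Ioi ((integrableOn_jostF_mul hp h₁ h₂).const_mul (ζ₁ ^ 2 - ζ₂ ^ 2))
    (W := fun x => jostF p ζ₁ x * jostF' p ζ₂ x - jostF' p ζ₁ x * jostF p ζ₂ x)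
    (fun a b ha hab => ?_)
    ((hasInit_jostF hp h₁.le).wronskian (hasInit_jostF hp h₂.le)) ?_
  · rw [key, integral_const_mul]; ring
  · rw [intervalIntegral.integral_const_mul]
    exact (isHalfSol_jostF hp h₁.le).green_of_le (isHalfSol_jostF hp h₂.le) ha hab
      (fun x _ _ => by ring)
  · simpa using ((tendsto_jostF_zero hp h₁).mul (tendsto_jostF'_zero hp h₂)).sub
      ((tendsto_jostF'_zero hp h₁).mul (tendsto_jostF_zero hp h₂))

theorem integrableOn_norm_sq_jostF (hp : HasMoment p) {ζ : ℂ} (hζ : 0 < ζ.im) :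
    IntegrableOn (fun t => ‖jostF p ζ t‖ ^ 2) (Ioi 0) := by
  simpa [pow_two, IntegrableOn] using (integrableOn_jostF_mul hp hζ hζ).norm

theorem integral_norm_sq_jostF_pos (hp : HasMoment p) {ζ : ℂ} (hζ : 0 < ζ.im) :
    0 < ∫ t in Ioi 0, ‖jostF p ζ t‖ ^ 2 := by
  rw [integral_pos_iff_support_of_nonneg (fun t => by positivity)
    (integrableOn_norm_sq_jostF hp hζ)]
  have h := (tendsto_jostM hp hζ.le).eventually_ne one_ne_zero
  obtain ⟨X, hX⟩ := eventually_atTop.1 h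
  have hsub : Ioo (max X 0) (max X 0 + 1) ⊆ Function.support (fun t => ‖jostF p ζ t‖ ^ 2) := by
    intro t ht
    have : jostM p ζ t ≠ 0 := hX t ((le_max_left X 0).trans ht.1.le)
    simp [jostF, this]
  refine lt_of_lt_of_le ?_ (measure_mono hsub)
  rw [Measure.restrict_apply measurableSet_Ioo, inter_eq_self_of_subset_left
    (show Ioo (max X 0) (max X 0 + 1) ⊆ Ioi 0 from
      fun t ht => lt_of_le_of_lt (le_max_right X 0) ht.1)]
  simp

theorem jost_bracket_conj (hp : HasMoment p) (hr : ∀ t, (starRingEnd ℂ) (p t) = p t) {ζ : ℂ}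
    (hζ : 0 < ζ.im) :
    (starRingEnd ℂ) (jostA p ζ) * jostV p ζ - (starRingEnd ℂ) (jostV p ζ) * jostA p ζ =
      (ζ ^ 2 - (starRingEnd ℂ) (ζ ^ 2)) * ((∫ t in Ioi 0, ‖jostF p ζ t‖ ^ 2 : ℝ) : ℂ) := by
  have h2 : 0 < (-(starRingEnd ℂ) ζ).im := by simpa using hζ
  have := jost_bracket_eq_integral hp h2 hζ
  rw [jostA_conj hr, jostV_conj hr] at this
  have e := integral_ofReal (𝕜 := ℂ) (μ := volume.restrict (Ioi 0)) (f := fun t => ‖jostF p ζ t‖ ^ 2)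
  rw [this, neg_sq, ← map_pow]
  refine congrArg _ (Eq.trans ?_ e)
  congr 1; ext t
  rw [jostF_conj hr, mul_comm, Complex.mul_conj]
  rw [Complex.normSq_eq_norm_sq]
  rfl

theorem jost_integral_continuousOn (hp : HasMoment p) {ζ₀ : ℂ} (h₀ : 0 < ζ₀.im) :
    ContinuousOn (fun ζ => ∫ t in Ioi 0, jostF p ζ₀ t * jostF p ζ t) {ζ : ℂ | 0 ≤ ζ.im} := by
  obtain ⟨C, hC0, hC⟩ := exists_jost_bounds hp
  refine continuousOn_of_dominated (bound := fun t => C * C * Real.exp (-ζ₀.im * t)) ?_ ?_ ?_ ?_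
  · intro ζ hζ
    exact ((continuous_jostF hp h₀.le).mul (continuous_jostF hp hζ)).aestronglyMeasurable
  · intro ζ hζ
    filter_upwards [ae_restrict_mem measurableSet_Ioi] with t ht
    have ht : 0 < t := ht
    have hζ : 0 ≤ ζ.im := hζ
    rw [norm_mul]
    have e1 := norm_jostF_le (hC ζ₀ h₀.le).1 t
    have e2 := norm_jostF_le (hC ζ hζ).1 t
    have e3 : Real.exp (-ζ.im * t) ≤ 1 := Real.exp_le_one_iff.2 (by nlinarith)
    calc _ ≤ (C * Real.exp (-ζ₀.im * t)) * (C * 1) := by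
          gcongr
          exact e2.trans (by gcongr)
      _ = _ := by ring
  · exact (exp_neg_integrableOn_Ioi 0 h₀).const_mul _
  · refine Eventually.of_forall fun t => ContinuousOn.mul continuousOn_const ?_
    unfold jostF
    exact ContinuousOn.mul (by fun_prop) (continuousOn_jostM_spectral hp t)

/-! ### Low-energy behaviour -/

/-- For the tail h of ∫|p|, integration by parts gives ∫₀ᵀ h = T h(T) + ∫₀ᵀ t|p(t)| dt, and T h(T)
is at most the first moment beyond T. So the partial integrals never exceed the full first moment.
-/
theorem integrableOn_tail_norm (hp : HasMoment p) :
    IntegrableOn (fun x => ∫ t in Ioi x, ‖p t‖) (Ioi 0) := by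
  set h := fun x => ∫ t in Ioi x, ‖p t‖ with hh
  have hpi := hp.integrable.norm
  have hh0 : ∀ x, 0 ≤ h x := fun x => integral_nonneg fun t => norm_nonneg _
  have heq : ∀ x, h x = h 0 - ∫ t in (0 : ℝ)..x, ‖p t‖ := fun x => by
    have := intervalIntegral.integral_interval_add_Ioi' (a := 0) (b := x) (μ := volume)
      (f := fun t => ‖p t‖) hpi.intervalIntegrable hpi.integrableOn
    simp only [hh]; linarith
  have hcont : Continuous h := by
    rw [show h = fun x => h 0 - ∫ t in (0 : ℝ)..x, ‖p t‖ from funext heq]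
    exact continuous_const.sub (intervalIntegral.continuous_primitive
      (fun _ _ => hpi.intervalIntegrable) 0)
  refine integrableOn_Ioi_of_intervalIntegral_norm_bounded (momentTail p 0) 0 (b := id)
    (l := atTop) (fun x => hcont.integrableOn_Ioc) tendsto_id ?_
  filter_upwards [eventually_ge_atTop 0] with T hT
  simp only [id]
  have hac : AbsolutelyContinuousOnInterval h 0 T := by
    rw [show h = fun x => h 0 - ∫ t in (0 : ℝ)..x, ‖p t‖ from funext heq]
    exact (LipschitzOnWith.absolutelyContinuousOnInterval (K := 0)
      ((LipschitzWith.const (h 0)).lipschitzOnWith)).sub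
      ((hpi.intervalIntegrable (a := 0) (b := T)
        ).absolutelyContinuousOnInterval_intervalIntegral (c := 0) (by simp))
  have hid : AbsolutelyContinuousOnInterval (fun x : ℝ => x) 0 T :=
    LipschitzOnWith.absolutelyContinuousOnInterval (K := 1) (LipschitzWith.id.lipschitzOnWith)
  have hi := hid.integral_deriv_mul_eq_sub hac
  have hde : ∀ᵐ t, deriv h t = -‖p t‖ := by
    filter_upwards [_root_.LocallyIntegrable.ae_hasDerivAt_integral hpi.locallyIntegrable]
      with t ht
    rw [show h = fun x => h 0 - ∫ t in (0 : ℝ)..x, ‖p t‖ from funext heq]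
    simpa using ((ht 0).const_sub (h 0)).deriv
  have hxi : IntervalIntegrable (fun t => t * ‖p t‖) volume 0 T := by
    have : IntervalIntegrable (fun t => |t| * ‖p t‖) volume 0 T :=
      hp.integrable_abs_mul.intervalIntegrable
    refine this.congr fun t ht => ?_
    rw [uIoc_of_le hT] at ht
    simp only [abs_of_pos ht.1]
  have hi2 : ∫ x in (0 : ℝ)..T, (deriv (fun x : ℝ => x) x * h x + x * deriv h x) =
      (∫ x in (0 : ℝ)..T, h x) - ∫ x in (0 : ℝ)..T, x * ‖p x‖ := by
    rw [← intervalIntegral.integral_sub (hcont.intervalIntegrable _ _) hxi]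
    refine intervalIntegral.integral_congr_ae ?_
    filter_upwards [hde] with x hx _
    rw [hx]; simp; ring
  rw [hi2] at hi
  have e1 : (∫ x in (0 : ℝ)..T, ‖h x‖) = ∫ x in (0 : ℝ)..T, h x := by
    congr 1; ext x; rw [Real.norm_of_nonneg (hh0 x)]
  have e2 : T * h T ≤ momentTail p T := by
    rw [hh, momentTail, ← integral_const_mul]
    refine setIntegral_mono_on (hpi.integrableOn.const_mul _) hp.integrable_abs_mul.integrableOn
      measurableSet_Ioi fun t ht => ?_
    gcongr
    exact (le_of_lt ht).trans (le_abs_self t)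
  have e3 : momentTail p 0 = (∫ x in (0 : ℝ)..T, x * ‖p x‖) + momentTail p T := by
    rw [momentTail, momentTail, ← intervalIntegral.integral_interval_add_Ioi' (b := T)
      hp.integrable_abs_mul.intervalIntegrable hp.integrable_abs_mul.integrableOn]
    congr 1
    refine intervalIntegral.integral_congr_ae (Eventually.of_forall fun t ht => ?_)
    rw [uIoc_of_le hT] at ht
    simp only [abs_of_pos ht.1]
  rw [e1]
  simp only [zero_mul, sub_zero] at hi
  linarith

theorem integrableOn_jostM_mul_jostN (hp : HasMoment p) {ζ : ℂ} (hζ : 0 ≤ ζ.im) :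
    IntegrableOn (fun x => jostM p 0 x * jostN p ζ x) (Ioi 0) := by
  set E := Real.exp (momentTail p 0)
  have hb := ((integrableOn_tail_norm hp).mul_const E).const_mul E
  refine Integrable.mono' hb ?_ ?_
  · exact (continuous_jostM hp (by simp)).aestronglyMeasurable.mul
      (((continuousOn_jostN hp hζ).mono Ioi_subset_Ici_self).aestronglyMeasurable
        measurableSet_Ioi)
  · filter_upwards [ae_restrict_mem measurableSet_Ioi] with x hx
    rw [norm_mul]
    have h1 := norm_jostM_le hp (ζ := 0) (by simp) x
    have h2 := norm_jostN_le hp hζ x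
    rw [max_eq_left (le_of_lt hx)] at h2
    gcongr

/-- Green's identity for the solutions themselves is unavailable, as they need not decay when one
parameter is 0. The amplitudes work instead: with n = m', the potential cancels from (m₀n_ζ -
n₀m_ζ)' = -2iζ m₀n_ζ, whose right side is integrable because n_ζ is dominated by the tail of ∫|p|.
-/
theorem jost_bracket_zero (hp : HasMoment p) {ζ : ℂ} (hζ : 0 ≤ ζ.im) :
    jostA p 0 * jostV p ζ - jostV p 0 * jostA p ζ = Complex.I * ζ *
      (jostA p 0 * jostA p ζ + 2 * ∫ x in Ioi 0, jostM p 0 x * jostN p ζ x) := by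
  have h00 : (0 : ℝ) ≤ ((0 : ℂ)).im := by simp
  have hN0 : ∀ {z : ℂ}, 0 ≤ z.im → Tendsto (jostN p z) (𝓝[>] 0) (𝓝 (jostN p z 0)) := fun hz =>
    ((continuousOn_jostN hp hz) 0 self_mem_Ici).mono_left (nhdsWithin_mono 0 Ioi_subset_Ici_self)
  have hM0 : ∀ {z : ℂ}, 0 ≤ z.im → Tendsto (jostM p z) (𝓝[>] 0) (𝓝 (jostM p z 0)) := fun hz =>
    ((continuous_jostM hp hz).tendsto 0).mono_left nhdsWithin_le_nhds
  have key := eq_neg_integral_Ioi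
    ((integrableOn_jostM_mul_jostN hp hζ).const_mul (-(2 * Complex.I * ζ)))
    (W := fun x => jostM p 0 x * jostN p ζ x - jostN p 0 x * jostM p ζ x) (fun a b ha hab => ?_)
    (((hM0 h00).mul (hN0 hζ)).sub ((hN0 h00).mul (hM0 hζ))) ?_
  · rw [integral_const_mul] at key
    simp only [jostA, jostV]
    linear_combination key
  · have hsub : uIcc a b ⊆ Ioi 0 := by
      rw [uIcc_of_le hab]; exact fun x hx => lt_of_lt_of_le ha hx.1
    have hMac : ∀ {z : ℂ}, 0 ≤ z.im → AbsolutelyContinuousOnInterval (jostM p z) a b := fun hz =>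
      absolutelyContinuousOnInterval_of_hasDerivAt (fun x hx => hasDerivAt_jostM hp hz (hsub hx))
        ((continuousOn_jostN hp hz).mono (hsub.trans Ioi_subset_Ici_self))
    refine (((hMac h00).complex_mul (jostN_ac hp hζ ha hab)).sub
      ((jostN_ac hp h00 ha hab).complex_mul (hMac hζ))).sub_eq_integral ?_ ?_
    · filter_upwards [ae_hasDerivAt_jostN hp hζ, ae_hasDerivAt_jostN hp h00] with x h1 h2 hx
      have hx0 : 0 < x := hsub hx
      refine (((hasDerivAt_jostM hp h00 hx0).mul (h1 hx0)).sub
        ((h2 hx0).mul (hasDerivAt_jostM hp hζ hx0))).congr_deriv ?_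
      ring
    · rw [intervalIntegrable_iff, uIoc_of_le hab]
      exact IntegrableOn.mono_set ((integrableOn_jostM_mul_jostN hp hζ).const_mul _)
        fun t ht => lt_trans ha ht.1
  · simpa using ((tendsto_jostM hp h00).mul (tendsto_jostN hp hζ)).sub
      ((tendsto_jostN hp h00).mul (tendsto_jostM hp hζ))

/-- The limit does not depend on the potential. At ζ = 0 it takes over the role that the positive
integral ∫|f|² has for Im ζ > 0. -/
theorem tendsto_jost_bracket_zero (hp : HasMoment p) :
    Tendsto (fun ζ => (jostA p 0 * jostV p ζ - jostV p 0 * jostA p ζ) / (Complex.I * ζ))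
      (𝓝[{ζ : ℂ | 0 ≤ ζ.im} \ {0}] 0) (𝓝 1) := by
  have h00 : (0 : ℝ) ≤ ((0 : ℂ)).im := by simp
  set E := Real.exp (momentTail p 0)
  have hc : ContinuousOn (fun ζ => ∫ x in Ioi 0, jostM p 0 x * jostN p ζ x)
      {ζ : ℂ | 0 ≤ ζ.im} := by
    refine continuousOn_of_dominated (bound := fun x => E * ((∫ t in Ioi x, ‖p t‖) * E))
      (fun ζ hζ => (integrableOn_jostM_mul_jostN hp hζ).aestronglyMeasurable) (fun ζ hζ => ?_)
      (((integrableOn_tail_norm hp).mul_const E).const_mul E)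
      (Eventually.of_forall fun x => continuousOn_const.mul (continuousOn_jostN_spectral hp x))
    filter_upwards [ae_restrict_mem measurableSet_Ioi] with x hx
    rw [norm_mul]
    have h1 := norm_jostM_le hp (ζ := 0) (by simp) x
    have h2 := norm_jostN_le hp hζ x
    rw [max_eq_left (le_of_lt hx)] at h2
    gcongr
  -- At ζ = 0 the integrand 2m m' is the derivative of m², which runs from a(0)² to 1.
  have hval : jostA p 0 * jostA p 0 + 2 * ∫ x in Ioi 0, jostM p 0 x * jostN p 0 x = 1 := by
    have hi := integral_Ioi_of_hasDerivAt_of_tendsto (a := (0 : ℝ))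
      (f := fun x => jostM p 0 x * jostM p 0 x) (f' := fun x => 2 * (jostM p 0 x * jostN p 0 x))
      (m := 1 * 1) (((continuous_jostM hp h00).mul (continuous_jostM hp h00)
        ).continuousWithinAt) (fun x hx => ?_)
      ((integrableOn_jostM_mul_jostN hp h00).const_mul 2)
      ((tendsto_jostM hp h00).mul (tendsto_jostM hp h00))
    · rw [integral_const_mul] at hi
      rw [hi, jostA]; ring
    · exact ((hasDerivAt_jostM hp h00 hx).mul (hasDerivAt_jostM hp h00 hx)).congr_deriv (by ring)
  have hlim : Tendsto (fun ζ => jostA p 0 * jostA p ζ + 2 * ∫ x in Ioi 0, jostM p 0 x * jostN p ζ x)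
      (𝓝[{ζ : ℂ | 0 ≤ ζ.im} \ {0}] 0) (𝓝 1) := by
    rw [← hval]
    exact ((((continuousOn_jostA hp) 0 h00).const_mul _).add ((hc 0 h00).const_mul 2)
      ).mono_left (nhdsWithin_mono 0 sdiff_subset)
  refine hlim.congr' ?_
  filter_upwards [self_mem_nhdsWithin] with ζ hζ
  have : Complex.I * ζ ≠ 0 := mul_ne_zero Complex.I_ne_zero hζ.2
  rw [jost_bracket_zero hp hζ.1, mul_div_cancel_left₀ _ this]

/-! ### Square-integrable solutions -/

theorem tendsto_norm_sq_tail {y : ℝ → ℂ} (hL : IntegrableOn (fun t => ‖y t‖ ^ 2) (Ioi 0)) :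
    Tendsto (fun n => ∫ t in n..(n + 1), ‖y t‖ ^ 2) atTop (𝓝 0) := by
  have h1 := intervalIntegral_tendsto_integral_Ioi 0 hL tendsto_id
  have h2 := intervalIntegral_tendsto_integral_Ioi 0 hL
    (tendsto_atTop_add_const_right atTop (1 : ℝ) tendsto_id)
  have h3 := h2.sub h1
  rw [sub_self] at h3
  refine h3.congr' ?_
  filter_upwards [eventually_ge_atTop 0] with n hn
  have hi : ∀ {b : ℝ}, 0 ≤ b → IntervalIntegrable (fun t => ‖y t‖ ^ 2) volume 0 b := fun {b} hb => by
    rw [intervalIntegrable_iff, uIoc_of_le hb]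
    exact hL.mono_set fun t ht => ht.1
  have h4 := intervalIntegral.integral_interval_sub_left (hi (b := n + 1) (by linarith)) (hi hn)
  simpa using h4

/-- Nothing is known about the size of y', so the constant Wronskian k cannot simply be evaluated at
infinity. It is averaged over [n, n+1] against (t - n)(n + 1 - t), which vanishes at both ends and
has integral 1/6. Integration by parts removes y', and what is left is bounded by the L² mass of y
on [n, n+1], which tends to 0. -/
theorem jost_bracket_eq_zero_of_sq_integrable (hp : HasMoment p) {ζ : ℂ} (hζ : 0 ≤ ζ.im)
    {y y' : ℝ → ℂ} (hy : IsHalfSol (fun x => p x - ζ ^ 2) y y')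
    (hL : IntegrableOn (fun t => ‖y t‖ ^ 2) (Ioi 0)) {x : ℝ} (hx : 0 < x) :
    y x * jostF' p ζ x - y' x * jostF p ζ x = 0 := by
  obtain ⟨C, hC0, hC⟩ := exists_jost_bounds hp
  set k := y x * jostF' p ζ x - y' x * jostF p ζ x with hk
  have hF := isHalfSol_jostF hp hζ
  have hconst : ∀ t, 0 < t → y t * jostF' p ζ t - y' t * jostF p ζ t = k := fun t ht =>
    hy.wronskian_eq hF ht hx
  set D := C + 2 * ((‖ζ‖ + 1) * C) with hD
  have hD0 : 0 ≤ D := by positivity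
  have hexp : ∀ t : ℝ, 0 < t → Real.exp (-ζ.im * t) ≤ 1 := fun t ht =>
    Real.exp_le_one_iff.2 (by nlinarith)
  have hmain : ∀ n : ℝ, 0 < n → ∀ ε : ℝ, 0 < ε →
      ‖k‖ / 6 ≤ D * (ε + ε⁻¹ * ∫ t in n..(n + 1), ‖y t‖ ^ 2) := by
    intro n hn ε hε
    have hsub : uIcc n (n + 1) ⊆ Ioi 0 := by
      rw [uIcc_of_le (by linarith)]; exact fun t ht => lt_of_lt_of_le hn ht.1
    have hcy := hy.continuousOn.mono hsub
    have hcy' := hy.continuousOn_deriv.mono hsub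
    have hcF := hF.continuousOn.mono hsub
    have hcF' := hF.continuousOn_deriv.mono hsub
    -- With w the weight and f the Jost solution, y'f = yf' - k turns (w y f)' into w'yf + 2w yf' -
    -- wk = g - wk, free of y'.
    set g : ℝ → ℂ := fun t => ((n + (n + 1) - 2 * t : ℝ) : ℂ) * (y t * jostF p ζ t) +
      2 * (((t - n) * (n + 1 - t) : ℝ) : ℂ) * (y t * jostF' p ζ t) with hg
    have hcg : ContinuousOn g (uIcc n (n + 1)) := by
      refine ContinuousOn.add (ContinuousOn.mul ?_ (hcy.mul hcF))
        (ContinuousOn.mul ?_ (hcy.mul hcF'))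
      · fun_prop
      · fun_prop
    have hder : ∀ t ∈ uIcc n (n + 1), HasDerivAt
        (fun t => (((t - n) * (n + 1 - t) : ℝ) : ℂ) * (y t * jostF p ζ t))
        (g t - (((t - n) * (n + 1 - t) : ℝ) : ℂ) * k) t := by
      intro t ht
      have ht0 : 0 < t := hsub ht
      have h1 : HasDerivAt (fun t : ℝ => (((t - n) * (n + 1 - t) : ℝ) : ℂ))
          (((1 * (n + 1 - t) + (t - n) * (-1) : ℝ)) : ℂ) t :=
        (((hasDerivAt_id t).sub_const n).mul ((hasDerivAt_id t).const_sub (n + 1))).ofReal_comp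
      refine (h1.mul ((hy.hasDerivAt t ht0).mul (hF.hasDerivAt t ht0))).congr_deriv ?_
      rw [← hconst t ht0, hg]
      push_cast
      simp only [Pi.mul_apply]
      ring
    have hci : Continuous fun t : ℝ => (((t - n) * (n + 1 - t) : ℝ) : ℂ) := by fun_prop
    have hint := intervalIntegral.integral_eq_sub_of_hasDerivAt hder
      ((hcg.sub (hci.continuousOn.mul continuousOn_const)).intervalIntegrable)
    have h6 : ∫ t in n..(n + 1), (((t - n) * (n + 1 - t) : ℝ) : ℂ) * k = (1 / 6 : ℂ) * k := by
      rw [intervalIntegral.integral_mul_const, intervalIntegral.integral_ofReal]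
      congr 1
      have : ∫ t in n..(n + 1), (t - n) * (n + 1 - t) = 1 / 6 := by
        have e : ∀ t : ℝ, (t - n) * (n + 1 - t) = (2 * n + 1) * t - t ^ 2 - n * (n + 1) := by
          intro t; ring
        simp only [e]
        rw [intervalIntegral.integral_sub (by apply Continuous.intervalIntegrable; fun_prop)
          (by apply Continuous.intervalIntegrable; fun_prop),
          intervalIntegral.integral_sub (by apply Continuous.intervalIntegrable; fun_prop)
          (by apply Continuous.intervalIntegrable; fun_prop),
          intervalIntegral.integral_const_mul, integral_id, integral_pow,
          intervalIntegral.integral_const]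
        simp only [smul_eq_mul]
        push_cast
        ring
      rw [this]; norm_num
    have hck : IntervalIntegrable (fun t : ℝ => (((t - n) * (n + 1 - t) : ℝ) : ℂ) * k) volume
        n (n + 1) := (hci.mul continuous_const).intervalIntegrable n (n + 1)
    rw [intervalIntegral.integral_sub hcg.intervalIntegrable hck, h6] at hint
    simp only [sub_self, zero_mul, mul_zero, add_sub_cancel_left, Complex.ofReal_zero] at hint
    have hnk : ‖k‖ / 6 = ‖∫ t in n..(n + 1), g t‖ := by
      rw [sub_eq_zero.1 hint, norm_mul]; norm_num; ring
    rw [hnk]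
    have hb : ∀ t ∈ Ioc n (n + 1), ‖g t‖ ≤ D * (ε + ε⁻¹ * ‖y t‖ ^ 2) := by
      intro t ht
      have ht0 : 0 < t := hn.trans ht.1
      have f1 : ‖jostF p ζ t‖ ≤ C := (norm_jostF_le (hC ζ hζ).1 t).trans
        (mul_le_of_le_one_right hC0 (hexp t ht0))
      have f2 : ‖jostF' p ζ t‖ ≤ (‖ζ‖ + 1) * C :=
        (norm_jostF'_le (hC ζ hζ).1 (hC ζ hζ).2.1 t).trans
        (mul_le_of_le_one_right (by positivity) (hexp t ht0))
      have f3 : ‖((n + (n + 1) - 2 * t : ℝ) : ℂ)‖ ≤ 1 := by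
        rw [Complex.norm_real, Real.norm_eq_abs, abs_le]
        constructor <;> linarith [ht.1, ht.2]
      have f4 : ‖(((t - n) * (n + 1 - t) : ℝ) : ℂ)‖ ≤ 1 := by
        rw [Complex.norm_real, Real.norm_eq_abs, abs_le]
        constructor <;> nlinarith [ht.1, ht.2]
      -- A pointwise substitute for Cauchy–Schwarz: first n → ∞ with ε fixed, then ε → 0.
      have f5 : ‖y t‖ ≤ ε + ε⁻¹ * ‖y t‖ ^ 2 := by
        have e1 : ε⁻¹ * ε = 1 := inv_mul_cancel₀ hε.ne'
        have e2 : 0 < ε⁻¹ := inv_pos.2 hε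
        rcases le_total ‖y t‖ ε with h | h
        · nlinarith [mul_nonneg e2.le (sq_nonneg ‖y t‖)]
        · have : ε⁻¹ * ‖y t‖ ^ 2 ≥ ε⁻¹ * (ε * ‖y t‖) := by
            gcongr; nlinarith
          rw [← mul_assoc, e1, one_mul] at this
          linarith
      calc ‖g t‖ ≤ ‖((n + (n + 1) - 2 * t : ℝ) : ℂ)‖ * (‖y t‖ * ‖jostF p ζ t‖) +
            2 * ‖(((t - n) * (n + 1 - t) : ℝ) : ℂ)‖ * (‖y t‖ * ‖jostF' p ζ t‖) := by
            refine (norm_add_le _ _).trans (le_of_eq ?_)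
            simp only [norm_mul, Complex.norm_two]
        _ ≤ 1 * (‖y t‖ * C) + 2 * 1 * (‖y t‖ * ((‖ζ‖ + 1) * C)) := by gcongr
        _ = D * ‖y t‖ := by rw [hD]; ring
        _ ≤ _ := by gcongr
    have hcy2 : IntervalIntegrable (fun t => ‖y t‖ ^ 2) volume n (n + 1) :=
      (hcy.norm.pow 2).intervalIntegrable
    refine (intervalIntegral.norm_integral_le_of_norm_le (by linarith)
      (Eventually.of_forall fun t ht => hb t ht)
      ((intervalIntegrable_const.add (hcy2.const_mul _)).const_mul D)).trans (le_of_eq ?_)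
    rw [intervalIntegral.integral_const_mul, intervalIntegral.integral_add intervalIntegrable_const
      (hcy2.const_mul _), intervalIntegral.integral_const_mul, intervalIntegral.integral_const]
    simp
  have hlim : ∀ ε : ℝ, 0 < ε → ‖k‖ / 6 ≤ D * ε := by
    intro ε hε
    have h1 : Tendsto (fun n => D * (ε + ε⁻¹ * ∫ t in n..(n + 1), ‖y t‖ ^ 2)) atTop
        (𝓝 (D * (ε + ε⁻¹ * 0))) :=
      (((tendsto_norm_sq_tail hL).const_mul _).const_add _).const_mul _
    rw [mul_zero, add_zero] at h1
    refine ge_of_tendsto h1 ?_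
    filter_upwards [eventually_gt_atTop 0] with n hn using hmain n hn ε hε
  have h2 : ‖k‖ / 6 ≤ 0 := by
    refine le_of_forall_pos_le_add fun δ hδ => ?_
    have := hlim (δ / (D + 1)) (by positivity)
    have h3 : D * (δ / (D + 1)) ≤ δ := by
      rw [mul_div_assoc', div_le_iff₀ (by positivity)]
      nlinarith
    linarith
  exact norm_le_zero_iff.1 (by linarith)

theorem not_sq_integrable_jostF_real (hp : HasMoment p) (ξ : ℝ) :
    ¬ IntegrableOn (fun t => ‖jostF p ξ t‖ ^ 2) (Ioi 0) := by
  intro hL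
  have h1 : (0 : ℝ) ≤ ((ξ : ℂ)).im := by simp
  have ht := tendsto_norm_sq_tail hL
  have hnorm : ∀ t, ‖jostF p ξ t‖ = ‖jostM p ξ t‖ := fun t => by
    rw [jostF, norm_mul, Complex.norm_exp]; simp
  have hm : ∀ᶠ t in atTop, (1 / 2 : ℝ) ≤ ‖jostF p ξ t‖ ^ 2 := by
    have := ((tendsto_jostM hp h1).norm).pow 2
    rw [norm_one, one_pow] at this
    filter_upwards [this.eventually_const_lt (show (1 / 2 : ℝ) < 1 by norm_num)] with t ht
    rw [hnorm]; exact ht.le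
  obtain ⟨X, hX⟩ := eventually_atTop.1 hm
  have hcon : (1 / 2 : ℝ) ≤ 0 := by
    refine ge_of_tendsto ht ?_
    filter_upwards [eventually_ge_atTop X] with n hn
    have hc := ((continuous_jostF hp h1).norm.pow 2).intervalIntegrable (μ := volume) n (n + 1)
    have := intervalIntegral.integral_mono_on (by linarith) intervalIntegrable_const hc
      (fun t ht => hX t (hn.trans ht.1))
    simpa using this
  norm_num at hcon

end Brackets

/-! ### From the transfer problem to half-line solutions -/

/-- The potential as a complex function. -/
def potR (q : ℝ → ℝ) (x : ℝ) : ℂ := q x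

/-- The reflected potential as a complex function. -/
def potL (q : ℝ → ℝ) (x : ℝ) : ℂ := q (-x)

theorem potR_conj (q : ℝ → ℝ) (x : ℝ) : (starRingEnd ℂ) (potR q x) = potR q x :=
  Complex.conj_ofReal _

theorem potL_conj (q : ℝ → ℝ) (x : ℝ) : (starRingEnd ℂ) (potL q x) = potL q x :=
  Complex.conj_ofReal _

theorem AdmissiblePotential.potR {q : ℝ → ℝ} (hq : AdmissiblePotential q) :
    HasMoment (potR q) where
  meas := Complex.continuous_ofReal.comp_aestronglyMeasurable hq.memLp_two.1
  int := by
    refine hq.integrable_moment.norm.congr (Eventually.of_forall fun t => ?_)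
    have : (0 : ℝ) ≤ 1 + |t| := by positivity
    simp [_root_.potR, abs_of_nonneg this]

theorem AdmissiblePotential.potL {q : ℝ → ℝ} (hq : AdmissiblePotential q) :
    HasMoment (potL q) where
  meas := by
    have := hq.potR.meas.comp_quasiMeasurePreserving
      (Measure.measurePreserving_neg (volume : Measure ℝ)).quasiMeasurePreserving
    exact this
  int := by
    have := hq.potR.int.comp_neg
    simpa [_root_.potL, _root_.potR] using this

theorem HasMoment.intervalIntegrable_mul {p u : ℝ → ℂ} (hp : HasMoment p) (μ : ℂ) {a b : ℝ}
    (hu : ContinuousOn u (uIcc a b)) :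
    IntervalIntegrable (fun x => (p x - μ) * u x) volume a b :=
  (hp.integrable.intervalIntegrable.sub intervalIntegrable_const).mul_continuousOn hu

theorem AbsolutelyContinuousOnInterval.reflect {u g : ℝ → ℂ} {a b : ℝ} (hab : a ≤ b)
    (hu : AbsolutelyContinuousOnInterval u a b)
    (hd : ∀ᵐ x, x ∈ uIcc a b → HasDerivAt u (g x) x) (hg : IntervalIntegrable g volume a b) :
    AbsolutelyContinuousOnInterval (fun x => u (-x)) (-b) (-a) := by
  have h1 : IntervalIntegrable (fun x => g (-x)) volume (-a) (-b) := 
    (IntervalIntegrable.iff_comp_neg).1 hg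
  have h2 := absolutelyContinuousOnInterval_integral_complex h1.symm (c := -b) (by simp)
  refine ((AbsolutelyContinuousOnInterval.const_complex (u b) (-b) (-a)).sub h2).congr_uIcc ?_
  intro x hx
  rw [uIcc_of_le (by linarith)] at hx
  have hsub : uIcc (-x) b ⊆ uIcc a b := by
    rw [uIcc_of_le hab, uIcc_of_le (by linarith [hx.1])]
    exact Icc_subset_Icc_left (by linarith [hx.2])
  have h3 := (hu.mono hsub).sub_eq_integral (hd.mono fun t ht hts => ht (hsub hts))
    (hg.mono_set hsub)
  simp only [Pi.sub_apply]
  rw [intervalIntegral.integral_comp_neg (fun t => g t), neg_neg, ← h3]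
  ring

/-- Absolute continuity alone differentiates y only almost everywhere, and `deriv` is 0 by default
elsewhere. Continuity of `deriv y` excludes the exceptional points, since y is then a primitive of a
continuous function. -/
theorem hasDerivAt_of_ac {y : ℝ → ℂ} {a b : ℝ} (hy : AbsolutelyContinuousOnInterval y a b)
    (hy' : AbsolutelyContinuousOnInterval (deriv y) a b) {x : ℝ} (hax : a < x) (hxb : x < b) :
    HasDerivAt y (deriv y x) x := by
  have hab : a ≤ b := (hax.trans hxb).le
  have hc := hy'.continuousOn
  have hae : ∀ᵐ t, t ∈ uIcc a b → HasDerivAt y (deriv y t) t := by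
    filter_upwards [hy.boundedVariationOn.ae_differentiableAt_of_mem_uIcc] with t ht hts
    exact (ht hts).hasDerivAt
  have heq : ∀ t ∈ Icc a b, y t = y a + ∫ s in a..t, deriv y s := by
    intro t ht
    have hsub : uIcc a t ⊆ uIcc a b := by
      rw [uIcc_of_le ht.1, uIcc_of_le hab]; exact Icc_subset_Icc_right ht.2
    have := (hy.mono hsub).sub_eq_integral (hae.mono fun s hs h => hs (hsub h))
      (hc.mono hsub).intervalIntegrable
    rw [← this]; ring
  rw [uIcc_of_le hab] at hc
  have hnhds : Icc a b ∈ 𝓝 x := Icc_mem_nhds hax hxb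
  have hcx : ContinuousAt (deriv y) x := hc.continuousAt hnhds
  have hi : IntervalIntegrable (deriv y) volume a x := by
    refine ContinuousOn.intervalIntegrable (hc.mono ?_)
    rw [uIcc_of_le hax.le]; exact Icc_subset_Icc_right hxb.le
  have hsm : StronglyMeasurableAtFilter (deriv y) (𝓝 x) :=
    ContinuousOn.stronglyMeasurableAtFilter isOpen_Ioo (hc.mono Ioo_subset_Icc_self) x
      ⟨hax, hxb⟩
  refine ((intervalIntegral.integral_hasDerivAt_right hi hsm hcx).const_add
    (y a)).congr_of_eventuallyEq ?_
  filter_upwards [hnhds] with t ht using heq t ht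

theorem PiecewiseAC.hasDerivAt {y : ℝ → ℂ} (hy : PiecewiseAC y) {x : ℝ} (hx : x ≠ 0) :
    HasDerivAt y (deriv y x) x := by
  rcases lt_or_gt_of_ne hx with h | h
  · obtain ⟨h1, h2⟩ := hy (x - 1) (x / 2) (by linarith) (Or.inl (by linarith))
    exact hasDerivAt_of_ac h1 h2 (by linarith) (by linarith)
  · obtain ⟨h1, h2⟩ := hy (x / 2) (x + 1) (by linarith) (Or.inr (by linarith))
    exact hasDerivAt_of_ac h1 h2 (by linarith) (by linarith)

theorem PiecewiseAC.ae_hasDerivAt_deriv {y : ℝ → ℂ} (hy : PiecewiseAC y) :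
    ∀ᵐ x : ℝ, x ≠ 0 → HasDerivAt (deriv y) (deriv (deriv y) x) x := by
  -- The intervals [1/(N+1), N+1] and their reflections exhaust ℝ \ {0}, so countably many null sets
  -- suffice.
  have h1 : ∀ᵐ x : ℝ, ∀ N : ℕ, (x ∈ uIcc (1 / ((N : ℝ) + 1)) (N + 1) → DifferentiableAt ℝ (deriv y) x)
      ∧ (x ∈ uIcc (-((N : ℝ) + 1)) (-(1 / ((N : ℝ) + 1))) → DifferentiableAt ℝ (deriv y) x) := by
    rw [ae_all_iff]
    intro N
    have hN : (0 : ℝ) < 1 / ((N : ℝ) + 1) := by positivity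
    have hN1 : 1 / ((N : ℝ) + 1) ≤ N + 1 := by
      rw [div_le_iff₀ (by positivity)]; nlinarith [(Nat.cast_nonneg N : (0 : ℝ) ≤ N)]
    filter_upwards [(hy _ _ hN1 (Or.inr hN)).2.boundedVariationOn.ae_differentiableAt_of_mem_uIcc,
      (hy _ _ (neg_le_neg hN1) (Or.inl (neg_lt_zero.2 hN))
        ).2.boundedVariationOn.ae_differentiableAt_of_mem_uIcc] with x ha hb using ⟨ha, hb⟩
  filter_upwards [h1] with x hx h0
  obtain ⟨N, hN⟩ := exists_nat_ge (max |x| (1 / |x|))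
  have hpos : 0 < |x| := abs_pos.2 h0
  have hN1 : |x| ≤ N + 1 := by linarith [(le_max_left _ _).trans hN]
  have hN2 : 1 / ((N : ℝ) + 1) ≤ |x| := by
    have := (le_max_right _ _).trans hN
    rw [div_le_iff₀ hpos] at this
    rw [div_le_iff₀ (by positivity)]
    nlinarith
  have hle := hN2.trans hN1
  refine DifferentiableAt.hasDerivAt ?_
  rcases lt_or_gt_of_ne h0 with h | h
  · rw [abs_of_neg h] at hN1 hN2
    refine (hx N).2 ?_
    rw [uIcc_of_le (neg_le_neg hle)]
    exact ⟨by linarith, by linarith⟩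
  · rw [abs_of_pos h] at hN1 hN2
    refine (hx N).1 ?_
    rw [uIcc_of_le hle]
    exact ⟨hN2, hN1⟩

theorem PiecewiseAC.ae_eq_deriv {q : ℝ → ℝ} {μ : ℂ} {y : ℝ → ℂ} (hy : PiecewiseAC y)
    (he : ∀ᵐ x ∂volume, schrodingerExpr q y x = μ * y x) :
    ∀ᵐ x : ℝ, x ≠ 0 → HasDerivAt (deriv y) (((q x : ℂ) - μ) * y x) x := by
  filter_upwards [he, hy.ae_hasDerivAt_deriv] with x h1 h2 h0
  refine (h2 h0).congr_deriv ?_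
  rw [schrodingerExpr] at h1
  linear_combination -h1

theorem PiecewiseAC.isHalfSol_right {q : ℝ → ℝ} {μ : ℂ} {y : ℝ → ℂ} (hy : PiecewiseAC y)
    (he : ∀ᵐ x ∂volume, schrodingerExpr q y x = μ * y x) :
    IsHalfSol (fun x => potR q x - μ) y (deriv y) where
  hasDerivAt x hx := hy.hasDerivAt hx.ne'
  ac a b ha hab := (hy a b hab (Or.inr ha)).2
  eq := by
    filter_upwards [hy.ae_eq_deriv he] with x hx h0 using hx h0.ne'

theorem ae_comp_neg {P : ℝ → Prop} (h : ∀ᵐ x : ℝ, P x) : ∀ᵐ x : ℝ, P (-x) :=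
  (Measure.measurePreserving_neg (volume : Measure ℝ)).quasiMeasurePreserving.ae h

theorem PiecewiseAC.isHalfSol_left {q : ℝ → ℝ} (hq : AdmissiblePotential q) {μ : ℂ} {y : ℝ → ℂ}
    (hy : PiecewiseAC y) (he : ∀ᵐ x ∂volume, schrodingerExpr q y x = μ * y x) :
    IsHalfSol (fun x => potL q x - μ) (fun x => y (-x)) (fun x => -deriv y (-x)) where
  hasDerivAt x hx := by
    have := (hy.hasDerivAt (x := -x) (by linarith)).scomp x (hasDerivAt_neg x)
    exact this.congr_deriv (by simp)
  ac a b ha hab := by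
    have h := hy (-b) (-a) (by linarith) (Or.inl (by linarith))
    have hr := h.2.reflect (by linarith) (g := fun x => ((q x : ℂ) - μ) * y x) ?_ ?_
    · rw [neg_neg, neg_neg] at hr
      exact hr.neg
    · filter_upwards [hy.ae_eq_deriv he] with x hx hxs
      rw [uIcc_of_le (by linarith)] at hxs
      exact hx (by linarith [hxs.2])
    · exact hq.potR.intervalIntegrable_mul μ h.1.continuousOn
  eq := by
    filter_upwards [ae_comp_neg (hy.ae_eq_deriv he)] with x hx h0
    have := ((hx (by linarith)).scomp x (hasDerivAt_neg x)).neg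
    refine this.congr_deriv ?_
    simp [potL]

/-- Glue two half-line functions. -/
noncomputable def glue (u w : ℝ → ℂ) (x : ℝ) : ℂ := if 0 < x then u x else w (-x)

theorem glue_pos (u w : ℝ → ℂ) {x : ℝ} (hx : 0 < x) : glue u w x = u x := if_pos hx

/-! ### Assembling a function on the line from two half-line solutions. -/

section Glue
variable {q : ℝ → ℝ} {μ : ℂ} {u u' w w' : ℝ → ℂ}

theorem IsHalfSol.deriv_glue_pos {P : ℝ → ℂ} (hu : IsHalfSol P u u') (w : ℝ → ℂ) {x : ℝ}
    (hx : 0 < x) : deriv (glue u w) x = u' x := by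
  refine HasDerivAt.deriv ((hu.hasDerivAt x hx).congr_of_eventuallyEq ?_)
  filter_upwards [Ioi_mem_nhds hx] with t ht using glue_pos u w ht

theorem IsHalfSol.deriv_glue_neg {P : ℝ → ℂ} (hw : IsHalfSol P w w') (u : ℝ → ℂ) {x : ℝ}
    (hx : x < 0) : deriv (glue u w) x = -w' (-x) := by
  have := (hw.hasDerivAt (-x) (by linarith)).scomp x (hasDerivAt_neg x)
  refine HasDerivAt.deriv (HasDerivAt.congr_of_eventuallyEq (by simpa using this) ?_)
  filter_upwards [Iio_mem_nhds hx] with t ht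
  exact if_neg (not_lt.2 (le_of_lt ht))

theorem piecewiseAC_glue (hq : AdmissiblePotential q)
    (hu : IsHalfSol (fun x => potR q x - μ) u u') (hw : IsHalfSol (fun x => potL q x - μ) w w') :
    PiecewiseAC (glue u w) := by
  rintro a b hab (hb | ha)
  · have hsub : uIcc (-b) (-a) ⊆ Ioi 0 := by
      rw [uIcc_of_le (by linarith)]
      exact fun x hx => lt_of_lt_of_le (by linarith) hx.1
    have h1 := (hw.ac_self (a := -b) (b := -a) (by linarith) (by linarith)).reflect (by linarith)
      (Eventually.of_forall fun x hx => hw.hasDerivAt x (hsub hx))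
      (hw.continuousOn_deriv.mono hsub).intervalIntegrable
    have h2 := (hw.ac (-b) (-a) (by linarith) (by linarith)).reflect (by linarith)
      (hw.eq.mono fun x hx hxs => hx (hsub hxs))
      (hq.potL.intervalIntegrable_mul μ (hw.continuousOn.mono hsub))
    rw [neg_neg, neg_neg] at h1 h2
    constructor
    · refine h1.congr_uIcc fun x hx => ?_
      rw [uIcc_of_le hab] at hx
      rw [glue, if_neg (by linarith [hx.2])]
    · refine h2.neg.congr_uIcc fun x hx => ?_
      rw [uIcc_of_le hab] at hx
      rw [hw.deriv_glue_neg u (by linarith [hx.2])]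
      rfl
  · constructor
    · refine (hu.ac_self ha hab).congr_uIcc fun x hx => ?_
      rw [uIcc_of_le hab] at hx
      rw [glue_pos u w (by linarith [hx.1])]
    · refine (hu.ac a b ha hab).congr_uIcc fun x hx => ?_
      rw [uIcc_of_le hab] at hx
      rw [hu.deriv_glue_pos w (by linarith [hx.1])]

theorem ae_schrodingerExpr_glue
    (hu : IsHalfSol (fun x => potR q x - μ) u u') (hw : IsHalfSol (fun x => potL q x - μ) w w') :
    ∀ᵐ x ∂volume, schrodingerExpr q (glue u w) x = μ * glue u w x := by
  filter_upwards [hu.eq, ae_comp_neg hw.eq, Measure.ae_ne volume (0 : ℝ)] with x h1 h2 h0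
  rw [schrodingerExpr]
  rcases lt_or_gt_of_ne h0 with h | h
  · have h3 := ((h2 (by linarith)).scomp x (hasDerivAt_neg x)).neg
    have h4 : deriv (deriv (glue u w)) x = -((-1 : ℝ) • ((potL q (-x) - μ) * w (-x))) := by
      refine HasDerivAt.deriv (h3.congr_of_eventuallyEq ?_)
      filter_upwards [Iio_mem_nhds h] with t ht
      exact hw.deriv_glue_neg u ht
    rw [h4, glue, if_neg (not_lt.2 h.le)]
    simp only [potL, neg_neg, neg_smul, one_smul]
    ring
  · have h4 : deriv (deriv (glue u w)) x = (potR q x - μ) * u x := by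
      refine HasDerivAt.deriv ((h1 h).congr_of_eventuallyEq ?_)
      filter_upwards [Ioi_mem_nhds h] with t ht
      exact hu.deriv_glue_pos w ht
    rw [h4, glue_pos u w h]
    simp only [potR]
    ring

end Glue

theorem tendsto_neg_nhdsGT_zero : Tendsto (fun x : ℝ => -x) (𝓝[>] 0) (𝓝[<] 0) := by
  have := tendsto_neg_nhdsGT (a := (0 : ℝ))
  rwa [neg_zero] at this

theorem tendsto_neg_nhdsLT_zero : Tendsto (fun x : ℝ => -x) (𝓝[<] 0) (𝓝[>] 0) := by
  have := tendsto_neg_nhdsLT (a := (0 : ℝ))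
  rwa [neg_zero] at this

/-! ### The transfer condition in terms of half-line data. -/

section Transfer
variable {q : ℝ → ℝ} {M : Matrix (Fin 2) (Fin 2) ℝ} {μ : ℂ}

theorem transferCondition_glue {P Q u u' w w' : ℝ → ℂ} {c d c' d' : ℂ}
    (hu : IsHalfSol P u u') (hw : IsHalfSol Q w w')
    (hui : HasInit u u' c d) (hwi : HasInit w w' c' d') (hM : M 0 1 = 0)
    (h1 : c = M 0 0 * c') (h2 : d = M 1 0 * c' - M 1 1 * d') : TransferCondition M (glue u w) := by
  -- The left piece is stored reflected, so its derivative datum d' is -y'(0⁻).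
  refine ⟨![c', -d'], ![c, d], ?_, ?_, ?_, ?_, ?_⟩
  · refine (hwi.1.comp tendsto_neg_nhdsLT_zero).congr' ?_
    filter_upwards [self_mem_nhdsWithin] with x hx
    exact (if_neg (not_lt.2 (le_of_lt hx))).symm
  · refine ((hwi.2.comp tendsto_neg_nhdsLT_zero).neg).congr' ?_
    filter_upwards [self_mem_nhdsWithin] with x hx
    exact (hw.deriv_glue_neg u hx).symm
  · refine hui.1.congr' ?_
    filter_upwards [self_mem_nhdsWithin] with x hx
    exact (glue_pos u w hx).symm
  · refine hui.2.congr' ?_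
    filter_upwards [self_mem_nhdsWithin] with x hx
    exact (hu.deriv_glue_pos w hx).symm
  · ext i
    fin_cases i
    · simp [Matrix.mulVec, dotProduct, Fin.sum_univ_two, hM, h1]
    · simp [Matrix.mulVec, dotProduct, Fin.sum_univ_two, h2]
      ring

theorem isTransferSolution_glue (hq : AdmissiblePotential q) {u u' w w' : ℝ → ℂ} {c d c' d' : ℂ}
    (hu : IsHalfSol (fun x => potR q x - μ) u u') (hw : IsHalfSol (fun x => potL q x - μ) w w')
    (hui : HasInit u u' c d) (hwi : HasInit w w' c' d') (hM : M 0 1 = 0)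
    (h1 : c = M 0 0 * c') (h2 : d = M 1 0 * c' - M 1 1 * d') :
    IsTransferSolution q M μ (glue u w) :=
  ⟨piecewiseAC_glue hq hu hw, transferCondition_glue hu hw hui hwi hM h1 h2,
    ae_schrodingerExpr_glue hu hw⟩

theorem TransferCondition.exists_hasInit {y : ℝ → ℂ} (h : TransferCondition M y) (hM : M 0 1 = 0) :
    ∃ c d c' d' : ℂ, HasInit y (deriv y) c d ∧
      HasInit (fun x => y (-x)) (fun x => -deriv y (-x)) c' d' ∧
      c = M 0 0 * c' ∧ d = M 1 0 * c' - M 1 1 * d' := by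
  obtain ⟨l, r, h1, h2, h3, h4, h5⟩ := h
  refine ⟨r 0, r 1, l 0, -l 1, ⟨h3, h4⟩, ⟨h1.comp tendsto_neg_nhdsGT_zero,
    (h2.comp tendsto_neg_nhdsGT_zero).neg⟩, ?_, ?_⟩
  · rw [h5]; simp [Matrix.mulVec, dotProduct, Fin.sum_univ_two, hM]
  · rw [h5]; simp [Matrix.mulVec, dotProduct, Fin.sum_univ_two]

end Transfer

/-! ### Half-line solutions for real spectral parameter -/

section RealSpectral
variable {p : ℝ → ℂ}

theorem exists_isHalfSol_hasInit (hp : HasMoment p) {ξ : ℝ} (hξ : ξ ≠ 0) (c d : ℂ) :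
    ∃ s t : ℂ, IsHalfSol (fun x => p x - (ξ : ℂ) ^ 2)
        (fun x => s * jostF p ξ x + t * jostF p (-ξ) x)
        (fun x => s * jostF' p ξ x + t * jostF' p (-ξ) x) ∧
      HasInit (fun x => s * jostF p ξ x + t * jostF p (-ξ) x)
        (fun x => s * jostF' p ξ x + t * jostF' p (-ξ) x) c d := by
  have h1 : (0 : ℝ) ≤ ((ξ : ℂ)).im := by simp
  have h2 : (0 : ℝ) ≤ (-(ξ : ℂ)).im := by simp
  have hs1 := isHalfSol_jostF hp h1
  have hs2 := isHalfSol_jostF hp h2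
  rw [neg_sq] at hs2
  have hi1 := hasInit_jostF hp h1
  have hi2 := hasInit_jostF hp h2
  have hw := hs1.wronskian_eq_init hs2 hi1 hi2 one_pos
  rw [jostF_wronskian_neg hp ξ one_pos] at hw
  have hξ' : (ξ : ℂ) ≠ 0 := Complex.ofReal_ne_zero.2 hξ
  have hD : (-(2 * Complex.I * ξ) : ℂ) ≠ 0 := by simp [hξ]
  -- Cramer's rule for the basis formed by the Jost solutions at ξ and -ξ, with Wronskian -2iξ.
  refine ⟨(c * jostV p (-ξ) - d * jostA p (-ξ)) / (-(2 * Complex.I * ξ)),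
    (jostA p ξ * d - jostV p ξ * c) / (-(2 * Complex.I * ξ)),
    (hs1.const_mul _).add (hs2.const_mul _), ?_⟩
  convert! (hi1.const_mul ((c * jostV p (-ξ) - d * jostA p (-ξ)) / (-(2 * Complex.I * ξ)))).add
    (hi2.const_mul ((jostA p ξ * d - jostV p ξ * c) / (-(2 * Complex.I * ξ)))) using 1
  · rw [div_mul_eq_mul_div, div_mul_eq_mul_div, ← add_div, eq_div_iff hD]
    linear_combination c * hw
  · rw [div_mul_eq_mul_div, div_mul_eq_mul_div, ← add_div, eq_div_iff hD]
    linear_combination d * hw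

/-- For real ξ both basis solutions have bounded amplitude, so decay cannot separate them. Writing h
= s f_ξ + t f_{-ξ}, the normalisation forces t e^{-2iξy} → 1 - s; an oscillating term of constant
modulus can converge only if t = 0, and then s = 1. -/
theorem eq_jostF_of_asymptotics (hp : HasMoment p) {ξ : ℝ} (hξ : ξ ≠ 0) {h h' : ℝ → ℂ} {c d : ℂ}
    (hh : IsHalfSol (fun x => p x - (ξ : ℂ) ^ 2) h h') (hi : HasInit h h' c d)
    (hl : Tendsto (fun x : ℝ => Complex.exp (-(Complex.I * ξ * x)) * h x) atTop (𝓝 1))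
    {x : ℝ} (hx : 0 < x) : h x = jostF p ξ x := by
  have h1 : (0 : ℝ) ≤ ((ξ : ℂ)).im := by simp
  have h2 : (0 : ℝ) ≤ (-(ξ : ℂ)).im := by simp
  obtain ⟨s, t, hst, hsti⟩ := exists_isHalfSol_hasInit hp hξ c d
  have heq : ∀ y, 0 < y → h y = s * jostF p ξ y + t * jostF p (-ξ) y := fun y hy =>
    hh.eq_of_hasInit hp hst hi hsti hy
  have hl1 : Tendsto (fun y : ℝ => s * jostM p ξ y +
      t * Complex.exp (-(2 * Complex.I * ξ * y)) * jostM p (-ξ) y) atTop (𝓝 1) := by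
    refine hl.congr' ?_
    filter_upwards [eventually_gt_atTop 0] with y hy
    rw [heq y hy, jostF, jostF]
    have e1 : Complex.exp (-(Complex.I * ξ * y)) * Complex.exp (Complex.I * ξ * y) = 1 := by
      rw [← Complex.exp_add]; simp
    have e2 : Complex.exp (-(Complex.I * ξ * y)) * Complex.exp (Complex.I * -ξ * y) =
        Complex.exp (-(2 * Complex.I * ξ * y)) := by
      rw [← Complex.exp_add]; congr 1; ring
    linear_combination (s * jostM p ξ y) * e1 + (t * jostM p (-ξ) y) * e2
  have hl2 : Tendsto (fun y : ℝ => t * Complex.exp (-(2 * Complex.I * ξ * y))) atTop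
      (𝓝 (1 - s)) := by
    have hm2 := tendsto_jostM hp h2
    have := (hl1.sub ((tendsto_jostM hp h1).const_mul s)).div hm2 one_ne_zero
    rw [mul_one, div_one] at this
    refine this.congr' ?_
    filter_upwards [hm2.eventually_ne one_ne_zero] with y hy
    simp only [Pi.div_apply]
    rw [add_sub_cancel_left, mul_div_assoc, div_self hy, mul_one]
  have hs : (1 : ℂ) - s = 0 := by
    -- A shift by half a period of e^{-2iξy} changes its sign, so the limit equals its own negative.
    have hsh : Tendsto (fun y : ℝ => y + Real.pi / |2 * ξ|) atTop atTop :=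
      tendsto_atTop_add_const_right _ _ tendsto_id
    have h3 := hl2.comp hsh
    have h4 : ∀ y : ℝ, Complex.exp (-(2 * Complex.I * ξ * ((y + Real.pi / |2 * ξ| : ℝ) : ℂ))) =
        -Complex.exp (-(2 * Complex.I * ξ * y)) := by
      intro y
      rcases lt_or_gt_of_ne hξ with h | h
      · have hξ' : (ξ : ℂ) ≠ 0 := Complex.ofReal_ne_zero.2 hξ
        rw [abs_of_neg (by linarith)]
        rw [show (-(2 * Complex.I * ξ * ((y + Real.pi / -(2 * ξ) : ℝ) : ℂ))) =
          -(2 * Complex.I * ξ * y) + Real.pi * Complex.I by push_cast; field_simp; ring,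
          Complex.exp_add, Complex.exp_pi_mul_I]
        ring
      · have hξ' : (ξ : ℂ) ≠ 0 := Complex.ofReal_ne_zero.2 hξ
        rw [abs_of_pos (by linarith)]
        rw [show (-(2 * Complex.I * ξ * ((y + Real.pi / (2 * ξ) : ℝ) : ℂ))) =
          -(2 * Complex.I * ξ * y) - Real.pi * Complex.I by push_cast; field_simp; ring,
          Complex.exp_sub, Complex.exp_pi_mul_I]
        ring
    have h5 : Tendsto (fun y : ℝ => t * Complex.exp (-(2 * Complex.I * ξ * y))) atTop
        (𝓝 (-(1 - s))) := by
      refine h3.neg.congr fun y => ?_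
      simp only [Function.comp_apply, h4]
      ring
    have h6 := tendsto_nhds_unique hl2 h5
    linear_combination (1 / 2 : ℂ) * h6
  have ht : t = 0 := by
    rw [hs] at hl2
    have h7 := hl2.norm
    have h8 : ∀ y : ℝ, ‖t * Complex.exp (-(2 * Complex.I * ξ * y))‖ = ‖t‖ := fun y => by
      rw [norm_mul, Complex.norm_exp]; simp
    simp only [h8, norm_zero] at h7
    exact norm_eq_zero.1 (tendsto_nhds_unique tendsto_const_nhds h7)
  rw [heq x hx, ht, ← sub_eq_zero.1 hs]
  ring

theorem tendsto_exp_mul_jostF (hp : HasMoment p) {ζ : ℂ} (hζ : 0 ≤ ζ.im) :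
    Tendsto (fun x : ℝ => Complex.exp (-(Complex.I * ζ * x)) * jostF p ζ x) atTop (𝓝 1) := by
  refine (tendsto_jostM hp hζ).congr fun x => ?_
  rw [jostF, ← mul_assoc, ← Complex.exp_add]
  simp

end RealSpectral

/-! ### The Jost solutions of the transfer problem and the connection coefficients -/

section Jost
variable {q : ℝ → ℝ} {M : Matrix (Fin 2) (Fin 2) ℝ}

theorem diag_mul_eq_one (hdet : M.det = 1) (hM : M 0 1 = 0) : (M 0 0 : ℂ) * M 1 1 = 1 := by
  rw [Matrix.det_fin_two, hM] at hdet
  simp only [zero_mul, sub_zero] at hdet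
  exact_mod_cast hdet

/-- The choice made by `epsilon` is harmless: a solution exists by gluing, its asymptotics determine
it for x > 0, and the inverse of M carries the data to the left side. The data of the reflected left
piece come out as m₂₂a_R and m₂₁a_R - m₁₁v_R. -/
theorem jostPlus_spec (hq : AdmissiblePotential q) (hdet : M.det = 1) (hM : M 0 1 = 0) {ξ : ℝ}
    (hξ : ξ ≠ 0) : (∀ x, 0 < x → jostPlus q M ξ x = jostF (potR q) ξ x) ∧
      ∃ w w' : ℝ → ℂ, IsHalfSol (fun x => potL q x - (ξ : ℂ) ^ 2) w w' ∧
        HasInit w w' (M 1 1 * jostA (potR q) ξ) (M 1 0 * jostA (potR q) ξ - M 0 0 * jostV (potR q) ξ) ∧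
        ∀ x, 0 < x → jostPlus q M ξ (-x) = w x := by
  have hp := hq.potR
  have hM1 := diag_mul_eq_one hdet hM
  have h1 : (0 : ℝ) ≤ ((ξ : ℂ)).im := by simp
  have hex : ∃ f, IsJostPlus q M ξ f := by
    obtain ⟨s, t, hst, hsti⟩ := exists_isHalfSol_hasInit hq.potL hξ (M 1 1 * jostA (potR q) ξ)
      (M 1 0 * jostA (potR q) ξ - M 0 0 * jostV (potR q) ξ)
    refine ⟨_, isTransferSolution_glue hq (isHalfSol_jostF hp h1) hst (hasInit_jostF hp h1) hsti hM
      ?_ ?_, ?_⟩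
    · linear_combination (-jostA (potR q) ξ) * hM1
    · linear_combination (-jostV (potR q) ξ) * hM1
    · refine (tendsto_exp_mul_jostF hp h1).congr' ?_
      filter_upwards [eventually_gt_atTop 0] with x hx
      rw [glue_pos _ _ hx]
  have hspec : IsJostPlus q M ξ (jostPlus q M ξ) := Classical.epsilon_spec hex
  obtain ⟨⟨hac, htr, hae⟩, hlim⟩ := hspec
  obtain ⟨c, d, c', d', hi, hi', e1, e2⟩ := htr.exists_hasInit hM
  have hR := hac.isHalfSol_right hae
  have hL := hac.isHalfSol_left hq hae
  have heq : ∀ x, 0 < x → jostPlus q M ξ x = jostF (potR q) ξ x := fun x hx =>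
    eq_jostF_of_asymptotics hp hξ hR hi hlim hx
  have hs1 := isHalfSol_jostF hp h1
  have heq' : ∀ x, 0 < x → deriv (jostPlus q M ξ) x = jostF' (potR q) ξ x := fun x hx => by
    refine HasDerivAt.deriv ((hs1.hasDerivAt x hx).congr_of_eventuallyEq ?_)
    filter_upwards [Ioi_mem_nhds hx] with t ht using heq t ht
  have hF := hasInit_jostF hp h1
  have hc : c = jostA (potR q) ξ := by
    refine tendsto_nhds_unique (hi.1.congr' ?_) hF.1
    filter_upwards [self_mem_nhdsWithin] with x hx using heq x hx
  have hd : d = jostV (potR q) ξ := by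
    refine tendsto_nhds_unique (hi.2.congr' ?_) hF.2
    filter_upwards [self_mem_nhdsWithin] with x hx using heq' x hx
  refine ⟨heq, _, _, hL, ?_, fun x _ => rfl⟩
  convert! hi' using 1
  · rw [← hc]; linear_combination (M 1 1 : ℂ) * e1 + c' * hM1
  · rw [← hc, ← hd]
    linear_combination (M 1 0 : ℂ) * e1 - (M 0 0 : ℂ) * e2 + d' * hM1

theorem jostMinus_spec (hq : AdmissiblePotential q) (hM : M 0 1 = 0) {ξ : ℝ}
    (hξ : ξ ≠ 0) : (∀ x, 0 < x → jostMinus q M ξ (-x) = jostF (potL q) ξ x) ∧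
      ∃ u u' : ℝ → ℂ, IsHalfSol (fun x => potR q x - (ξ : ℂ) ^ 2) u u' ∧
        HasInit u u' (M 0 0 * jostA (potL q) ξ) (M 1 0 * jostA (potL q) ξ - M 1 1 * jostV (potL q) ξ) ∧
        ∀ x, 0 < x → jostMinus q M ξ x = u x := by
  have hp := hq.potL
  have h1 : (0 : ℝ) ≤ ((ξ : ℂ)).im := by simp
  have hs1 := isHalfSol_jostF hp h1
  have hex : ∃ f, IsJostMinus q M ξ f := by
    obtain ⟨s, t, hst, hsti⟩ := exists_isHalfSol_hasInit hq.potR hξ (M 0 0 * jostA (potL q) ξ)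
      (M 1 0 * jostA (potL q) ξ - M 1 1 * jostV (potL q) ξ)
    refine ⟨_, isTransferSolution_glue hq hst hs1 hsti (hasInit_jostF hp h1) hM rfl rfl, ?_⟩
    refine ((tendsto_exp_mul_jostF hp h1).comp tendsto_neg_atBot_atTop).congr' ?_
    filter_upwards [eventually_lt_atBot 0] with x hx
    simp only [Function.comp_apply]
    rw [glue, if_neg (not_lt.2 hx.le)]
    congr 2; push_cast; ring
  have hspec : IsJostMinus q M ξ (jostMinus q M ξ) := Classical.epsilon_spec hex
  obtain ⟨⟨hac, htr, hae⟩, hlim⟩ := hspec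
  obtain ⟨c, d, c', d', hi, hi', e1, e2⟩ := htr.exists_hasInit hM
  have hR := hac.isHalfSol_right hae
  have hL := hac.isHalfSol_left hq hae
  have hlim' : Tendsto (fun x : ℝ => Complex.exp (-(Complex.I * ξ * x)) * jostMinus q M ξ (-x))
      atTop (𝓝 1) := by
    refine (hlim.comp tendsto_neg_atTop_atBot).congr fun x => ?_
    simp only [Function.comp_apply]
    congr 2; push_cast; ring
  have heq : ∀ x, 0 < x → jostMinus q M ξ (-x) = jostF (potL q) ξ x := fun x hx =>
    eq_jostF_of_asymptotics hp hξ hL hi' hlim' hx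
  have heq' : ∀ x, 0 < x → -deriv (jostMinus q M ξ) (-x) = jostF' (potL q) ξ x := fun x hx => by
    refine (hL.hasDerivAt x hx).unique ((hs1.hasDerivAt x hx).congr_of_eventuallyEq ?_)
    filter_upwards [Ioi_mem_nhds hx] with t ht using heq t ht
  have hF := hasInit_jostF hp h1
  have hc : c' = jostA (potL q) ξ := by
    refine tendsto_nhds_unique (hi'.1.congr' ?_) hF.1
    filter_upwards [self_mem_nhdsWithin] with x hx using heq x hx
  have hd : d' = jostV (potL q) ξ := by
    refine tendsto_nhds_unique (hi'.2.congr' ?_) hF.2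
    filter_upwards [self_mem_nhdsWithin] with x hx using heq' x hx
  refine ⟨heq, _, _, hR, ?_, fun x _ => rfl⟩
  rw [← hc, ← hd, ← e1, ← e2]
  exact hi

/-- The Wronskian of the two Jost solutions of the transfer problem. -/
noncomputable def jostW (q : ℝ → ℝ) (M : Matrix (Fin 2) (Fin 2) ℝ) (ζ : ℂ) : ℂ :=
  M 0 0 * jostA (potL q) ζ * jostV (potR q) ζ -
    (M 1 0 * jostA (potL q) ζ - M 1 1 * jostV (potL q) ζ) * jostA (potR q) ζ

/-- The Wronskian of the conjugate right and the left Jost solution of the transfer problem. -/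
noncomputable def jostWB (q : ℝ → ℝ) (M : Matrix (Fin 2) (Fin 2) ℝ) (ξ : ℝ) : ℂ :=
  (starRingEnd ℂ) (jostA (potR q) ξ) *
      (M 1 0 * jostA (potL q) ξ - M 1 1 * jostV (potL q) ξ) -
    (starRingEnd ℂ) (jostV (potR q) ξ) * (M 0 0 * jostA (potL q) ξ)

theorem isHalfSol_conj_jostF (hq : AdmissiblePotential q) (ξ : ℝ) :
    IsHalfSol (fun x => potR q x - (ξ : ℂ) ^ 2) (fun x => (starRingEnd ℂ) (jostF (potR q) ξ x))
      (fun x => (starRingEnd ℂ) (jostF' (potR q) ξ x)) := by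
  have h := (isHalfSol_jostF hq.potR (ζ := (ξ : ℂ)) (by simp)).conj
  simpa [potR_conj] using h

theorem hasInit_conj {u u' : ℝ → ℂ} {c d : ℂ} (h : HasInit u u' c d) :
    HasInit (fun x => (starRingEnd ℂ) (u x)) (fun x => (starRingEnd ℂ) (u' x))
      ((starRingEnd ℂ) c) ((starRingEnd ℂ) d) :=
  ⟨(Complex.continuous_conj.tendsto _).comp h.1, (Complex.continuous_conj.tendsto _).comp h.2⟩

/-- On the right the coefficients solve a linear system for the initial data whose determinant is
the bracket 2iξ. On the left the same system is transported through M⁻¹, and uniqueness of the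
initial value problem extends the identity to every x ≠ 0. The pair is unique because the Jost
solution and its conjugate have nonzero Wronskian. -/
theorem connectionPair_eq (hq : AdmissiblePotential q) (hdet : M.det = 1) (hM : M 0 1 = 0) {ξ : ℝ}
    (hξ : ξ ≠ 0) : connectionPair q M ξ =
      (jostW q M ξ / (2 * Complex.I * ξ), jostWB q M ξ / (2 * Complex.I * ξ)) := by
  obtain ⟨hP, w, w', hw, hwi, hwe⟩ := jostPlus_spec hq hdet hM hξ
  obtain ⟨hN, u, u', hu, hui, hue⟩ := jostMinus_spec (M := M) hq hM hξ
  have hM1 := diag_mul_eq_one hdet hM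
  have h1 : (0 : ℝ) ≤ ((ξ : ℂ)).im := by simp
  have hbr := jost_bracket_real hq.potR (potR_conj q) ξ
  have hD : (2 * Complex.I * ξ : ℂ) ≠ 0 := by simp [hξ]
  have hF := isHalfSol_jostF hq.potR h1
  have hFi := hasInit_jostF hq.potR h1
  have hFc := isHalfSol_conj_jostF hq ξ
  have hFci := hasInit_conj hFi
  set A := jostW q M ξ / (2 * Complex.I * ξ) with hA
  set B := jostWB q M ξ / (2 * Complex.I * ξ) with hB
  have eq1 : A * (starRingEnd ℂ) (jostA (potR q) ξ) + B * jostA (potR q) ξ =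
      M 0 0 * jostA (potL q) ξ := by
    rw [hA, hB, div_mul_eq_mul_div, div_mul_eq_mul_div, ← add_div, div_eq_iff hD, jostW, jostWB]
    linear_combination (M 0 0 * jostA (potL q) ξ) * hbr
  have eq2 : A * (starRingEnd ℂ) (jostV (potR q) ξ) + B * jostV (potR q) ξ =
      M 1 0 * jostA (potL q) ξ - M 1 1 * jostV (potL q) ξ := by
    rw [hA, hB, div_mul_eq_mul_div, div_mul_eq_mul_div, ← add_div, div_eq_iff hD, jostW, jostWB]
    linear_combination (M 1 0 * jostA (potL q) ξ - M 1 1 * jostV (potL q) ξ) * hbr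
  have hex : IsConnectionPair q M ξ (A, B) := by
    intro x hx
    rcases lt_or_gt_of_ne hx with h | h
    · have hx' : 0 < -x := by linarith
      have e1 := hN (-x) hx'
      have e2 := hwe (-x) hx'
      rw [neg_neg] at e1 e2
      rw [e1, e2]
      have hwc := hw.conj
      simp only [map_sub, potL_conj, map_pow, Complex.conj_ofReal] at hwc
      refine (isHalfSol_jostF hq.potL h1).eq_of_hasInit hq.potL
        ((hwc.const_mul A).add (hw.const_mul B)) (hasInit_jostF hq.potL h1) ?_ hx'
      convert! ((hasInit_conj hwi).const_mul A).add (hwi.const_mul B) using 1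
      · simp only [map_mul, Complex.conj_ofReal]
        linear_combination (-(M 1 1 : ℂ)) * eq1 - (jostA (potL q) ξ) * hM1
      · simp only [map_mul, map_sub, Complex.conj_ofReal]
        linear_combination (-(M 1 0 : ℂ)) * eq1 + (M 0 0 : ℂ) * eq2 - (jostV (potL q) ξ) * hM1
    · rw [hP x h, hue x h]
      refine hu.eq_of_hasInit hq.potR ((hFc.const_mul A).add (hF.const_mul B)) hui ?_ h
      convert! (hFci.const_mul A).add (hFi.const_mul B) using 1
      · exact eq1.symm
      · exact eq2.symm
  have hspec : IsConnectionPair q M ξ (connectionPair q M ξ) := Classical.epsilon_spec ⟨_, hex⟩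
  set A' := (connectionPair q M ξ).1
  set B' := (connectionPair q M ξ).2
  have hz : ∀ x, 0 < x → (A' - A) * (starRingEnd ℂ) (jostF (potR q) ξ x) +
      (B' - B) * jostF (potR q) ξ x = 0 := by
    intro x hx
    have e1 := hex x hx.ne'
    have e2 := hspec x hx.ne'
    rw [hP x hx] at e1 e2
    linear_combination e1 - e2
  have hsol := (hFc.const_mul (A' - A)).add (hF.const_mul (B' - B))
  have hz' : (A' - A) * (starRingEnd ℂ) (jostF' (potR q) ξ 1) +
      (B' - B) * jostF' (potR q) ξ 1 = 0 := by
    refine (hsol.hasDerivAt 1 one_pos).unique ((hasDerivAt_const 1 (0 : ℂ)).congr_of_eventuallyEq ?_)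
    filter_upwards [Ioi_mem_nhds one_pos] with t ht using hz t ht
  have hz1 := hz 1 one_pos
  have hw1 := hFc.wronskian_eq_init hF hFci hFi one_pos
  rw [hbr] at hw1
  have eA : A' - A = 0 := by
    have : (A' - A) * (2 * Complex.I * ξ) = 0 := by
      linear_combination (jostF' (potR q) ξ 1) * hz1 - (jostF (potR q) ξ 1) * hz' - (A' - A) * hw1
    exact (mul_eq_zero.1 this).resolve_right hD
  have eB : B' - B = 0 := by
    have : (B' - B) * (2 * Complex.I * ξ) = 0 := by
      linear_combination ((starRingEnd ℂ) (jostF (potR q) ξ 1)) * hz' -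
        ((starRingEnd ℂ) (jostF' (potR q) ξ 1)) * hz1 - (B' - B) * hw1
    exact (mul_eq_zero.1 this).resolve_right hD
  exact Prod.ext (sub_eq_zero.1 eA) (sub_eq_zero.1 eB)

theorem coeffA_eq (hq : AdmissiblePotential q) (hdet : M.det = 1) (hM : M 0 1 = 0) {ξ : ℝ}
    (hξ : ξ ≠ 0) : coeffA q M ξ = jostW q M ξ / (2 * Complex.I * ξ) := by
  rw [coeffA, connectionPair_eq hq hdet hM hξ]

theorem coeffB_eq (hq : AdmissiblePotential q) (hdet : M.det = 1) (hM : M 0 1 = 0) {ξ : ℝ}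
    (hξ : ξ ≠ 0) : coeffB q M ξ = jostWB q M ξ / (2 * Complex.I * ξ) := by
  rw [coeffB, connectionPair_eq hq hdet hM hξ]

/-- Conservation of energy: `|A|² - |B|² = 1`. -/
theorem normSq_coeffA_sub (hq : AdmissiblePotential q) (hdet : M.det = 1) (hM : M 0 1 = 0) {ξ : ℝ}
    (hξ : ξ ≠ 0) : ‖coeffA q M ξ‖ ^ 2 - ‖coeffB q M ξ‖ ^ 2 = 1 := by
  have hM1 := diag_mul_eq_one hdet hM
  have hR := jost_bracket_real hq.potR (potR_conj q) ξ
  have hL := jost_bracket_real hq.potL (potL_conj q) ξ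
  have hD : (2 * Complex.I * ξ : ℂ) ≠ 0 := by simp [hξ]
  have hDc : (starRingEnd ℂ) (2 * Complex.I * ξ : ℂ) = -(2 * Complex.I * ξ) := by
    simp [map_ofNat]
  have key : coeffA q M ξ * (starRingEnd ℂ) (coeffA q M ξ) -
      coeffB q M ξ * (starRingEnd ℂ) (coeffB q M ξ) = 1 := by
    rw [coeffA_eq hq hdet hM hξ, coeffB_eq hq hdet hM hξ, map_div₀, map_div₀, hDc, jostW, jostWB]
    simp only [map_sub, map_mul, Complex.conj_ofReal, Complex.conj_conj]
    set aR := jostA (potR q) ξ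
    set vR := jostV (potR q) ξ
    set aL := jostA (potL q) ξ
    set vL := jostV (potL q) ξ
    set D := (2 * Complex.I * ξ : ℂ)
    rw [div_mul_div_comm, div_mul_div_comm, ← sub_div, div_eq_iff (mul_ne_zero hD (neg_ne_zero.2 hD))]
    -- With denominators cleared, the left side is -m₁₁m₂₂ times the product of the left and right
    -- brackets, both equal to D.
    have e : (M 0 0 : ℂ) * M 1 1 * D * D = D * D := by rw [hM1, one_mul]
    linear_combination (-(M 0 0 : ℂ) * M 1 1 * ((starRingEnd ℂ) aL * vL - (starRingEnd ℂ) vL * aL)) * hR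
      - (M 0 0 : ℂ) * M 1 1 * D * hL - e
  rw [Complex.mul_conj, Complex.mul_conj, Complex.normSq_eq_norm_sq, Complex.normSq_eq_norm_sq] at key
  exact_mod_cast key

theorem one_le_norm_coeffA (hq : AdmissiblePotential q) (hdet : M.det = 1) (hM : M 0 1 = 0) {ξ : ℝ}
    (hξ : ξ ≠ 0) : 1 ≤ ‖coeffA q M ξ‖ := by
  have := normSq_coeffA_sub hq hdet hM hξ
  nlinarith [norm_nonneg (coeffA q M ξ), sq_nonneg ‖coeffB q M ξ‖]

theorem one_sub_norm_reflectionCoeff_sq (hq : AdmissiblePotential q) (hdet : M.det = 1)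
    (hM : M 0 1 = 0) {ξ : ℝ} (hξ : ξ ≠ 0) :
    1 - ‖reflectionCoeff q M ξ‖ ^ 2 = (‖coeffA q M ξ‖ ^ 2)⁻¹ := by
  have h1 := normSq_coeffA_sub hq hdet hM hξ
  have h2 : ‖coeffA q M ξ‖ ≠ 0 := (lt_of_lt_of_le one_pos (one_le_norm_coeffA hq hdet hM hξ)).ne'
  rw [reflectionCoeff, norm_div, div_pow]
  field_simp
  linarith

theorem norm_reflectionCoeff_lt_one (hq : AdmissiblePotential q) (hdet : M.det = 1)
    (hM : M 0 1 = 0) {ξ : ℝ} (hξ : ξ ≠ 0) : ‖reflectionCoeff q M ξ‖ < 1 := by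
  have h1 := one_sub_norm_reflectionCoeff_sq hq hdet hM hξ
  have h2 := one_le_norm_coeffA hq hdet hM hξ
  have h3 : 0 < (‖coeffA q M ξ‖ ^ 2)⁻¹ := by positivity
  nlinarith [norm_nonneg (reflectionCoeff q M ξ)]

end Jost

/-! ### The Wronskian of the two Jost solutions -/

section JostWronskian

variable {q : ℝ → ℝ} {M : Matrix (Fin 2) (Fin 2) ℝ}

theorem continuousOn_jostW (hq : AdmissiblePotential q) :
    ContinuousOn (jostW q M) {ζ : ℂ | 0 ≤ ζ.im} := by
  have h1 := continuousOn_jostA hq.potL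
  have h2 := continuousOn_jostA hq.potR
  have h3 := continuousOn_jostV hq.potL
  have h4 := continuousOn_jostV hq.potR
  unfold jostW
  fun_prop

theorem differentiableOn_jostW (hq : AdmissiblePotential q) :
    DifferentiableOn ℂ (jostW q M) {ζ : ℂ | 0 < ζ.im} := by
  have h1 := differentiableOn_jostA hq.potL
  have h2 := differentiableOn_jostA hq.potR
  have h3 := differentiableOn_jostV hq.potL
  have h4 := differentiableOn_jostV hq.potR
  unfold jostW
  fun_prop

/-- The extension of the coefficient `A` to the closed upper half-plane. -/
noncomputable def extA (q : ℝ → ℝ) (M : Matrix (Fin 2) (Fin 2) ℝ) (ζ : ℂ) : ℂ :=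
  jostW q M ζ / (2 * Complex.I * ζ)

theorem isUpperExtension_extA (hq : AdmissiblePotential q) (hdet : M.det = 1) (hM : M 0 1 = 0) :
    IsUpperExtension (coeffA q M) (extA q M) where
  analytic := (differentiableOn_jostW hq).div (by fun_prop) fun ζ hζ => by
    have : ζ ≠ 0 := by rintro rfl; simp at hζ
    simp [this]
  continuousOn := ((continuousOn_jostW hq).mono fun ζ hζ => hζ.1).div (by fun_prop) fun ζ hζ => by
    simp [hζ.2]
  boundary ξ hξ := (coeffA_eq hq hdet hM hξ).symm

theorem norm_jost_mul_sub_one_le {a b : ℂ} {r C D : ℝ} (hb : ‖b‖ ≤ D)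
    (h₁ : ‖a - 1‖ ≤ C / r) (h₂ : ‖b - 1‖ ≤ D / r) (hr : 0 < r) : ‖a * b - 1‖ * r ≤ C * D + D := by
  have h : a * b - 1 = (a - 1) * b + (b - 1) := by ring
  have h3 : ‖a * b - 1‖ ≤ C / r * D + D / r := by
    rw [h]
    refine (norm_add_le _ _).trans (add_le_add ?_ h₂)
    rw [norm_mul]
    exact mul_le_mul h₁ hb (norm_nonneg _) ((norm_nonneg _).trans h₁)
  calc ‖a * b - 1‖ * r ≤ (C / r * D + D / r) * r := mul_le_mul_of_nonneg_right h3 hr.le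
    _ = C * D + D := by field_simp

/-- Uniform bound on `jostW` relative to its leading term. -/
theorem exists_bound_jostW (hq : AdmissiblePotential q) : ∃ C : ℝ, ∀ ζ : ℂ, 0 ≤ ζ.im → ζ ≠ 0 →
    ‖jostW q M ζ - Complex.I * ζ * (M 0 0 + M 1 1)‖ ≤ C := by
  obtain ⟨C, hC, h⟩ := exists_jost_bounds hq.potL
  obtain ⟨D, hD, k⟩ := exists_jost_bounds hq.potR
  refine ⟨|M 0 0| * C * D + |M 1 1| * D * C + |M 1 0| * C * D +
    |M 0 0 + M 1 1| * (C * D + D), fun ζ hζ h0 => ?_⟩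
  obtain ⟨h1, -, h2, h3⟩ := h ζ hζ
  obtain ⟨k1, -, k2, k3⟩ := k ζ hζ
  have ha : ‖jostA (potL q) ζ‖ ≤ C := h1 0
  have hb : ‖jostA (potR q) ζ‖ ≤ D := k1 0
  have hab := norm_jost_mul_sub_one_le hb (h2 h0) (k2 h0) (norm_pos_iff.2 h0)
  have e : jostW q M ζ - Complex.I * ζ * (M 0 0 + M 1 1) =
      M 0 0 * jostA (potL q) ζ * (jostV (potR q) ζ - Complex.I * ζ * jostA (potR q) ζ) +
      M 1 1 * jostA (potR q) ζ * (jostV (potL q) ζ - Complex.I * ζ * jostA (potL q) ζ) +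
      -(M 1 0 * jostA (potL q) ζ * jostA (potR q) ζ) +
      ((M 0 0 + M 1 1 : ℝ) : ℂ) * (Complex.I * ((jostA (potL q) ζ * jostA (potR q) ζ - 1) * ζ)) := by
    rw [jostW]; push_cast; ring
  rw [e]
  refine (norm_add_le _ _).trans (add_le_add ((norm_add_le _ _).trans (add_le_add
    ((norm_add_le _ _).trans (add_le_add ?_ ?_)) ?_)) ?_)
  · rw [norm_mul, norm_mul, Complex.norm_real, Real.norm_eq_abs]
    gcongr
  · rw [norm_mul, norm_mul, Complex.norm_real, Real.norm_eq_abs]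
    gcongr
  · rw [norm_neg, norm_mul, norm_mul, Complex.norm_real, Real.norm_eq_abs]
    gcongr
  · rw [norm_mul, norm_mul, Complex.norm_real, Real.norm_eq_abs, Complex.norm_I, one_mul, norm_mul]
    gcongr

/-- Conjugation flips the sign in v_R = iξa_R + O(1), so the leading coefficient is the difference
of the diagonal entries where `jostW` has their sum. -/
theorem exists_bound_jostWB (hq : AdmissiblePotential q) : ∃ C : ℝ, ∀ ξ : ℝ, ξ ≠ 0 →
    ‖jostWB q M ξ - Complex.I * ξ * (M 0 0 - M 1 1)‖ ≤ C := by
  obtain ⟨C, hC, h⟩ := exists_jost_bounds hq.potL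
  obtain ⟨D, hD, k⟩ := exists_jost_bounds hq.potR
  refine ⟨|M 1 0| * D * C + |M 1 1| * D * C + |M 0 0| * C * D +
    |M 0 0 - M 1 1| * (C * D + D), fun ξ hξ => ?_⟩
  have h0 : (ξ : ℂ) ≠ 0 := Complex.ofReal_ne_zero.2 hξ
  obtain ⟨h1, -, h2, h3⟩ := h ξ (by simp)
  obtain ⟨k1, -, k2, k3⟩ := k ξ (by simp)
  have ha : ‖jostA (potL q) ξ‖ ≤ C := h1 0
  have hb : ‖jostA (potR q) ξ‖ ≤ D := k1 0
  have hb' : ‖(starRingEnd ℂ) (jostA (potR q) ξ)‖ ≤ D := by rwa [RCLike.norm_conj]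
  have k2' : ‖(starRingEnd ℂ) (jostA (potR q) ξ) - 1‖ ≤ D / ‖(ξ : ℂ)‖ := by
    have := k2 h0
    rwa [← RCLike.norm_conj, map_sub, map_one] at this
  have k3' : ‖(starRingEnd ℂ) (jostV (potR q) ξ) +
      Complex.I * ξ * (starRingEnd ℂ) (jostA (potR q) ξ)‖ ≤ D := by
    rw [← RCLike.norm_conj] at k3
    simpa using k3
  have hab := norm_jost_mul_sub_one_le hb' (h2 h0) k2' (norm_pos_iff.2 h0)
  have e : jostWB q M ξ - Complex.I * ξ * (M 0 0 - M 1 1) =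
      M 1 0 * (starRingEnd ℂ) (jostA (potR q) ξ) * jostA (potL q) ξ +
      -(M 1 1 * (starRingEnd ℂ) (jostA (potR q) ξ) *
        (jostV (potL q) ξ - Complex.I * ξ * jostA (potL q) ξ)) +
      -(M 0 0 * jostA (potL q) ξ * ((starRingEnd ℂ) (jostV (potR q) ξ) +
        Complex.I * ξ * (starRingEnd ℂ) (jostA (potR q) ξ))) +
      ((M 0 0 - M 1 1 : ℝ) : ℂ) * (Complex.I *
        ((jostA (potL q) ξ * (starRingEnd ℂ) (jostA (potR q) ξ) - 1) * ξ)) := by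
    rw [jostWB]; push_cast; ring
  rw [e]
  refine (norm_add_le _ _).trans (add_le_add ((norm_add_le _ _).trans (add_le_add
    ((norm_add_le _ _).trans (add_le_add ?_ ?_)) ?_)) ?_)
  · rw [norm_mul, norm_mul, Complex.norm_real, Real.norm_eq_abs]
    gcongr
  · rw [norm_neg, norm_mul, norm_mul, Complex.norm_real, Real.norm_eq_abs]
    gcongr
  · rw [norm_neg, norm_mul, norm_mul, Complex.norm_real, Real.norm_eq_abs]
    gcongr
  · rw [norm_mul, norm_mul, Complex.norm_real, Real.norm_eq_abs, Complex.norm_I, one_mul, norm_mul]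
    gcongr

theorem norm_div_sub_half_le {w ζ s : ℂ} {C : ℝ} (h : ‖w - Complex.I * ζ * s‖ ≤ C) (hζ : ζ ≠ 0) :
    ‖w / (2 * Complex.I * ζ) - s / 2‖ ≤ C / 2 / ‖ζ‖ := by
  have e : w / (2 * Complex.I * ζ) - s / 2 = (w - Complex.I * ζ * s) / (2 * Complex.I * ζ) := by
    field_simp
  rw [e, norm_div, norm_mul, norm_mul, Complex.norm_I, Complex.norm_two, mul_one, div_div]
  gcongr

theorem exists_bound_extA (hq : AdmissiblePotential q) : ∃ C : ℝ, ∀ ζ : ℂ, 0 ≤ ζ.im → ζ ≠ 0 →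
    ‖extA q M ζ - (M 0 0 + M 1 1) / 2‖ ≤ C / ‖ζ‖ := by
  obtain ⟨C, hC⟩ := exists_bound_jostW (M := M) hq
  exact ⟨C / 2, fun ζ h1 h2 => norm_div_sub_half_le (hC ζ h1 h2) h2⟩

theorem add_diag_ne_zero (hdet : M.det = 1) (hM : M 0 1 = 0) : M 0 0 + M 1 1 ≠ 0 := by
  have h : M 0 0 * M 1 1 = 1 := by exact_mod_cast diag_mul_eq_one hdet hM
  intro h0
  rw [eq_neg_of_add_eq_zero_right h0] at h
  nlinarith [sq_nonneg (M 0 0)]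

/-- The limit is the ratio of the leading coefficients of the two Wronskians; m₂₁ multiplies bounded
terms only and disappears after division by ξ. -/
theorem tendsto_reflectionCoeff (hq : AdmissiblePotential q) (hdet : M.det = 1) (hM : M 0 1 = 0) :
    Tendsto (reflectionCoeff q M) (cocompact ℝ)
      (𝓝 (((M 0 0 - M 1 1) / (M 0 0 + M 1 1) : ℝ) : ℂ)) := by
  obtain ⟨C, hC⟩ := exists_bound_jostW (M := M) hq
  obtain ⟨D, hD⟩ := exists_bound_jostWB (M := M) hq
  have hne : ∀ᶠ ξ : ℝ in cocompact ℝ, ξ ≠ 0 := by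
    have := (isCompact_singleton (x := (0 : ℝ))).compl_mem_cocompact
    filter_upwards [this] with ξ hξ using hξ
  have h0 : ∀ K : ℝ, Tendsto (fun ξ : ℝ => K / ‖(ξ : ℂ)‖) (cocompact ℝ) (𝓝 0) := fun K => by
    simp only [Complex.norm_real]
    exact (tendsto_norm_cocompact_atTop).const_div_atTop K
  have hA : Tendsto (fun ξ : ℝ => jostW q M ξ / (2 * Complex.I * ξ)) (cocompact ℝ)
      (𝓝 ((M 0 0 + M 1 1) / 2)) := by
    rw [tendsto_iff_norm_sub_tendsto_zero]
    refine squeeze_zero' (Eventually.of_forall fun _ => norm_nonneg _) ?_ (h0 (C / 2))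
    filter_upwards [hne] with ξ hξ
    exact norm_div_sub_half_le (hC ξ (by simp) (by simpa using hξ)) (by simpa using hξ)
  have hB : Tendsto (fun ξ : ℝ => jostWB q M ξ / (2 * Complex.I * ξ)) (cocompact ℝ)
      (𝓝 ((M 0 0 - M 1 1) / 2)) := by
    rw [tendsto_iff_norm_sub_tendsto_zero]
    refine squeeze_zero' (Eventually.of_forall fun _ => norm_nonneg _) ?_ (h0 (D / 2))
    filter_upwards [hne] with ξ hξ
    exact norm_div_sub_half_le (hD ξ hξ) (by simpa using hξ)
  have hs : (M 0 0 + M 1 1 : ℂ) ≠ 0 := by exact_mod_cast add_diag_ne_zero hdet hM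
  have hlim := hB.div hA (div_ne_zero hs two_ne_zero)
  have e : ((M 0 0 : ℂ) - M 1 1) / 2 / ((M 0 0 + M 1 1) / 2) =
      (((M 0 0 - M 1 1) / (M 0 0 + M 1 1) : ℝ) : ℂ) := by
    push_cast; field_simp
  rw [e] at hlim
  refine hlim.congr' ?_
  filter_upwards [hne] with ξ hξ
  rw [reflectionCoeff, coeffA_eq hq hdet hM hξ, coeffB_eq hq hdet hM hξ]
  rfl

/-- At a zero of `jostW` the two Jost solutions are proportional. -/
theorem exists_ratio (hq : AdmissiblePotential q) (hdet : M.det = 1) (hM : M 0 1 = 0) {ζ : ℂ}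
    (hζ : 0 ≤ ζ.im) (hW : jostW q M ζ = 0) : ∃ c : ℂ, c ≠ 0 ∧
      M 0 0 * jostA (potL q) ζ = c * jostA (potR q) ζ ∧
      M 1 0 * jostA (potL q) ζ - M 1 1 * jostV (potL q) ζ = c * jostV (potR q) ζ := by
  have hM1 := diag_mul_eq_one hdet hM
  have h0 : (M 0 0 : ℂ) ≠ 0 := left_ne_zero_of_mul (hM1.trans_ne one_ne_zero)
  have h1 : (M 1 1 : ℂ) ≠ 0 := right_ne_zero_of_mul (hM1.trans_ne one_ne_zero)
  have hL := jostA_jostV_ne_zero hq.potL hζ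
  have hR := jostA_jostV_ne_zero hq.potR hζ
  have hex : ∃ c : ℂ, M 0 0 * jostA (potL q) ζ = c * jostA (potR q) ζ ∧
      M 1 0 * jostA (potL q) ζ - M 1 1 * jostV (potL q) ζ = c * jostV (potR q) ζ := by
    rw [jostW] at hW
    by_cases ha : jostA (potR q) ζ = 0
    · have hv : jostV (potR q) ζ ≠ 0 := fun hv => hR ⟨ha, hv⟩
      refine ⟨(M 1 0 * jostA (potL q) ζ - M 1 1 * jostV (potL q) ζ) / jostV (potR q) ζ, ?_, ?_⟩
      · rw [ha, mul_zero, sub_zero] at hW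
        rw [ha, mul_zero]
        exact (mul_eq_zero.1 hW).resolve_right hv
      · field_simp
    · refine ⟨M 0 0 * jostA (potL q) ζ / jostA (potR q) ζ, by field_simp, ?_⟩
      field_simp
      linear_combination -hW
  obtain ⟨c, e1, e2⟩ := hex
  refine ⟨c, ?_, e1, e2⟩
  rintro rfl
  rw [zero_mul] at e1 e2
  have ha := (mul_eq_zero.1 e1).resolve_left h0
  rw [ha, mul_zero, zero_sub, neg_eq_zero] at e2
  exact hL ⟨ha, (mul_eq_zero.1 e2).resolve_left h1⟩

/-- Zeros of `jostW` in the open upper half-plane lie on the imaginary axis. -/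
theorem re_eq_zero_of_jostW_eq_zero (hq : AdmissiblePotential q) (hdet : M.det = 1)
    (hM : M 0 1 = 0) {ζ : ℂ} (hζ : 0 < ζ.im) (hW : jostW q M ζ = 0) : ζ.re = 0 := by
  have hM1 := diag_mul_eq_one hdet hM
  obtain ⟨c, -, e1, e2⟩ := exists_ratio hq hdet hM hζ.le hW
  have hL := jost_bracket_conj hq.potL (potL_conj q) hζ
  have hR := jost_bracket_conj hq.potR (potR_conj q) hζ
  have iL := integral_norm_sq_jostF_pos hq.potL hζ
  have iR := integral_norm_sq_jostF_pos hq.potR hζ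
  set I := ∫ t in Ioi 0, ‖jostF (potL q) ζ t‖ ^ 2
  set J := ∫ t in Ioi 0, ‖jostF (potR q) ζ t‖ ^ 2
  have f1 := congrArg (starRingEnd ℂ) e1
  have f2 := congrArg (starRingEnd ℂ) e2
  simp only [map_mul, map_sub, Complex.conj_ofReal] at f1 f2
  set aL := jostA (potL q) ζ
  set vL := jostV (potL q) ζ
  set aR := jostA (potR q) ζ
  set vR := jostV (potR q) ζ
  -- Green's identity with the conjugate solution, added over both half-lines with weight |c|² on
  -- the right. The contributions at the origin cancel because M preserves Wronskians. Hence ζ² is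
  -- real, and Im ζ > 0 leaves only Re ζ = 0.
  have key : (ζ ^ 2 - (starRingEnd ℂ) (ζ ^ 2)) * ((Complex.normSq c * J + I : ℝ) : ℂ) = 0 := by
    push_cast
    rw [Complex.normSq_eq_conj_mul_self]
    have e : (starRingEnd ℂ) c * c * ((starRingEnd ℂ) aR * vR - (starRingEnd ℂ) vR * aR) +
        ((starRingEnd ℂ) aL * vL - (starRingEnd ℂ) vL * aL) = 0 := by
      have g : (M 0 0 * (starRingEnd ℂ) aL) * (M 1 0 * aL - M 1 1 * vL) -
          (M 1 0 * (starRingEnd ℂ) aL - M 1 1 * (starRingEnd ℂ) vL) * (M 0 0 * aL) =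
          (starRingEnd ℂ) c * c * ((starRingEnd ℂ) aR * vR - (starRingEnd ℂ) vR * aR) := by
        rw [f1, f2, e1, e2]; ring
      linear_combination -g - ((starRingEnd ℂ) aL * vL - (starRingEnd ℂ) vL * aL) * hM1
    linear_combination e - (starRingEnd ℂ) c * c * hR - hL
  have hpos : Complex.normSq c * J + I ≠ 0 :=
    (add_pos_of_nonneg_of_pos (mul_nonneg (Complex.normSq_nonneg c) iR.le) iL).ne'
  have h := (mul_eq_zero.1 key).resolve_right (Complex.ofReal_ne_zero.2 hpos)
  have him := congrArg Complex.im h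
  simp only [Complex.sub_im, Complex.conj_im, Complex.zero_im, sq, Complex.mul_im] at him
  have : ζ.re * ζ.im = 0 := by linarith
  exact (mul_eq_zero.1 this).resolve_right hζ.ne'

theorem neg_conj_I_mul (η : ℝ) : -(starRingEnd ℂ) (Complex.I * η) = Complex.I * η := by simp

/-- On the imaginary axis the ratio of the Jost solutions is real. -/
theorem exists_real_ratio (hq : AdmissiblePotential q) (hdet : M.det = 1) (hM : M 0 1 = 0) {η : ℝ}
    (hη : 0 ≤ η) (hW : jostW q M (Complex.I * η) = 0) : ∃ c : ℝ, c ≠ 0 ∧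
      M 0 0 * jostA (potL q) (Complex.I * η) = c * jostA (potR q) (Complex.I * η) ∧
      M 1 0 * jostA (potL q) (Complex.I * η) - M 1 1 * jostV (potL q) (Complex.I * η) =
        c * jostV (potR q) (Complex.I * η) := by
  have hi : 0 ≤ (Complex.I * η).im := by simpa using hη
  obtain ⟨c, hc, e1, e2⟩ := exists_ratio hq hdet hM hi hW
  have r1 := jostA_conj (potL_conj q) (Complex.I * η)
  have r2 := jostV_conj (potL_conj q) (Complex.I * η)
  have r3 := jostA_conj (potR_conj q) (Complex.I * η)
  have r4 := jostV_conj (potR_conj q) (Complex.I * η)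
  rw [neg_conj_I_mul] at r1 r2 r3 r4
  have f1 := congrArg (starRingEnd ℂ) e1
  have f2 := congrArg (starRingEnd ℂ) e2
  simp only [map_mul, map_sub, Complex.conj_ofReal, ← r1, ← r2, ← r3, ← r4] at f1 f2
  -- All data at iη are real, so conj c is a ratio too; two different ratios would force both data
  -- of the right Jost solution to vanish.
  have hcc : (starRingEnd ℂ) c = c := by
    by_contra hne
    refine jostA_jostV_ne_zero hq.potR hi ⟨?_, ?_⟩
    · exact (mul_eq_zero.1 (show ((starRingEnd ℂ) c - c) * jostA (potR q) (Complex.I * η) = 0 by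
        linear_combination e1 - f1)).resolve_left (sub_ne_zero.2 hne)
    · exact (mul_eq_zero.1 (show ((starRingEnd ℂ) c - c) * jostV (potR q) (Complex.I * η) = 0 by
        linear_combination e2 - f2)).resolve_left (sub_ne_zero.2 hne)
  obtain ⟨r, rfl⟩ := Complex.conj_eq_iff_real.1 hcc
  exact ⟨r, by simpa using hc, e1, e2⟩

/-- The Plücker relation between Jost solutions at two spectral parameters. -/
theorem jostW_plucker (hdet : M.det = 1) (hM : M 0 1 = 0) {ζ₀ c : ℂ}
    (e1 : M 0 0 * jostA (potL q) ζ₀ = c * jostA (potR q) ζ₀)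
    (e2 : M 1 0 * jostA (potL q) ζ₀ - M 1 1 * jostV (potL q) ζ₀ = c * jostV (potR q) ζ₀) (ζ : ℂ) :
    (jostW q M ζ * (c * jostA (potR q) ζ₀) =
      c * (jostA (potR q) ζ₀ * jostV (potR q) ζ - jostV (potR q) ζ₀ * jostA (potR q) ζ) *
        (M 0 0 * jostA (potL q) ζ) +
      (jostA (potL q) ζ₀ * jostV (potL q) ζ - jostV (potL q) ζ₀ * jostA (potL q) ζ) *
        jostA (potR q) ζ) ∧
    jostW q M ζ * (c * jostV (potR q) ζ₀) =
      c * (jostA (potR q) ζ₀ * jostV (potR q) ζ - jostV (potR q) ζ₀ * jostA (potR q) ζ) *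
        (M 1 0 * jostA (potL q) ζ - M 1 1 * jostV (potL q) ζ) +
      (jostA (potL q) ζ₀ * jostV (potL q) ζ - jostV (potL q) ζ₀ * jostA (potL q) ζ) *
        jostV (potR q) ζ := by
  have hM1 := diag_mul_eq_one hdet hM
  rw [jostW]
  set aL := jostA (potL q) ζ
  set vL := jostV (potL q) ζ
  set aR := jostA (potR q) ζ
  set vR := jostV (potR q) ζ
  set bL := jostA (potL q) ζ₀
  set wL := jostV (potL q) ζ₀
  set bR := jostA (potR q) ζ₀
  set wR := jostV (potR q) ζ₀
  -- M preserves Wronskians, and the sign comes from reflecting the left half-line: up to that sign,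
  -- the bracket of the data at ζ₀ and ζ is the same on either side of the origin.
  have g : c * (bR * (M 1 0 * aL - M 1 1 * vL) - wR * (M 0 0 * aL)) =
      -(bL * vL - wL * aL) := by
    linear_combination (-(M 1 0 * aL - M 1 1 * vL)) * e1 + (M 0 0 * aL) * e2 -
      (bL * vL - wL * aL) * hM1
  constructor
  · linear_combination -aR * g
  · linear_combination -vR * g

end JostWronskian

/-! ### Zeros of the Wronskian -/

section JostZeros

variable {q : ℝ → ℝ} {M : Matrix (Fin 2) (Fin 2) ℝ} {p : ℝ → ℂ}

/-- The factor z² - z₀² makes the difference quotient equal to (z + z₀)K(z)/k, so continuity of `K`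
at z₀ is enough. -/
theorem hasDerivAt_of_eq_mul {f K : ℂ → ℂ} {z₀ : ℂ} {k : ℂ} {s : Set ℂ} (hs : s ∈ 𝓝 z₀)
    (hf : ∀ z ∈ s, f z * k = (z ^ 2 - z₀ ^ 2) * K z) (hk : k ≠ 0) (hK : ContinuousAt K z₀) :
    HasDerivAt f (2 * z₀ * K z₀ / k) z₀ := by
  rw [hasDerivAt_iff_tendsto_slope]
  have h0 : f z₀ = 0 := by
    have := hf z₀ (mem_of_mem_nhds hs)
    rw [sub_self, zero_mul] at this
    exact (mul_eq_zero.1 this).resolve_right hk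
  have h1 : Tendsto (fun z => (z + z₀) * K z / k) (𝓝[≠] z₀) (𝓝 ((z₀ + z₀) * K z₀ / k)) :=
    ((((continuousAt_id.add continuousAt_const).mul hK).div_const k).tendsto).mono_left
      nhdsWithin_le_nhds
  rw [two_mul]
  refine h1.congr' ?_
  filter_upwards [self_mem_nhdsWithin, nhdsWithin_le_nhds hs] with z hz hzs
  have hz' : z - z₀ ≠ 0 := sub_ne_zero.2 hz
  rw [slope_def_field, h0, sub_zero]
  field_simp
  linear_combination -hf z hzs

theorem conj_jostF_imag (hp : ∀ t, (starRingEnd ℂ) (p t) = p t) (η x : ℝ) :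
    (starRingEnd ℂ) (jostF p (Complex.I * η) x) = jostF p (Complex.I * η) x := by
  rw [← jostF_conj hp, neg_conj_I_mul]

theorem integral_jostF_mul_self (hr : ∀ t, (starRingEnd ℂ) (p t) = p t) (η : ℝ) :
    ∫ t in Ioi 0, jostF p (Complex.I * η) t * jostF p (Complex.I * η) t =
      ((∫ t in Ioi 0, ‖jostF p (Complex.I * η) t‖ ^ 2 : ℝ) : ℂ) := by
  rw [← integral_complex_ofReal]
  refine integral_congr_ae (Eventually.of_forall fun t => ?_)
  simp only
  nth_rewrite 1 [← conj_jostF_imag hr η t]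
  rw [mul_comm, Complex.mul_conj, Complex.normSq_eq_norm_sq]

/-- Zeros of `jostW` in the open upper half-plane are simple. -/
theorem exists_hasDerivAt_jostW (hq : AdmissiblePotential q) (hdet : M.det = 1) (hM : M 0 1 = 0)
    {η : ℝ} (hη : 0 < η) (hW : jostW q M (Complex.I * η) = 0) :
    ∃ d : ℂ, d ≠ 0 ∧ HasDerivAt (jostW q M) d (Complex.I * η) := by
  obtain ⟨c, hc, e1, e2⟩ := exists_real_ratio hq hdet hM hη.le hW
  have hc' : (c : ℂ) ≠ 0 := Complex.ofReal_ne_zero.2 hc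
  have hi : 0 < (Complex.I * η).im := by simpa using hη
  set z₀ : ℂ := Complex.I * η with hz₀
  have hz0 : z₀ ≠ 0 := by rintro h; rw [h] at hi; simp at hi
  have hop : {z : ℂ | 0 < z.im} ∈ 𝓝 z₀ := (isOpen_lt continuous_const Complex.continuous_im).mem_nhds hi
  have hcl : {z : ℂ | 0 ≤ z.im} ∈ 𝓝 z₀ := mem_of_superset hop fun z (hz : 0 < z.im) => hz.le
  have iL := integral_norm_sq_jostF_pos hq.potL hi
  have iR := integral_norm_sq_jostF_pos hq.potR hi
  have sL := integral_jostF_mul_self (potL_conj q) η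
  have sR := integral_jostF_mul_self (potR_conj q) η
  rw [← hz₀] at sL sR
  have cL := (jost_integral_continuousOn hq.potL hi).continuousAt hcl
  have cR := (jost_integral_continuousOn hq.potR hi).continuousAt hcl
  have caL := (continuousOn_jostA hq.potL).continuousAt hcl
  have caR := (continuousOn_jostA hq.potR).continuousAt hcl
  have cvL := (continuousOn_jostV hq.potL).continuousAt hcl
  have cvR := (continuousOn_jostV hq.potR).continuousAt hcl
  set I := ∫ t in Ioi 0, ‖jostF (potL q) z₀ t‖ ^ 2
  set J := ∫ t in Ioi 0, ‖jostF (potR q) z₀ t‖ ^ 2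
  have hpos : ((c : ℂ) * c * J + I) ≠ 0 := by
    have : 0 < c * c * J + I := add_pos_of_nonneg_of_pos (mul_nonneg (mul_self_nonneg c) iR.le) iL
    exact_mod_cast this.ne'
  have hpl := jostW_plucker hdet hM e1 e2
  -- The relation is divided by whichever datum of the right Jost solution is nonzero. Either way
  -- the derivative comes out as 2z₀(c²J + I)/c, nonzero since c is real and I, J are positive.
  by_cases ha : jostA (potR q) z₀ = 0
  · have hv : jostV (potR q) z₀ ≠ 0 := fun hv => jostA_jostV_ne_zero hq.potR hi.le ⟨ha, hv⟩
    refine ⟨_, ?_, hasDerivAt_of_eq_mul (s := {z : ℂ | 0 < z.im}) (k := c * jostV (potR q) z₀)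
      (K := fun z => c * (∫ t in Ioi 0, jostF (potR q) z₀ t * jostF (potR q) z t) *
        (M 1 0 * jostA (potL q) z - M 1 1 * jostV (potL q) z) +
        (∫ t in Ioi 0, jostF (potL q) z₀ t * jostF (potL q) z t) * jostV (potR q) z)
      hop ?_ (mul_ne_zero hc' hv) (by fun_prop)⟩
    · have : (c : ℂ) * J * (c * jostV (potR q) z₀) + I * jostV (potR q) z₀ =
          (c * c * J + I) * jostV (potR q) z₀ := by ring
      simp only [sL, sR, e2, this]
      exact div_ne_zero (mul_ne_zero (mul_ne_zero two_ne_zero hz0) (mul_ne_zero hpos hv))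
        (mul_ne_zero hc' hv)
    · intro z hz
      rw [(hpl z).2, jost_bracket_eq_integral hq.potR hi hz, jost_bracket_eq_integral hq.potL hi hz]
      ring
  · refine ⟨_, ?_, hasDerivAt_of_eq_mul (s := {z : ℂ | 0 < z.im}) (k := c * jostA (potR q) z₀)
      (K := fun z => c * (∫ t in Ioi 0, jostF (potR q) z₀ t * jostF (potR q) z t) *
        (M 0 0 * jostA (potL q) z) +
        (∫ t in Ioi 0, jostF (potL q) z₀ t * jostF (potL q) z t) * jostA (potR q) z)
      hop ?_ (mul_ne_zero hc' ha) (by fun_prop)⟩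
    · have : (c : ℂ) * J * (c * jostA (potR q) z₀) + I * jostA (potR q) z₀ =
          (c * c * J + I) * jostA (potR q) z₀ := by ring
      simp only [sL, sR, e1, this]
      exact div_ne_zero (mul_ne_zero (mul_ne_zero two_ne_zero hz0) (mul_ne_zero hpos ha))
        (mul_ne_zero hc' ha)
    · intro z hz
      rw [(hpl z).1, jost_bracket_eq_integral hq.potR hi hz, jost_bracket_eq_integral hq.potL hi hz]
      ring

theorem exists_pos_eventually_le_norm {l : Filter ℂ} {f : ℂ → ℂ} {k m : ℂ}
    (h : Tendsto (fun z => f z * k) l (𝓝 m)) (hm : m ≠ 0) : ∃ r > 0, ∀ᶠ z in l, r ≤ ‖f z‖ := by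
  have hk : k ≠ 0 ∨ k = 0 := ne_or_eq k 0
  have hm' : 0 < ‖m‖ := norm_pos_iff.2 hm
  have h1 : ∀ᶠ z in l, ‖m‖ / 2 < ‖f z * k‖ := h.norm.eventually_const_lt (by linarith)
  refine ⟨‖m‖ / 2 / (‖k‖ + 1), by positivity, h1.mono fun z hz => ?_⟩
  rw [div_le_iff₀ (by positivity)]
  rw [norm_mul] at hz
  nlinarith [norm_nonneg (f z)]

/-- `extA` is bounded away from zero near the origin. -/
theorem exists_le_norm_extA_near_zero (hq : AdmissiblePotential q) (hdet : M.det = 1)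
    (hM : M 0 1 = 0) :
    ∃ r > 0, ∀ᶠ ζ in 𝓝[{ζ : ℂ | 0 ≤ ζ.im} \ {0}] 0, r ≤ ‖extA q M ζ‖ := by
  have h0 : (0 : ℂ) ∈ {ζ : ℂ | 0 ≤ ζ.im} := by simp
  have hle : 𝓝[{ζ : ℂ | 0 ≤ ζ.im} \ {0}] (0 : ℂ) ≤ 𝓝[{ζ : ℂ | 0 ≤ ζ.im}] 0 :=
    nhdsWithin_mono _ sdiff_subset
  have caL := ((continuousOn_jostA hq.potL) 0 h0).mono_left hle
  have caR := ((continuousOn_jostA hq.potR) 0 h0).mono_left hle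
  have cvL := ((continuousOn_jostV hq.potL) 0 h0).mono_left hle
  have cvR := ((continuousOn_jostV hq.potR) 0 h0).mono_left hle
  -- If W(0) ≠ 0, then A blows up like 1/ζ. If W(0) = 0, the relation at ζ₀ = 0 divided by iζ tends
  -- to c² + 1 times a nonzero datum, with c real.
  by_cases hW : jostW q M 0 = 0
  · obtain ⟨c, hc, e1, e2⟩ := exists_real_ratio hq hdet hM le_rfl
      (by simpa using hW)
    simp only [Complex.ofReal_zero, mul_zero] at e1 e2
    have hc' : (c : ℂ) ≠ 0 := Complex.ofReal_ne_zero.2 hc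
    have hpos : ((c : ℂ) * c + 1) ≠ 0 := by
      have : 0 < c * c + 1 := by nlinarith [mul_self_nonneg c]
      exact_mod_cast this.ne'
    have hpl := jostW_plucker hdet hM e1 e2
    have dL := tendsto_jost_bracket_zero hq.potL
    have dR := tendsto_jost_bracket_zero hq.potR
    have hcc : Tendsto (fun _ : ℂ => (c : ℂ)) (𝓝[{ζ : ℂ | 0 ≤ ζ.im} \ {0}] 0) (𝓝 c) :=
      tendsto_const_nhds
    have hz : ∀ᶠ ζ : ℂ in 𝓝[{ζ : ℂ | 0 ≤ ζ.im} \ {0}] 0, ζ ≠ 0 := by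
      filter_upwards [self_mem_nhdsWithin] with ζ hζ using hζ.2
    by_cases ha : jostA (potR q) 0 = 0
    · have hv : jostV (potR q) 0 ≠ 0 := fun hv => jostA_jostV_ne_zero hq.potR h0 ⟨ha, hv⟩
      have hlim := ((hcc.mul dR).mul ((caL.const_mul (M 1 0 : ℂ)).sub (cvL.const_mul (M 1 1 : ℂ)))).add
        (dL.mul cvR)
      refine exists_pos_eventually_le_norm (k := 2 * (c * jostV (potR q) 0))
        (hlim.congr' ?_) ?_
      · filter_upwards [hz] with ζ hζ
        rw [extA]
        have := (hpl ζ).2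
        field_simp
        linear_combination -this
      · rw [e2]
        have : (c : ℂ) * 1 * (c * jostV (potR q) 0) + 1 * jostV (potR q) 0 =
          (c * c + 1) * jostV (potR q) 0 := by ring
        rw [this]
        exact mul_ne_zero hpos hv
    · have hlim := ((hcc.mul dR).mul (caL.const_mul (M 0 0 : ℂ))).add (dL.mul caR)
      refine exists_pos_eventually_le_norm (k := 2 * (c * jostA (potR q) 0))
        (hlim.congr' ?_) ?_
      · filter_upwards [hz] with ζ hζ
        rw [extA]
        have := (hpl ζ).1
        field_simp
        linear_combination -this
      · rw [e1]
        have : (c : ℂ) * 1 * (c * jostA (potR q) 0) + 1 * jostA (potR q) 0 =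
          (c * c + 1) * jostA (potR q) 0 := by ring
        rw [this]
        exact mul_ne_zero hpos ha
  · have hlim := ((continuousOn_jostW (M := M) hq) 0 h0).mono_left hle
    obtain ⟨r, hr, h⟩ := exists_pos_eventually_le_norm (k := 1) (by simpa using hlim) hW
    refine ⟨r / 2, by positivity, ?_⟩
    have h1 : ∀ᶠ ζ : ℂ in 𝓝[{ζ : ℂ | 0 ≤ ζ.im} \ {0}] 0, ‖ζ‖ < 1 :=
      nhdsWithin_le_nhds
        ((continuous_norm.tendsto (0 : ℂ)).eventually_lt_const (by simp))
    filter_upwards [h, h1, self_mem_nhdsWithin] with ζ hζ hζ1 hζ0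
    have h2 : 0 < ‖ζ‖ := norm_pos_iff.2 hζ0.2
    rw [extA, norm_div, norm_mul, norm_mul, Complex.norm_two, Complex.norm_I, mul_one,
      le_div_iff₀ (by positivity)]
    nlinarith

/-- The zeros of `jostW` in the open upper half-plane, as a set of positive numbers. -/
def jostZeros (q : ℝ → ℝ) (M : Matrix (Fin 2) (Fin 2) ℝ) : Set ℝ :=
  {η : ℝ | 0 < η ∧ jostW q M (Complex.I * η) = 0}

theorem extA_eq_zero_iff {ζ : ℂ} (hζ : ζ ≠ 0) : extA q M ζ = 0 ↔ jostW q M ζ = 0 := by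
  simp [extA, hζ]

theorem exists_mem_jostZeros (hq : AdmissiblePotential q) (hdet : M.det = 1) (hM : M 0 1 = 0)
    {ζ : ℂ} (hζ : 0 < ζ.im) (hW : jostW q M ζ = 0) :
    ∃ η ∈ jostZeros q M, ζ = Complex.I * η := by
  have hre := re_eq_zero_of_jostW_eq_zero hq hdet hM hζ hW
  have e : ζ = Complex.I * ζ.im := by
    apply Complex.ext <;> simp [hre]
  exact ⟨ζ.im, ⟨hζ, by rwa [← e]⟩, e⟩

/-- A vanishing A(iη) is incompatible with the lower bound near 0 and, since A has a nonzero limit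
at infinity with error O(1/|ζ|), with large η. The zeros thus lie in a compact interval, where an
accumulation point would be a zero that is not simple. -/
theorem finite_jostZeros (hq : AdmissiblePotential q) (hdet : M.det = 1) (hM : M 0 1 = 0) :
    (jostZeros q M).Finite := by
  obtain ⟨C, hC⟩ := exists_bound_extA (M := M) hq
  obtain ⟨r, hr, hr0⟩ := exists_le_norm_extA_near_zero hq hdet hM
  have hs : ((M 0 0 + M 1 1 : ℂ) / 2) ≠ 0 :=
    div_ne_zero (by exact_mod_cast add_diag_ne_zero hdet hM) two_ne_zero
  rw [eventually_nhdsWithin_iff, Metric.eventually_nhds_iff] at hr0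
  obtain ⟨δ, hδ, hδ0⟩ := hr0
  set R := C / ‖(M 0 0 + M 1 1 : ℂ) / 2‖
  have hsub : jostZeros q M ⊆ Icc δ R := by
    rintro η ⟨hη, hW⟩
    have hne : (Complex.I * η : ℂ) ≠ 0 := by simp [hη.ne']
    have hi : 0 ≤ (Complex.I * η : ℂ).im := by simpa using hη.le
    have hn : ‖(Complex.I * η : ℂ)‖ = η := by simp [abs_of_pos hη]
    have hA := (extA_eq_zero_iff hne).2 hW
    constructor
    · by_contra! hlt
      have := hδ0 (y := Complex.I * η) (by rwa [dist_zero_right, hn]) ⟨hi, hne⟩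
      rw [hA, norm_zero] at this
      linarith
    · have := hC _ hi hne
      rw [hA, zero_sub, norm_neg, hn, le_div_iff₀ hη] at this
      rw [le_div_iff₀ (norm_pos_iff.2 hs), mul_comm]
      exact this
  by_contra hinf
  obtain ⟨x, hx, hacc⟩ := Set.Infinite.exists_accPt_of_subset_isCompact hinf isCompact_Icc hsub
  have hx0 : 0 < x := hδ.trans_le hx.1
  have hxi : 0 < (Complex.I * x : ℂ).im := by simpa using hx0
  have hop : {z : ℂ | 0 < z.im} ∈ 𝓝 (Complex.I * x) :=
    (isOpen_lt continuous_const Complex.continuous_im).mem_nhds hxi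
  have hfreq := accPt_iff_frequently.1 hacc
  have hcont : ContinuousAt (jostW q M) (Complex.I * x) :=
    (continuousOn_jostW hq).continuousAt (mem_of_superset hop fun z (hz : 0 < z.im) => hz.le)
  have hIx : Tendsto (fun y : ℝ => (Complex.I * y : ℂ)) (𝓝 x) (𝓝 (Complex.I * x)) := by
    have : Continuous fun y : ℝ => (Complex.I * y : ℂ) := by fun_prop
    exact this.tendsto x
  have hW0 : jostW q M (Complex.I * x) = 0 := by
    by_contra hne
    exact hfreq (((hcont.tendsto.comp hIx).eventually_ne hne).mono fun y hy h => hy h.2.2)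
  obtain ⟨d, hd, hder⟩ := exists_hasDerivAt_jostW hq hdet hM hx0 hW0
  have hev := hder.eventually_ne (c := 0) hd
  rw [eventually_nhdsWithin_iff] at hev
  refine hfreq ((hIx.eventually hev).mono fun y hy h => ?_)
  exact hy (by simpa using h.1) h.2.2

end JostZeros

/-! ### Eigenvalues -/

section Eigenvalues

variable {q : ℝ → ℝ} {M : Matrix (Fin 2) (Fin 2) ℝ}

/-- A square integrable half-line solution is a multiple of the Jost solution, and vanishes when
the spectral parameter is real. -/
theorem IsHalfSol.exists_eq_mul_jostF {p : ℝ → ℂ} (hp : HasMoment p) {ζ : ℂ} (hζ : 0 ≤ ζ.im)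
    {y y' : ℝ → ℂ} {c d : ℂ} (hy : IsHalfSol (fun x => p x - ζ ^ 2) y y') (hi : HasInit y y' c d)
    (hL : IntegrableOn (fun t => ‖y t‖ ^ 2) (Ioi 0)) :
    ∃ k : ℂ, c = k * jostA p ζ ∧ d = k * jostV p ζ ∧ (∀ x, 0 < x → y x = k * jostF p ζ x) ∧
      (ζ.im = 0 → k = 0) := by
  have hF := isHalfSol_jostF hp hζ
  have hFi := hasInit_jostF hp hζ
  have hbr := hy.wronskian_eq_init hF hi hFi one_pos
  rw [jost_bracket_eq_zero_of_sq_integrable hp hζ hy hL one_pos] at hbr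
  have hex : ∃ k : ℂ, c = k * jostA p ζ ∧ d = k * jostV p ζ := by
    by_cases ha : jostA p ζ = 0
    · have hv : jostV p ζ ≠ 0 := fun hv => jostA_jostV_ne_zero hp hζ ⟨ha, hv⟩
      refine ⟨d / jostV p ζ, ?_, by field_simp⟩
      rw [ha, mul_zero, sub_zero] at hbr
      rw [ha, mul_zero]
      exact (mul_eq_zero.1 hbr.symm).resolve_right hv
    · refine ⟨c / jostA p ζ, by field_simp, ?_⟩
      field_simp
      linear_combination hbr
  obtain ⟨k, rfl, rfl⟩ := hex
  have heq : ∀ x, 0 < x → y x = k * jostF p ζ x := fun x hx =>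
    hy.eq_of_hasInit hp (hF.const_mul k) hi (hFi.const_mul k) hx
  refine ⟨k, rfl, rfl, heq, fun him => ?_⟩
  by_contra hk
  have hre : ((ζ.re : ℝ) : ℂ) = ζ := Complex.ext (by simp) (by simp [him])
  refine not_sq_integrable_jostF_real hp ζ.re ?_
  rw [hre]
  have h2 := hL.const_mul ((‖k‖ ^ 2)⁻¹)
  refine IntegrableOn.congr_fun h2 (fun t ht => ?_) measurableSet_Ioi
  rw [heq t ht, norm_mul, mul_pow, inv_mul_cancel_left₀ (pow_ne_zero 2 (norm_ne_zero_iff.2 hk))]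

theorem memLp_glue {u w : ℝ → ℂ} (hu : MemLp u 2 (volume.restrict (Ioi 0)))
    (hw : MemLp w 2 (volume.restrict (Ioi 0))) : MemLp (glue u w) 2 volume := by
  have h : glue u w = (Ioi (0 : ℝ)).piecewise u (fun x => w (-x)) := by
    funext x
    rw [glue, Set.piecewise]
    rfl
  classical
  have hw2 : MemLp (fun x => w (-x)) 2 (volume.restrict (Ioi (0 : ℝ))ᶜ) := by
    rw [compl_Ioi]
    rw [Measure.restrict_congr_set Ioi_ae_eq_Ici] at hw
    have hmp := (Measure.measurePreserving_neg (volume : Measure ℝ)).restrict_preimage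
      (measurableSet_Ici (a := (0 : ℝ)))
    have hpre : (Neg.neg ⁻¹' Ici (0 : ℝ)) = Iic 0 := by ext x; simp
    rw [hpre] at hmp
    exact hw.comp_measurePreserving hmp
  rw [h]
  convert MemLp.piecewise measurableSet_Ioi hu hw2

theorem memLp_jostF {p : ℝ → ℂ} (hp : HasMoment p) {ζ : ℂ} (hζ : 0 < ζ.im) :
    MemLp (jostF p ζ) 2 (volume.restrict (Ioi 0)) :=
  (memLp_two_iff_integrable_sq_norm (continuous_jostF hp hζ.le).aestronglyMeasurable).2
    (integrableOn_norm_sq_jostF hp hζ)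

theorem MeasureTheory.MemLp.integrableOn_comp_neg {y : ℝ → ℂ} (hy : MemLp y 2 volume) :
    IntegrableOn (fun t => ‖y (-t)‖ ^ 2) (Ioi 0) :=
  ((hy.comp_measurePreserving (Measure.measurePreserving_neg (volume : Measure ℝ))).integrable_norm_pow
    two_ne_zero).integrableOn

theorem exists_sq_eq_im_nonneg (μ : ℂ) : ∃ ζ : ℂ, ζ ^ 2 = μ ∧ 0 ≤ ζ.im := by
  obtain ⟨z, hz⟩ := IsAlgClosed.exists_pow_nat_eq μ two_pos
  rcases le_total 0 z.im with h | h
  · exact ⟨z, hz, h⟩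
  · exact ⟨-z, by rw [neg_sq, hz], by simpa using h⟩

/-- Take the square root ζ of μ with Im ζ ≥ 0. An eigenfunction restricts to multiples of the two
Jost solutions, both zero when ζ is real. Matching the multiples at the origin is a homogeneous
linear system with determinant W up to sign, so a nonzero pair exists exactly when W(ζ) = 0.
Conversely, Jost solutions in proportion at a zero glue to an eigenfunction. -/
theorem eigenvalueSet_eq (hq : AdmissiblePotential q) (hdet : M.det = 1) (hM : M 0 1 = 0) :
    eigenvalueSet q M = (fun η : ℝ => -((η : ℂ)) ^ 2) '' jostZeros q M := by
  apply Subset.antisymm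
  · rintro μ ⟨y, ⟨hy2, -, hac, htr⟩, he, hne⟩
    obtain ⟨ζ, rfl, hζ⟩ := exists_sq_eq_im_nonneg μ
    obtain ⟨c, d, c', d', hi, hi', h1, h2⟩ := htr.exists_hasInit hM
    obtain ⟨k, rfl, rfl, hk, hk0⟩ := (hac.isHalfSol_right he).exists_eq_mul_jostF hq.potR hζ hi
      (hy2.integrable_norm_pow two_ne_zero).integrableOn
    obtain ⟨l, rfl, rfl, hl, hl0⟩ := (hac.isHalfSol_left hq he).exists_eq_mul_jostF hq.potL hζ hi'
      hy2.integrableOn_comp_neg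
    have hkl : ¬ (k = 0 ∧ l = 0) := by
      rintro ⟨rfl, rfl⟩
      refine hne ?_
      filter_upwards [Measure.ae_ne volume (0 : ℝ)] with x hx
      rcases lt_or_gt_of_ne hx with h | h
      · simpa using hl (-x) (by linarith)
      · simpa using hk x h
    have him : 0 < ζ.im := lt_of_le_of_ne hζ fun h => hkl ⟨hk0 h.symm, hl0 h.symm⟩
    have hlW : l * jostW q M ζ = 0 := by
      rw [jostW]
      linear_combination -jostV (potR q) ζ * h1 + jostA (potR q) ζ * h2
    have hW : jostW q M ζ = 0 := by
      refine (mul_eq_zero.1 hlW).resolve_left fun hl0 => hkl ⟨?_, hl0⟩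
      by_contra hk0
      subst hl0
      refine jostA_jostV_ne_zero hq.potR hζ ⟨?_, ?_⟩
      · exact (mul_eq_zero.1 (h1.trans (by ring))).resolve_left hk0
      · exact (mul_eq_zero.1 (h2.trans (by ring))).resolve_left hk0
    obtain ⟨η, hη, rfl⟩ := exists_mem_jostZeros hq hdet hM him hW
    refine ⟨η, hη, ?_⟩
    simp only [mul_pow, Complex.I_sq]
    ring
  · rintro _ ⟨η, ⟨hη, hW⟩, rfl⟩
    have hi : 0 < (Complex.I * η : ℂ).im := by simpa using hη
    have hsq : -((η : ℂ)) ^ 2 = (Complex.I * η) ^ 2 := by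
      rw [mul_pow, Complex.I_sq]; ring
    simp only [hsq]
    obtain ⟨c, hc, e1, e2⟩ := exists_ratio hq hdet hM hi.le hW
    have hu := (isHalfSol_jostF hq.potR hi.le).const_mul c
    have hw := isHalfSol_jostF hq.potL hi.le
    have hsol := isTransferSolution_glue hq hu hw
      ((hasInit_jostF hq.potR hi.le).const_mul c) (hasInit_jostF hq.potL hi.le) hM e1.symm e2.symm
    have hLp : MemLp (glue (fun x => c * jostF (potR q) (Complex.I * η) x)
        (jostF (potL q) (Complex.I * η))) 2 volume :=
      memLp_glue ((memLp_jostF hq.potR hi).const_mul c) (memLp_jostF hq.potL hi)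
    refine ⟨_, ⟨hLp, (hLp.const_mul _).ae_eq (hsol.2.2.mono fun x hx => hx.symm), hsol.1, hsol.2.1⟩,
      hsol.2.2, fun h0 => ?_⟩
    have hpos := integral_norm_sq_jostF_pos hq.potR hi
    refine hpos.ne' ?_
    rw [setIntegral_congr_ae (g := fun _ => (0 : ℝ)) measurableSet_Ioi ?_, integral_zero]
    filter_upwards [h0] with x hx hx0
    rw [glue_pos _ _ hx0] at hx
    simp [(mul_eq_zero.1 hx).resolve_left hc]

end Eigenvalues

/-! ### The Poisson formula in the upper half-plane -/

section Poisson

/-- The Cayley transform from the unit disc to the upper half-plane sending `0` to `ζ`. -/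
noncomputable def cayley (ζ w : ℂ) : ℂ := (ζ + (starRingEnd ℂ) ζ * w) / (1 + w)

theorem cayley_im (ζ w : ℂ) :
    (cayley ζ w).im = ζ.im * (1 - Complex.normSq w) / Complex.normSq (1 + w) := by
  rw [cayley, Complex.div_im, ← sub_div]
  congr 1
  simp only [Complex.add_re, Complex.add_im, Complex.mul_re, Complex.mul_im, Complex.conj_re,
    Complex.conj_im, Complex.one_re, Complex.one_im, Complex.normSq_apply]
  ring

theorem one_add_ne_zero_of_norm_lt_one {w : ℂ} (hw : ‖w‖ < 1) : 1 + w ≠ 0 := by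
  intro h
  rw [eq_neg_of_add_eq_zero_right h, norm_neg, norm_one] at hw
  exact lt_irrefl _ hw

theorem cayley_im_pos {ζ w : ℂ} (hζ : 0 < ζ.im) (hw : ‖w‖ < 1) : 0 < (cayley ζ w).im := by
  rw [cayley_im]
  have h1 : 0 < Complex.normSq (1 + w) := Complex.normSq_pos.2 (one_add_ne_zero_of_norm_lt_one hw)
  have h2 : Complex.normSq w < 1 := by
    rw [Complex.normSq_eq_norm_sq]; nlinarith [norm_nonneg w]
  have : 0 < 1 - Complex.normSq w := by linarith
  positivity

/-- On the circle, with a half the angle, the map gives Re(ζe^{-ia})/cos a = Re ζ + Im ζ tan a. This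
is the substitution taking the uniform measure on the circle to the Poisson kernel at ζ. -/
theorem cayley_circleMap_arctan {ζ : ℂ} (hζ : 0 < ζ.im) (ξ : ℝ) :
    cayley ζ (circleMap 0 1 (2 * Real.arctan ((ξ - ζ.re) / ζ.im))) = ξ := by
  set s := (ξ - ζ.re) / ζ.im with hs
  set a := Real.arctan s
  have hca : Real.cos a ≠ 0 := (Real.cos_arctan_pos s).ne'
  have hsin : Real.sin a = s * Real.cos a := by
    rw [← Real.tan_mul_cos hca, Real.tan_arctan]
  have hcs : (Real.cos a : ℂ) ^ 2 * (1 + (s : ℂ) ^ 2) = 1 := by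
    have := Real.sin_sq_add_cos_sq a
    rw [hsin] at this
    have h2 : Real.cos a ^ 2 * (1 + s ^ 2) = 1 := by linarith
    exact_mod_cast h2
  have hw : circleMap 0 1 (2 * a) = (Real.cos a : ℂ) ^ 2 * (1 + Complex.I * s) ^ 2 := by
    have e : Complex.exp (a * Complex.I) = Real.cos a * (1 + Complex.I * s) := by
      rw [Complex.exp_mul_I, ← Complex.ofReal_cos, ← Complex.ofReal_sin, hsin]
      push_cast; ring
    rw [circleMap, zero_add, Complex.ofReal_one, one_mul, ← mul_pow, ← e, ← Complex.exp_nat_mul]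
    push_cast; ring_nf
  have hξ : (ξ : ℂ) = ζ.re + ζ.im * s := by
    have : ξ = ζ.re + ζ.im * s := by rw [hs]; field_simp; ring
    exact_mod_cast this
  have hz : ζ = ζ.re + ζ.im * Complex.I := (Complex.re_add_im ζ).symm
  have hzc : (starRingEnd ℂ) ζ = ζ.re - ζ.im * Complex.I := by
    apply Complex.ext <;> simp
  have h1 : (1 : ℂ) + Complex.I * s ≠ 0 := by
    intro h
    have := congrArg Complex.re h
    simp at this
  have hne : 1 + circleMap 0 1 (2 * a) ≠ 0 := by
    have : 1 + circleMap 0 1 (2 * a) = (Real.cos a : ℂ) ^ 2 * (1 + Complex.I * s) * 2 := by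
      rw [hw]
      linear_combination -hcs + (Real.cos a : ℂ) ^ 2 * (s : ℂ) ^ 2 * Complex.I_sq
    rw [this]
    exact mul_ne_zero (mul_ne_zero (pow_ne_zero 2 (Complex.ofReal_ne_zero.2 hca)) h1) two_ne_zero
  rw [cayley, div_eq_iff hne, hw, hξ, hzc]
  nth_rewrite 1 [hz]
  linear_combination (-(ζ.im * Complex.I) + ζ.im * s) * hcs -
    ζ.im * (Real.cos a : ℂ) ^ 2 * (2 * s + Complex.I * s ^ 2 + s ^ 3) * Complex.I_sq

/-- The Poisson formula for `log ‖g‖`, with `g` zero-free and `log ‖g‖` bounded on the closed upper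
half-plane. -/
theorem log_norm_eq_poisson_of_bounded {g : ℂ → ℂ} (hd : DifferentiableOn ℂ g {z | 0 < z.im})
    (hc : ContinuousOn g {z | 0 ≤ z.im}) (h0 : ∀ z : ℂ, 0 ≤ z.im → g z ≠ 0) {K : ℝ}
    (hK : ∀ z : ℂ, 0 ≤ z.im → |Real.log ‖g z‖| ≤ K) {ζ : ℂ} (hζ : 0 < ζ.im) :
    Real.log ‖g ζ‖ = ∫ ξ : ℝ, ζ.im / (Real.pi * ‖(ξ : ℂ) - ζ‖ ^ 2) * Real.log ‖g ξ‖ := by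
  have hop : IsOpen {z : ℂ | 0 < z.im} := isOpen_lt continuous_const Complex.continuous_im
  have hcay : ∀ w : ℂ, 1 + w ≠ 0 → ContinuousAt (cayley ζ) w := fun w hw => by
    unfold cayley
    exact ContinuousAt.div (by fun_prop) (by fun_prop) hw
  have hlogc : ContinuousOn (fun z => Real.log ‖g z‖) {z | 0 ≤ z.im} :=
    hc.norm.log fun z hz => norm_ne_zero_iff.2 (h0 z hz)
  -- The mean value property on circles of radius r < 1 for the harmonic pullback, whose value at
  -- the centre is log ‖g ζ‖.
  have hmean : ∀ r : ℝ, 0 < r → r < 1 →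
      (2 * Real.pi)⁻¹ * ∫ θ in Ioo (-Real.pi) Real.pi, Real.log ‖g (cayley ζ (circleMap 0 r θ))‖ =
        Real.log ‖g ζ‖ := by
    intro r hr0 hr1
    have hharm : InnerProductSpace.HarmonicOnNhd (fun w => Real.log ‖g (cayley ζ w)‖)
        (Metric.closedBall 0 |r|) := by
      intro w hw
      rw [abs_of_pos hr0, mem_closedBall_zero_iff] at hw
      have hw1 : ‖w‖ < 1 := hw.trans_lt hr1
      have him := cayley_im_pos hζ hw1
      refine AnalyticAt.harmonicAt_log_norm (f := fun w => g (cayley ζ w)) ?_ (h0 _ him.le)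
      refine AnalyticAt.fun_comp (hd.analyticAt (hop.mem_nhds him)) ?_
      unfold cayley
      exact AnalyticAt.div (by fun_prop) (by fun_prop) (one_add_ne_zero_of_norm_lt_one hw1)
    have h1 := InnerProductSpace.HarmonicOnNhd.circleAverage_eq hharm
    have h2 : cayley ζ 0 = ζ := by simp [cayley]
    rw [h2, Real.circleAverage_eq_integral_add (-Real.pi),
      intervalIntegral.integral_comp_add_right
        (fun θ => Real.log ‖g (cayley ζ (circleMap 0 r θ))‖) (-Real.pi),
      intervalIntegral.integral_of_le (by linarith [Real.pi_pos]), smul_eq_mul,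
      integral_Ioc_eq_integral_Ioo] at h1
    rw [← h1]
    congr 3
    ring_nf
  have hne : ∀ θ ∈ Ioo (-Real.pi) Real.pi, 1 + circleMap 0 1 θ ≠ 0 := by
    intro θ hθ h
    have hre := congrArg Complex.re h
    have hcos : 0 < Real.cos (θ / 2) := Real.cos_pos_of_mem_Ioo
      ⟨by linarith [hθ.1], by linarith [hθ.2]⟩
    have h2 := Real.cos_sq (θ / 2)
    rw [mul_div_cancel₀ _ (two_ne_zero' ℝ)] at h2
    simp only [circleMap, Complex.add_re, Complex.one_re, zero_add, Complex.ofReal_one, one_mul,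
      Complex.exp_ofReal_mul_I_re, Complex.zero_re] at hre
    nlinarith
  have him1 : ∀ θ ∈ Ioo (-Real.pi) Real.pi, 0 ≤ (cayley ζ (circleMap 0 1 θ)).im := by
    intro θ hθ
    rw [cayley_im, Complex.normSq_eq_norm_sq, norm_circleMap_zero]
    simp
  -- Let r → 1 under the bound `K`. The open interval omits only w = -1, the point sent to infinity.
  have hlim : Tendsto (fun r : ℝ => ∫ θ in Ioo (-Real.pi) Real.pi,
      Real.log ‖g (cayley ζ (circleMap 0 r θ))‖) (𝓝[<] 1)
      (𝓝 (∫ θ in Ioo (-Real.pi) Real.pi, Real.log ‖g (cayley ζ (circleMap 0 1 θ))‖)) := by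
    have hev : ∀ᶠ r : ℝ in 𝓝[<] 1, 0 < r ∧ r < 1 := by
      filter_upwards [self_mem_nhdsWithin, nhdsWithin_le_nhds (Ioi_mem_nhds one_pos)] with r h1 h2
      exact ⟨h2, h1⟩
    have hball : ∀ r : ℝ, 0 < r ∧ r < 1 → ∀ θ, ‖circleMap 0 r θ‖ < 1 := fun r hr θ => by
      rw [norm_circleMap_zero, abs_of_pos hr.1]; exact hr.2
    refine tendsto_integral_filter_of_dominated_convergence (fun _ => K) ?_ ?_ ?_ ?_
    · filter_upwards [hev] with r hr
      refine Continuous.aestronglyMeasurable ?_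
      rw [← continuousOn_univ]
      refine hlogc.comp (fun θ _ => ?_) (fun θ _ => (cayley_im_pos hζ (hball r hr θ)).le)
      exact ((hcay _ (one_add_ne_zero_of_norm_lt_one (hball r hr θ))).comp
        (by fun_prop : Continuous (circleMap 0 r)).continuousAt).continuousWithinAt
    · filter_upwards [hev] with r hr
      exact Eventually.of_forall fun θ => hK _ (cayley_im_pos hζ (hball r hr θ)).le
    · exact integrableOn_const (by simp)
    · refine (ae_restrict_iff' measurableSet_Ioo).2 (Eventually.of_forall fun θ hθ => ?_)
      have hr : Tendsto (fun r : ℝ => circleMap 0 r θ) (𝓝[<] 1) (𝓝 (circleMap 0 1 θ)) := by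
        have : Continuous fun r : ℝ => circleMap 0 r θ := by unfold circleMap; fun_prop
        exact (this.tendsto 1).mono_left nhdsWithin_le_nhds
      have hφ : Tendsto (fun r : ℝ => cayley ζ (circleMap 0 r θ)) (𝓝[<] 1)
          (𝓝[{z | 0 ≤ z.im}] (cayley ζ (circleMap 0 1 θ))) :=
        tendsto_nhdsWithin_iff.2 ⟨(hcay _ (hne θ hθ)).tendsto.comp hr,
          hev.mono fun r hr => (cayley_im_pos hζ (hball r hr θ)).le⟩
      exact (hlogc _ (him1 θ hθ)).tendsto.comp hφ
  have hconst : Tendsto (fun r : ℝ => (2 * Real.pi)⁻¹ * ∫ θ in Ioo (-Real.pi) Real.pi,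
      Real.log ‖g (cayley ζ (circleMap 0 r θ))‖) (𝓝[<] 1) (𝓝 (Real.log ‖g ζ‖)) := by
    refine tendsto_const_nhds.congr' ?_
    filter_upwards [self_mem_nhdsWithin, nhdsWithin_le_nhds (Ioi_mem_nhds one_pos)] with r h1 h2
    exact (hmean r h2 h1).symm
  rw [tendsto_nhds_unique hconst (hlim.const_mul _)]
  -- Change of variables θ = 2 arctan((ξ - Re ζ)/Im ζ): its Jacobian 2 Im ζ/|ξ - ζ|² with the
  -- prefactor 1/(2π) is the Poisson kernel.
  have himage : (fun ξ : ℝ => 2 * Real.arctan ((ξ - ζ.re) / ζ.im)) '' univ =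
      Ioo (-Real.pi) Real.pi := by
    apply Subset.antisymm
    · rintro _ ⟨ξ, -, rfl⟩
      have h1 := Real.arctan_lt_pi_div_two ((ξ - ζ.re) / ζ.im)
      have h2 := Real.neg_pi_div_two_lt_arctan ((ξ - ζ.re) / ζ.im)
      exact ⟨by simp only; linarith, by simp only; linarith⟩
    · intro θ hθ
      refine ⟨ζ.re + ζ.im * Real.tan (θ / 2), mem_univ _, ?_⟩
      simp only
      rw [add_sub_cancel_left, mul_div_cancel_left₀ _ hζ.ne',
        Real.arctan_tan (by linarith [hθ.1]) (by linarith [hθ.2])]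
      ring
  have hinj : InjOn (fun ξ : ℝ => 2 * Real.arctan ((ξ - ζ.re) / ζ.im)) univ := by
    intro a _ b _ hab
    have h1 := Real.arctan_injective (mul_left_cancel₀ two_ne_zero hab)
    have h2 := (div_left_inj' hζ.ne').1 h1
    linarith
  have hder : ∀ ξ ∈ (univ : Set ℝ), HasDerivWithinAt
      (fun ξ : ℝ => 2 * Real.arctan ((ξ - ζ.re) / ζ.im))
      (2 * (1 / (1 + ((ξ - ζ.re) / ζ.im) ^ 2) * (1 / ζ.im))) univ ξ := fun ξ _ =>
    ((((hasDerivAt_id ξ).sub_const ζ.re).div_const ζ.im).arctan.const_mul 2).hasDerivWithinAt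
  rw [← himage, integral_image_eq_integral_abs_deriv_smul MeasurableSet.univ hder hinj,
    Measure.restrict_univ, ← integral_const_mul]
  refine integral_congr_ae (Eventually.of_forall fun ξ => ?_)
  simp only [smul_eq_mul]
  rw [cayley_circleMap_arctan hζ ξ, ← mul_assoc]
  congr 1
  have hsq : ‖(ξ : ℂ) - ζ‖ ^ 2 = (ξ - ζ.re) ^ 2 + ζ.im ^ 2 := by
    rw [← Complex.normSq_eq_norm_sq, Complex.normSq_apply]
    simp only [Complex.sub_re, Complex.sub_im, Complex.ofReal_re, Complex.ofReal_im]
    ring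
  rw [hsq, abs_of_pos (by positivity)]
  have hpi := Real.pi_pos
  have : 0 < (ξ - ζ.re) ^ 2 + ζ.im ^ 2 := by positivity
  field_simp
  ring

end Poisson

/-! ### Reconstruction of an outer function from its boundary modulus -/

section Outer

/-- The common dominating function. Any exponent strictly between 0 and 1 would serve: it absorbs
the logarithmic singularity at the origin and still decays fast enough at infinity after
multiplication by the Cauchy kernel. -/
theorem integrableOn_Ioi_inv_sqrt_div :
    IntegrableOn (fun x : ℝ => 1 / √|x| / (1 + |x|)) (Ioi 0) := by
  have hm : ∀ s : Set ℝ, AEStronglyMeasurable (fun x : ℝ => 1 / √|x| / (1 + |x|))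
      (volume.restrict s) := fun s => by
    have : Measurable (fun x : ℝ => 1 / √|x| / (1 + |x|)) := by fun_prop
    exact this.aestronglyMeasurable
  rw [← Ioc_union_Ioi_eq_Ioi zero_le_one]
  refine IntegrableOn.union ?_ ?_
  · have h1 : IntegrableOn (fun x : ℝ => x ^ (-(1 / 2) : ℝ)) (Ioc 0 1) :=
      (intervalIntegrable_iff_integrableOn_Ioc_of_le zero_le_one).1
        (intervalIntegral.intervalIntegrable_rpow' (by norm_num))
    refine h1.mono' (hm _) ((ae_restrict_iff' measurableSet_Ioc).2 (Eventually.of_forall ?_))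
    intro x hx
    rw [Real.norm_of_nonneg (by positivity), Real.rpow_neg hx.1.le, ← Real.sqrt_eq_rpow,
      abs_of_pos hx.1, ← one_div]
    exact div_le_self (by positivity) (by linarith [hx.1])
  · have h1 : IntegrableOn (fun x : ℝ => x ^ (-(3 / 2) : ℝ)) (Ioi 1) :=
      integrableOn_Ioi_rpow_of_lt (by norm_num) one_pos
    refine h1.mono' (hm _) ((ae_restrict_iff' measurableSet_Ioi).2 (Eventually.of_forall ?_))
    intro x hx
    have hx0 : (0 : ℝ) < x := one_pos.trans hx
    have e : x ^ (-(3 / 2) : ℝ) = 1 / √x / x := by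
      rw [Real.sqrt_eq_rpow, show (-(3 / 2) : ℝ) = -(1 / 2) + -1 by norm_num, Real.rpow_add hx0, Real.rpow_neg_one,
        Real.rpow_neg hx0.le]
      field_simp
    rw [Real.norm_of_nonneg (by positivity), e, abs_of_pos hx0]
    gcongr
    linarith

theorem integrable_inv_sqrt_div : Integrable (fun x : ℝ => 1 / √|x| / (1 + |x|)) := by
  have h := integrableOn_Ioi_inv_sqrt_div
  have h2 : IntegrableOn (fun x : ℝ => 1 / √|x| / (1 + |x|)) (Iio 0) := by
    have := h.comp_neg
    simpa using this
  rw [← integrableOn_univ, ← Iio_union_Ici (a := (0 : ℝ))]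
  exact h2.union ((integrableOn_Ici_iff_integrableOn_Ioi (by simp)).2 h)

theorem inv_norm_sub_le {ζ : ℂ} (hζ : 0 < ζ.im) (ξ : ℝ) :
    1 / ‖(ξ : ℂ) - ζ‖ ≤ (1 + (1 + ‖ζ‖) / ζ.im) / (1 + |ξ|) := by
  have h1 : ζ.im ≤ ‖(ξ : ℂ) - ζ‖ := by
    have := Complex.abs_im_le_norm ((ξ : ℂ) - ζ)
    rw [Complex.sub_im, Complex.ofReal_im, zero_sub, abs_neg, abs_of_pos hζ] at this
    exact this
  have h2 : |ξ| ≤ ‖(ξ : ℂ) - ζ‖ + ‖ζ‖ := by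
    have := norm_add_le ((ξ : ℂ) - ζ) ζ
    rwa [sub_add_cancel, Complex.norm_real, Real.norm_eq_abs] at this
  have h3 : 0 < ‖(ξ : ℂ) - ζ‖ := hζ.trans_le h1
  rw [div_le_div_iff₀ h3 (by positivity), one_mul, add_mul, one_mul]
  have h4 : 1 + ‖ζ‖ ≤ (1 + ‖ζ‖) / ζ.im * ‖(ξ : ℂ) - ζ‖ := by
    rw [div_mul_eq_mul_div, le_div_iff₀ hζ]
    gcongr
  linarith

theorem ofReal_sub_ne_zero {ζ : ℂ} (hζ : 0 < ζ.im) (ξ : ℝ) : (ξ : ℂ) - ζ ≠ 0 := by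
  intro h
  have := congrArg Complex.im h
  simp at this
  exact hζ.ne' this

variable {g : ℂ → ℂ} {C : ℝ}

theorem continuous_ofReal_upper : ContinuousOn (fun ξ : ℝ => (ξ : ℂ)) {0}ᶜ :=
  Complex.continuous_ofReal.continuousOn

theorem aestronglyMeasurable_log_norm (hc : ContinuousOn g {z | 0 ≤ z.im ∧ z ≠ 0})
    (h0 : ∀ z : ℂ, 0 ≤ z.im → z ≠ 0 → g z ≠ 0) :
    AEStronglyMeasurable (fun ξ : ℝ => Real.log ‖g ξ‖) volume := by
  have h1 : ContinuousOn (fun ξ : ℝ => Real.log ‖g ξ‖) {0}ᶜ := by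
    refine ContinuousOn.log ?_ fun ξ hξ => norm_ne_zero_iff.2 (h0 _ (by simp) (by simpa using hξ))
    exact (hc.comp continuous_ofReal_upper fun ξ hξ => ⟨by simp, by simpa using hξ⟩).norm
  have h2 := h1.aestronglyMeasurable (μ := volume) (measurableSet_singleton (0 : ℝ)).compl
  rwa [restrict_compl_singleton] at h2

/-- The Poisson formula for `log ‖g‖` when `log ‖g‖` has an inverse square root bound. -/
theorem log_norm_eq_poisson (hd : DifferentiableOn ℂ g {z | 0 < z.im})
    (hc : ContinuousOn g {z | 0 ≤ z.im ∧ z ≠ 0}) (h0 : ∀ z : ℂ, 0 ≤ z.im → z ≠ 0 → g z ≠ 0)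
    (hC : ∀ z : ℂ, 0 ≤ z.im → z ≠ 0 → |Real.log ‖g z‖| ≤ C / √‖z‖) {ζ : ℂ} (hζ : 0 < ζ.im) :
    Real.log ‖g ζ‖ = ∫ ξ : ℝ, ζ.im / (Real.pi * ‖(ξ : ℂ) - ζ‖ ^ 2) * Real.log ‖g ξ‖ := by
  have hC0 : 0 ≤ C := by
    have := (abs_nonneg _).trans (hC Complex.I (by simp) Complex.I_ne_zero)
    simpa using this
  have him : ∀ (δ : ℝ) (z : ℂ), (z + Complex.I * δ).im = z.im + δ := fun δ z => by simp
  have hne : ∀ (δ : ℝ) (z : ℂ), 0 < δ → 0 ≤ z.im → z + Complex.I * δ ≠ 0 := fun δ z hδ hz h => by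
    have := him δ z
    rw [h, Complex.zero_im] at this
    linarith
  -- Raising g by iδ bounds the log-modulus by C/√δ, so the bounded case applies. As |ξ + iδ| ≥ |ξ|,
  -- the bound C/√|ξ| is uniform in δ and dominates the passage to δ = 0.
  have hshift : ∀ δ : ℝ, 0 < δ → Real.log ‖g (ζ + Complex.I * δ)‖ =
      ∫ ξ : ℝ, ζ.im / (Real.pi * ‖(ξ : ℂ) - ζ‖ ^ 2) * Real.log ‖g (ξ + Complex.I * δ)‖ := by
    intro δ hδ
    refine log_norm_eq_poisson_of_bounded (g := fun z => g (z + Complex.I * δ)) (K := C / √δ)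
      ?_ ?_ ?_ ?_ hζ
    · refine hd.comp (by fun_prop) fun z (hz : 0 < z.im) => ?_
      simp only [mem_ofPred_eq, him]
      linarith
    · refine hc.comp (by fun_prop) fun z (hz : 0 ≤ z.im) => ⟨?_, hne δ z hδ hz⟩
      simp only [him]
      linarith
    · intro z hz
      exact h0 _ (by rw [him]; linarith) (hne δ z hδ hz)
    · intro z hz
      refine (hC _ (by rw [him]; linarith) (hne δ z hδ hz)).trans ?_
      gcongr
      have := Complex.abs_im_le_norm (z + Complex.I * δ)
      rw [him, abs_of_nonneg (by linarith)] at this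
      linarith
  have hlogc : ContinuousOn (fun z => Real.log ‖g z‖) {z | 0 ≤ z.im ∧ z ≠ 0} :=
    hc.norm.log fun z hz => norm_ne_zero_iff.2 (h0 z hz.1 hz.2)
  have hpt : ∀ z : ℂ, 0 ≤ z.im → z ≠ 0 → Tendsto (fun δ : ℝ => Real.log ‖g (z + Complex.I * δ)‖)
      (𝓝[>] 0) (𝓝 (Real.log ‖g z‖)) := by
    intro z hz hz0
    have h1 : Tendsto (fun δ : ℝ => z + Complex.I * δ) (𝓝[>] 0) (𝓝[{z | 0 ≤ z.im ∧ z ≠ 0}] z) := by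
      refine tendsto_nhdsWithin_iff.2 ⟨?_, ?_⟩
      · have : Continuous fun δ : ℝ => z + Complex.I * δ := by fun_prop
        have h2 := (this.tendsto 0).mono_left (nhdsWithin_le_nhds (s := Ioi 0))
        simpa using h2
      · filter_upwards [self_mem_nhdsWithin] with δ hδ
        exact ⟨by rw [him]; exact add_nonneg hz (le_of_lt hδ), hne δ z hδ hz⟩
    exact (hlogc z ⟨hz, hz0⟩).tendsto.comp h1
  have hζ0 : ζ ≠ 0 := by rintro rfl; simp at hζ
  set k := 1 + (1 + ‖ζ‖) / ζ.im
  have hlim : Tendsto (fun δ : ℝ => ∫ ξ : ℝ, ζ.im / (Real.pi * ‖(ξ : ℂ) - ζ‖ ^ 2) *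
      Real.log ‖g (ξ + Complex.I * δ)‖) (𝓝[>] 0)
      (𝓝 (∫ ξ : ℝ, ζ.im / (Real.pi * ‖(ξ : ℂ) - ζ‖ ^ 2) * Real.log ‖g ξ‖)) := by
    refine tendsto_integral_filter_of_dominated_convergence
      (fun ξ => k * C * (1 / √|ξ| / (1 + |ξ|))) ?_ ?_ (integrable_inv_sqrt_div.const_mul _) ?_
    · filter_upwards [self_mem_nhdsWithin] with δ hδ
      refine Continuous.aestronglyMeasurable (Continuous.mul ?_ ?_)
      · refine continuous_const.div (by fun_prop) fun ξ => ?_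
        exact mul_ne_zero Real.pi_ne_zero (pow_ne_zero 2 (norm_ne_zero_iff.2 (ofReal_sub_ne_zero hζ ξ)))
      · rw [← continuousOn_univ]
        refine hlogc.comp (by fun_prop) fun ξ _ => ⟨?_, hne δ ξ hδ (by simp)⟩
        rw [him]; simpa using le_of_lt hδ
    · filter_upwards [self_mem_nhdsWithin] with δ hδ
      filter_upwards [Measure.ae_ne volume (0 : ℝ)] with ξ hξ
      have hξ' : 0 < |ξ| := abs_pos.2 hξ
      have hn : 0 < ‖(ξ : ℂ) - ζ‖ := norm_pos_iff.2 (ofReal_sub_ne_zero hζ ξ)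
      have h1 : |Real.log ‖g (ξ + Complex.I * δ)‖| ≤ C / √|ξ| := by
        refine (hC _ (by rw [him]; simpa using le_of_lt hδ) (hne δ ξ hδ (by simp))).trans ?_
        gcongr
        have := Complex.abs_re_le_norm ((ξ : ℂ) + Complex.I * δ)
        simpa using this
      have h2 : ζ.im / (Real.pi * ‖(ξ : ℂ) - ζ‖ ^ 2) ≤ k / (1 + |ξ|) := by
        refine le_trans ?_ (inv_norm_sub_le hζ ξ)
        rw [div_le_div_iff₀ (mul_pos Real.pi_pos (pow_pos hn 2)) hn]
        have h3 : ζ.im ≤ ‖(ξ : ℂ) - ζ‖ := by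
          have := Complex.abs_im_le_norm ((ξ : ℂ) - ζ)
          rw [Complex.sub_im, Complex.ofReal_im, zero_sub, abs_neg, abs_of_pos hζ] at this
          exact this
        have h4 : (1 : ℝ) ≤ Real.pi := by linarith [Real.pi_gt_three]
        nlinarith [mul_le_mul_of_nonneg_right h3 hn.le, sq_nonneg ‖(ξ : ℂ) - ζ‖,
          mul_le_mul_of_nonneg_right h4 (sq_nonneg ‖(ξ : ℂ) - ζ‖)]
      rw [norm_mul, Real.norm_of_nonneg (by positivity), Real.norm_eq_abs]
      calc _ ≤ k / (1 + |ξ|) * (C / √|ξ|) := by gcongr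
        _ = _ := by ring
    · filter_upwards [Measure.ae_ne volume (0 : ℝ)] with ξ hξ
      exact (hpt ξ (by simp) (by simpa using hξ)).const_mul _
  have h1 := hpt ζ hζ.le hζ0
  refine tendsto_nhds_unique h1 (hlim.congr' ?_)
  filter_upwards [self_mem_nhdsWithin] with δ hδ using (hshift δ hδ).symm

theorem integrable_div_sub {u : ℝ → ℝ} (hu : AEStronglyMeasurable u volume)
    (hb : ∀ ξ : ℝ, ξ ≠ 0 → |u ξ| ≤ C / √|ξ|) {ζ : ℂ} (hζ : 0 < ζ.im) :
    Integrable (fun ξ : ℝ => (u ξ : ℂ) / ((ξ : ℂ) - ζ)) := by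
  refine (integrable_inv_sqrt_div.const_mul (C * (1 + (1 + ‖ζ‖) / ζ.im))).mono' ?_ ?_
  · exact (Complex.continuous_ofReal.comp_aestronglyMeasurable hu).div₀
      (by fun_prop : Continuous fun ξ : ℝ => (ξ : ℂ) - ζ).aestronglyMeasurable
  · filter_upwards [Measure.ae_ne volume (0 : ℝ)] with ξ hξ
    have h1 := inv_norm_sub_le hζ ξ
    have h2 := hb ξ hξ
    rw [norm_div, Complex.norm_real, Real.norm_eq_abs, div_eq_mul_one_div]
    calc |u ξ| * (1 / ‖(ξ : ℂ) - ζ‖)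
        ≤ (C / √|ξ|) * ((1 + (1 + ‖ζ‖) / ζ.im) / (1 + |ξ|)) := by
          gcongr
          exact (abs_nonneg _).trans h2
      _ = _ := by ring

/-- The Cauchy integral of a function with an inverse square root bound. -/
noncomputable def cauchyInt (u : ℝ → ℝ) (ζ : ℂ) : ℂ :=
  1 / (Real.pi * Complex.I) * ∫ ξ : ℝ, (u ξ : ℂ) / ((ξ : ℂ) - ζ)

theorem differentiableOn_cauchyInt {u : ℝ → ℝ} (hu : AEStronglyMeasurable u volume)
    (hb : ∀ ξ : ℝ, ξ ≠ 0 → |u ξ| ≤ C / √|ξ|) :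
    DifferentiableOn ℂ (cauchyInt u) {z | 0 < z.im} := by
  intro ζ hζ
  have hζ : 0 < ζ.im := hζ
  refine DifferentiableAt.differentiableWithinAt (DifferentiableAt.const_mul ?_ _)
  have him : ∀ z ∈ Metric.ball ζ (ζ.im / 2), 0 < z.im := by
    intro z hz
    have := (Complex.abs_im_le_norm (z - ζ)).trans_lt (mem_ball_iff_norm.1 hz)
    rw [Complex.sub_im] at this
    linarith [(abs_lt.1 this).1]
  have hdiff := differentiableOn_integral_of_dominated (μ := volume)
    (F := fun z ξ => (u ξ : ℂ) / ((ξ : ℂ) - z)) (U := Metric.ball ζ (ζ.im / 2))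
    (bound := fun ξ => 2 * ‖(u ξ : ℂ) / ((ξ : ℂ) - ζ)‖) Metric.isOpen_ball
    (fun z hz => (integrable_div_sub hu hb (him z hz)).1) ?_ ?_
    ((integrable_div_sub hu hb hζ).norm.const_mul 2)
  · exact hdiff.differentiableAt (Metric.ball_mem_nhds ζ (by positivity))
  · refine Eventually.of_forall fun ξ => ?_
    exact (differentiableOn_const _).div (by fun_prop) fun z hz => ofReal_sub_ne_zero (him z hz) ξ
  · refine Eventually.of_forall fun ξ z hz => ?_
    have h1 : ζ.im ≤ ‖(ξ : ℂ) - ζ‖ := by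
      have := Complex.abs_im_le_norm ((ξ : ℂ) - ζ)
      rw [Complex.sub_im, Complex.ofReal_im, zero_sub, abs_neg, abs_of_pos hζ] at this
      exact this
    have h2 : ‖(ξ : ℂ) - ζ‖ ≤ ‖(ξ : ℂ) - z‖ + ‖z - ζ‖ := by
      simpa using norm_add_le ((ξ : ℂ) - z) (z - ζ)
    have h3 := mem_ball_iff_norm.1 hz
    have h4 : ‖(ξ : ℂ) - ζ‖ / 2 ≤ ‖(ξ : ℂ) - z‖ := by linarith
    have h5 : 0 < ‖(ξ : ℂ) - ζ‖ := by linarith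
    rw [norm_div, norm_div]
    calc ‖(u ξ : ℂ)‖ / ‖(ξ : ℂ) - z‖ ≤ ‖(u ξ : ℂ)‖ / (‖(ξ : ℂ) - ζ‖ / 2) := by gcongr
      _ = _ := by field_simp

/-- The real part of 1/(πi(ξ - ζ)) is the Poisson kernel. The constant is 1/(πi) rather than 1/(2πi)
because only the real part of the boundary logarithm is supplied. -/
theorem cauchyInt_re {u : ℝ → ℝ} (hu : AEStronglyMeasurable u volume)
    (hb : ∀ ξ : ℝ, ξ ≠ 0 → |u ξ| ≤ C / √|ξ|) {ζ : ℂ} (hζ : 0 < ζ.im) :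
    (cauchyInt u ζ).re = ∫ ξ : ℝ, ζ.im / (Real.pi * ‖(ξ : ℂ) - ζ‖ ^ 2) * u ξ := by
  have hint := (integrable_div_sub hu hb hζ).const_mul (1 / (Real.pi * Complex.I))
  rw [cauchyInt, ← integral_const_mul, ← Complex.reCLM_apply,
    ← ContinuousLinearMap.integral_comp_comm _ hint]
  refine integral_congr_ae (Eventually.of_forall fun ξ => ?_)
  simp only [Complex.reCLM_apply]
  have hn : Complex.normSq ((ξ : ℂ) - ζ) ≠ 0 :=
    fun h => ofReal_sub_ne_zero hζ ξ (Complex.normSq_eq_zero.1 h)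
  have e : (1 / (Real.pi * Complex.I) * ((u ξ : ℂ) / ((ξ : ℂ) - ζ)) : ℂ) =
      ((u ξ / Real.pi / Complex.normSq ((ξ : ℂ) - ζ) : ℝ) : ℂ) *
        (-Complex.I * (starRingEnd ℂ) ((ξ : ℂ) - ζ)) := by
    have h1 := ofReal_sub_ne_zero hζ ξ
    have h2 : (Real.pi : ℂ) ≠ 0 := Complex.ofReal_ne_zero.2 Real.pi_ne_zero
    have h3 : (starRingEnd ℂ) ((ξ : ℂ) - ζ) ≠ 0 := by rwa [Ne, map_eq_zero]
    push_cast
    rw [← Complex.mul_conj]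
    field_simp
    rw [Complex.I_sq]; ring
  rw [e, Complex.re_ofReal_mul, ← Complex.normSq_eq_norm_sq]
  have : (-Complex.I * (starRingEnd ℂ) ((ξ : ℂ) - ζ)).re = ζ.im := by simp
  rw [this]
  have := Real.pi_ne_zero
  field_simp

theorem tendsto_cauchyInt {u : ℝ → ℝ} (hu : AEStronglyMeasurable u volume)
    (hb : ∀ ξ : ℝ, ξ ≠ 0 → |u ξ| ≤ C / √|ξ|) :
    Tendsto (fun t : ℝ => cauchyInt u (Complex.I * t)) atTop (𝓝 0) := by
  have h1 : Tendsto (fun t : ℝ => ∫ ξ : ℝ, (u ξ : ℂ) / ((ξ : ℂ) - Complex.I * t)) atTop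
      (𝓝 (∫ _ : ℝ, (0 : ℂ))) := by
    refine tendsto_integral_filter_of_dominated_convergence
      (fun ξ => ‖(u ξ : ℂ) / ((ξ : ℂ) - Complex.I)‖) ?_ ?_
      (integrable_div_sub hu hb (by simp)).norm ?_
    · filter_upwards [eventually_gt_atTop 0] with t ht
      exact (integrable_div_sub hu hb (by simpa using ht)).1
    · filter_upwards [eventually_ge_atTop 1] with t ht
      refine Eventually.of_forall fun ξ => ?_
      rw [norm_div, norm_div]
      have h2 : 0 < ‖(ξ : ℂ) - Complex.I‖ :=
        norm_pos_iff.2 (ofReal_sub_ne_zero (by simp) ξ)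
      gcongr
      rw [← sq_le_sq₀ (norm_nonneg _) (norm_nonneg _), ← Complex.normSq_eq_norm_sq,
        ← Complex.normSq_eq_norm_sq, Complex.normSq_apply, Complex.normSq_apply]
      simp
      nlinarith
    · refine Eventually.of_forall fun ξ => ?_
      rw [tendsto_zero_iff_norm_tendsto_zero]
      have h3 : Tendsto (fun t : ℝ => ‖(u ξ : ℂ)‖ / t) atTop (𝓝 0) :=
        tendsto_const_nhds.div_atTop tendsto_id
      refine squeeze_zero' (Eventually.of_forall fun _ => norm_nonneg _) ?_ h3
      filter_upwards [eventually_gt_atTop 0] with t ht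
      rw [norm_div]
      gcongr
      have := Complex.abs_im_le_norm ((ξ : ℂ) - Complex.I * t)
      simp only [Complex.sub_im, Complex.ofReal_im, Complex.mul_im, Complex.I_re, Complex.I_im,
        Complex.ofReal_re, zero_mul, one_mul, zero_add, zero_sub, abs_neg] at this
      exact (le_abs_self t).trans this
  rw [integral_zero] at h1
  have h2 := h1.const_mul (1 / (Real.pi * Complex.I) : ℂ)
  rwa [mul_zero] at h2

/-- A zero-free function on the upper half-plane with suitable behaviour at `0` and `∞` is the
exponential of the Cauchy integral of its boundary log-modulus. -/
theorem eq_exp_cauchyInt (hd : DifferentiableOn ℂ g {z | 0 < z.im})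
    (hc : ContinuousOn g {z | 0 ≤ z.im ∧ z ≠ 0}) (h0 : ∀ z : ℂ, 0 ≤ z.im → z ≠ 0 → g z ≠ 0)
    (hC : ∀ z : ℂ, 0 ≤ z.im → z ≠ 0 → |Real.log ‖g z‖| ≤ C / √‖z‖)
    (hinf : Tendsto (fun t : ℝ => g (Complex.I * t)) atTop (𝓝 1)) {ζ : ℂ} (hζ : 0 < ζ.im) :
    Integrable (fun ξ : ℝ => (Real.log ‖g ξ‖ : ℂ) / ((ξ : ℂ) - ζ)) ∧
      g ζ = Complex.exp (cauchyInt (fun ξ : ℝ => Real.log ‖g ξ‖) ζ) := by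
  have hu := aestronglyMeasurable_log_norm hc h0
  have hb : ∀ ξ : ℝ, ξ ≠ 0 → |Real.log ‖g ξ‖| ≤ C / √|ξ| := fun ξ hξ => by
    have := hC ξ (by simp) (by simpa using hξ)
    rwa [Complex.norm_real, Real.norm_eq_abs] at this
  refine ⟨integrable_div_sub hu hb hζ, ?_⟩
  have hne : ∀ z : ℂ, 0 < z.im → g z ≠ 0 := fun z hz =>
    h0 z hz.le (by rintro rfl; simp at hz)
  set u : ℝ → ℝ := fun ξ => Real.log ‖g ξ‖ with hudef
  -- By the Poisson formula F has modulus one, so the maximum principle makes it constant; its value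
  -- is found at i∞, where the Cauchy integral vanishes and g tends to 1.
  set F : ℂ → ℂ := fun z => Complex.exp (cauchyInt u z) / g z
  have hF : DifferentiableOn ℂ F {z | 0 < z.im} :=
    (differentiableOn_cauchyInt hu hb).cexp.div hd hne
  have hF1 : ∀ z : ℂ, 0 < z.im → ‖F z‖ = 1 := fun z hz => by
    have hp : 0 < ‖g z‖ := norm_pos_iff.2 (hne z hz)
    rw [norm_div, Complex.norm_exp, cauchyInt_re hu hb hz, ← log_norm_eq_poisson hd hc h0 hC hz,
      Real.exp_log hp, div_self hp.ne']
  have hop : IsOpen {z : ℂ | 0 < z.im} := isOpen_lt continuous_const Complex.continuous_im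
  have hconv : IsPreconnected {z : ℂ | 0 < z.im} := (convex_halfSpace_im_gt 0).isPreconnected
  have heq := Complex.eqOn_of_isPreconnected_of_isMaxOn_norm hconv hop hF hζ (c := ζ)
    (fun z hz => by
      simp only [Function.comp_apply, mem_ofPred_eq]
      rw [hF1 z hz, hF1 ζ hζ])
  have hlim : Tendsto (fun t : ℝ => F (Complex.I * t)) atTop (𝓝 1) := by
    have h1 := ((Complex.continuous_exp.tendsto 0).comp (tendsto_cauchyInt hu hb)).div hinf one_ne_zero
    rwa [Complex.exp_zero, div_one] at h1
  have hlim2 : Tendsto (fun t : ℝ => F (Complex.I * t)) atTop (𝓝 (F ζ)) := by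
    refine tendsto_const_nhds.congr' ?_
    filter_upwards [eventually_gt_atTop 0] with t ht
    exact (heq (show 0 < (Complex.I * t : ℂ).im by simpa using ht)).symm
  have h1 := tendsto_nhds_unique hlim2 hlim
  exact ((div_eq_one_iff_eq (hne ζ hζ)).1 h1).symm

end Outer

/-! ### Blaschke factorization in the upper half-plane -/

section Blaschke

/-- Zeros are divided out one at a time by `dslope`. Simplicity keeps the quotient nonzero at the
removed point, and it persists at the remaining zeros because they are distinct from that point. -/
theorem exists_eq_prod_mul {U T : Set ℂ} (hU : IsOpen U) (hUT : U ⊆ T) (S : Finset ℂ) {f : ℂ → ℂ}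
    (hd : DifferentiableOn ℂ f U) (hc : ContinuousOn f T)
    (hS : ∀ s ∈ S, s ∈ U ∧ f s = 0 ∧ ∃ d ≠ 0, HasDerivAt f d s) :
    ∃ g : ℂ → ℂ, DifferentiableOn ℂ g U ∧ ContinuousOn g T ∧
      (∀ z, f z = (∏ s ∈ S, (z - s)) * g z) ∧ ∀ s ∈ S, g s ≠ 0 := by
  classical
  induction S using Finset.induction_on generalizing f with
  | empty => exact ⟨f, hd, hc, by simp, by simp⟩
  | insert s₀ S hs₀ ih =>
    obtain ⟨hsU, hf0, d, hd0, hder⟩ := hS s₀ (Finset.mem_insert_self _ _)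
    have hmem := hU.mem_nhds hsU
    have hmul : ∀ z, f z = (z - s₀) * dslope f s₀ z := fun z => by
      have := sub_smul_dslope f s₀ z
      rw [smul_eq_mul, hf0, sub_zero] at this
      exact this.symm
    have h1 : DifferentiableOn ℂ (dslope f s₀) U := (Complex.differentiableOn_dslope hmem).2 hd
    have h2 : ContinuousOn (dslope f s₀) T :=
      (continuousOn_dslope (mem_of_superset hmem hUT)).2 ⟨hc, hder.differentiableAt⟩
    have h3 : dslope f s₀ s₀ ≠ 0 := by rwa [dslope_same, hder.deriv]
    obtain ⟨g, hg1, hg2, hg3, hg4⟩ := ih h1 h2 fun s hs => by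
      obtain ⟨k1, k2, e, he, k3⟩ := hS s (Finset.mem_insert_of_mem hs)
      have hne : s - s₀ ≠ 0 := sub_ne_zero.2 fun h => hs₀ (h ▸ hs)
      refine ⟨k1, ?_, e / (s - s₀), div_ne_zero he hne, ?_⟩
      · have := hmul s
        rw [k2] at this
        exact (mul_eq_zero.1 this.symm).resolve_left hne
      · have h4 := k3.div ((hasDerivAt_id s).sub_const s₀) hne
        have e1 : (e * (id s - s₀) - f s * 1) / (id s - s₀) ^ 2 = e / (s - s₀) := by
          rw [k2, id]; field_simp; ring
        rw [e1] at h4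
        refine h4.congr_of_eventuallyEq ?_
        filter_upwards [isOpen_ne.mem_nhds (sub_ne_zero.1 hne)] with z hz
        rw [Pi.div_apply, hmul z, id, mul_div_cancel_left₀ _ (sub_ne_zero.2 hz)]
    refine ⟨g, hg1, hg2, fun z => ?_, fun s hs => ?_⟩
    · rw [hmul, hg3, Finset.prod_insert hs₀, mul_assoc]
    · rcases Finset.mem_insert.1 hs with rfl | hs
      · intro h0
        rw [hg3, h0, mul_zero] at h3
        exact h3 rfl
      · exact hg4 s hs

theorem abs_log_norm_le {w : ℂ} (hw : ‖w - 1‖ ≤ 1 / 2) : |Real.log ‖w‖| ≤ 2 * ‖w - 1‖ := by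
  have h1 := abs_le.1 ((abs_norm_sub_norm_le w 1).trans_eq rfl)
  rw [norm_one] at h1
  have hpos : 1 / 2 ≤ ‖w‖ := by linarith
  rw [abs_le]
  constructor
  · have h2 := Real.one_sub_inv_le_log_of_pos (by linarith : 0 < ‖w‖)
    have h3 : ‖w‖⁻¹ - 1 ≤ 2 * ‖w - 1‖ := by
      have : ‖w‖⁻¹ - 1 = (1 - ‖w‖) / ‖w‖ := by field_simp
      rw [this, div_le_iff₀ (by linarith)]
      nlinarith [norm_nonneg (w - 1)]
    linarith
  · have := Real.log_le_sub_one_of_pos (by linarith : 0 < ‖w‖)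
    linarith [norm_nonneg (w - 1)]

theorem isBigO_log_norm_atInfty {l : Filter ℂ} (hl : Tendsto norm l atTop) {f : ℂ → ℂ} {C : ℝ}
    (hf : ∀ᶠ z in l, ‖f z - 1‖ ≤ C / ‖z‖) :
    (fun z => Real.log ‖f z‖) =O[l] fun z => 1 / √‖z‖ := by
  have h0 : Tendsto (fun z : ℂ => C / ‖z‖) l (𝓝 0) := tendsto_const_nhds.div_atTop hl
  refine Asymptotics.IsBigO.of_bound (2 * |C|) ?_
  filter_upwards [hf, h0.eventually_le_const (by norm_num : (0 : ℝ) < 1 / 2),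
    hl.eventually_ge_atTop 1] with z h1 h2 h3
  rw [Real.norm_eq_abs, Real.norm_of_nonneg (by positivity)]
  refine (abs_log_norm_le (h1.trans h2)).trans ?_
  rw [mul_assoc]
  refine mul_le_mul_of_nonneg_left (h1.trans ?_) two_pos.le
  calc C / ‖z‖ ≤ |C| / ‖z‖ := by gcongr; exact le_abs_self C
    _ ≤ |C| / √‖z‖ := by
      gcongr
      exact Real.sqrt_le_iff.2 ⟨norm_nonneg z, by nlinarith⟩
    _ = |C| * (1 / √‖z‖) := by ring

/-- The lower bound controls the negative part of the logarithm. A possible simple pole contributes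
at most log(C/|z|) ≤ 2√(C/|z|). -/
theorem isBigO_log_norm_zero {l : Filter ℂ} (hl : Tendsto norm l (𝓝[>] 0)) {f : ℂ → ℂ} {C r : ℝ}
    (hr : 0 < r) (hf : ∀ᶠ z in l, r ≤ ‖f z‖ ∧ ‖f z‖ ≤ C / ‖z‖) :
    (fun z => Real.log ‖f z‖) =O[l] fun z => 1 / √‖z‖ := by
  refine Asymptotics.IsBigO.of_bound (|Real.log r| + 2 * √C) ?_
  have h1 : ∀ᶠ z in l, 0 < ‖z‖ := hl.eventually self_mem_nhdsWithin
  have h2 : ∀ᶠ z in l, ‖z‖ ≤ 1 :=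
    hl.eventually (nhdsWithin_le_nhds (Iic_mem_nhds one_pos))
  filter_upwards [hf, h1, h2] with z h3 h4 h5
  have h6 : 0 < ‖f z‖ := hr.trans_le h3.1
  have hC : 0 < C / ‖z‖ := h6.trans_le h3.2
  have h7 : (1 : ℝ) ≤ 1 / √‖z‖ := by
    rw [le_div_iff₀ (by positivity), one_mul]
    exact Real.sqrt_le_one.2 h5
  rw [Real.norm_eq_abs, Real.norm_of_nonneg (by positivity), abs_le]
  have h8 : Real.log r ≤ Real.log ‖f z‖ := Real.log_le_log hr h3.1
  have h9 : Real.log ‖f z‖ ≤ 2 * √C * (1 / √‖z‖) := by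
    calc Real.log ‖f z‖ ≤ Real.log (C / ‖z‖) := Real.log_le_log h6 h3.2
      _ = 2 * Real.log √(C / ‖z‖) := by rw [Real.log_sqrt hC.le]; ring
      _ ≤ 2 * √(C / ‖z‖) := by
        have := Real.log_le_sub_one_of_pos (Real.sqrt_pos.2 hC)
        linarith
      _ = _ := by rw [Real.sqrt_div' _ h4.le]; ring
  have h10 := neg_abs_le (Real.log r)
  have h11 := Real.sqrt_nonneg C
  constructor <;> nlinarith [abs_nonneg (Real.log r), mul_nonneg h11 (zero_le_one.trans h7),
    mul_nonneg (abs_nonneg (Real.log r)) (zero_le_one.trans h7)]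

/-- The estimates at 0 and infinity leave a compact half-annulus, where continuity gives a bound. -/
theorem exists_le_div_sqrt {u : ℂ → ℝ} (hc : ContinuousOn u {z | 0 ≤ z.im ∧ z ≠ 0})
    (hinf : u =O[Bornology.cobounded ℂ ⊓ 𝓟 {z | 0 ≤ z.im ∧ z ≠ 0}] fun z => 1 / √‖z‖)
    (hzero : u =O[𝓝[{z | 0 ≤ z.im ∧ z ≠ 0}] 0] fun z => 1 / √‖z‖) :
    ∃ C : ℝ, ∀ z : ℂ, 0 ≤ z.im → z ≠ 0 → |u z| ≤ C / √‖z‖ := by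
  obtain ⟨C₁, h1⟩ := hinf.bound
  obtain ⟨C₂, h2⟩ := hzero.bound
  rw [eventually_inf_principal, ← comap_norm_atTop, eventually_comap] at h1
  obtain ⟨R, hR⟩ := eventually_atTop.1 h1
  rw [eventually_nhdsWithin_iff, Metric.eventually_nhds_iff] at h2
  obtain ⟨δ, hδ, h2⟩ := h2
  have hcomp : IsCompact ({z : ℂ | 0 ≤ z.im} ∩ {z | δ ≤ ‖z‖} ∩ Metric.closedBall 0 R) := by
    refine (isCompact_closedBall (0 : ℂ) R).inter_left ?_
    exact (isClosed_le continuous_const Complex.continuous_im).inter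
      (isClosed_le continuous_const continuous_norm)
  obtain ⟨K, hK⟩ := hcomp.exists_bound_of_continuousOn (f := u)
    (hc.mono fun z hz => ⟨hz.1.1, norm_pos_iff.1 (hδ.trans_le hz.1.2)⟩)
  refine ⟨|C₁| + |C₂| + |K| * √R, fun z hz hz0 => ?_⟩
  have hz' : 0 < √‖z‖ := Real.sqrt_pos.2 (norm_pos_iff.2 hz0)
  rw [le_div_iff₀ hz']
  have hn : ‖1 / √‖z‖‖ = 1 / √‖z‖ := Real.norm_of_nonneg (by positivity)
  have hp1 := abs_nonneg C₁
  have hp2 := abs_nonneg C₂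
  have hp3 := mul_nonneg (abs_nonneg K) (Real.sqrt_nonneg R)
  by_cases ha : R ≤ ‖z‖
  · have := hR _ ha z rfl ⟨hz, hz0⟩
    rw [hn, Real.norm_eq_abs, mul_one_div, le_div_iff₀ hz'] at this
    linarith [le_abs_self C₁]
  by_cases hb : ‖z‖ < δ
  · have := h2 (by rwa [dist_zero_right]) ⟨hz, hz0⟩
    rw [hn, Real.norm_eq_abs, mul_one_div, le_div_iff₀ hz'] at this
    linarith [le_abs_self C₂]
  · have h3 := hK z ⟨⟨hz, not_lt.1 hb⟩, mem_closedBall_zero_iff.2 (not_le.1 ha).le⟩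
    rw [Real.norm_eq_abs] at h3
    have h4 : √‖z‖ ≤ √R := Real.sqrt_le_sqrt (not_le.1 ha).le
    have := mul_le_mul (h3.trans (le_abs_self K)) h4 hz'.le (abs_nonneg K)
    linarith

theorem add_I_mul_ne_zero {η : ℝ} (hη : 0 < η) {z : ℂ} (hz : 0 ≤ z.im) : z + Complex.I * η ≠ 0 := by
  intro h
  have := congrArg Complex.im h
  simp at this
  linarith

theorem norm_le_norm_add_I_mul {η : ℝ} (hη : 0 < η) {z : ℂ} (hz : 0 ≤ z.im) :
    ‖z‖ ≤ ‖z + Complex.I * η‖ := by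
  rw [← sq_le_sq₀ (norm_nonneg _) (norm_nonneg _), ← Complex.normSq_eq_norm_sq,
    ← Complex.normSq_eq_norm_sq, Complex.normSq_apply, Complex.normSq_apply]
  simp
  nlinarith

theorem norm_blaschke_sub_one_le {η : ℝ} (hη : 0 < η) {z : ℂ} (hz : 0 ≤ z.im) (hz0 : z ≠ 0) :
    ‖(z - Complex.I * η) / (z + Complex.I * η) - 1‖ ≤ 2 * η / ‖z‖ := by
  have e : (z - Complex.I * η) / (z + Complex.I * η) - 1 =
      -(Complex.I * (2 * η)) / (z + Complex.I * η) := by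
    rw [div_sub_one (add_I_mul_ne_zero hη hz)]
    ring
  have e2 : ‖(-(Complex.I * (2 * η)) : ℂ)‖ = 2 * η := by
    simp [abs_of_pos hη]
  rw [e, norm_div, e2]
  have := norm_pos_iff.2 hz0
  gcongr
  exact norm_le_norm_add_I_mul hη hz

theorem tendsto_norm_upper_zero :
    Tendsto (norm : ℂ → ℝ) (𝓝[{z : ℂ | 0 ≤ z.im ∧ z ≠ 0}] 0) (𝓝[>] 0) := by
  refine tendsto_nhdsWithin_iff.2 ⟨?_, ?_⟩
  · have := (continuous_norm.tendsto (0 : ℂ)).mono_left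
      (nhdsWithin_le_nhds (s := {z : ℂ | 0 ≤ z.im ∧ z ≠ 0}))
    rwa [norm_zero] at this
  · filter_upwards [self_mem_nhdsWithin] with z hz using norm_pos_iff.2 hz.2

theorem isBigO_log_blaschke_zero {η : ℝ} (hη : 0 < η) :
    (fun z : ℂ => Real.log ‖(z - Complex.I * η) / (z + Complex.I * η)‖)
      =O[𝓝[{z : ℂ | 0 ≤ z.im ∧ z ≠ 0}] 0] fun z => 1 / √‖z‖ := by
  have h0 : (Complex.I * η : ℂ) ≠ 0 := by simp [hη.ne']
  have hlim : Tendsto (fun z : ℂ => ‖(z - Complex.I * η) / (z + Complex.I * η)‖)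
      (𝓝[{z : ℂ | 0 ≤ z.im ∧ z ≠ 0}] 0) (𝓝 1) := by
    have hc : ContinuousAt (fun z : ℂ => (z - Complex.I * η) / (z + Complex.I * η)) 0 := by
      refine ContinuousAt.div (by fun_prop) (by fun_prop) ?_
      rwa [zero_add]
    have h1 := hc.norm.tendsto.mono_left (nhdsWithin_le_nhds (s := {z : ℂ | 0 ≤ z.im ∧ z ≠ 0}))
    rwa [zero_sub, zero_add, neg_div, div_self h0, norm_neg, norm_one] at h1
  refine isBigO_log_norm_zero tendsto_norm_upper_zero
    (f := fun z => (z - Complex.I * η) / (z + Complex.I * η)) (r := 1 / 2) (C := 2) (by norm_num) ?_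
  filter_upwards [hlim.eventually_const_le (by norm_num : (1 / 2 : ℝ) < 1),
    hlim.eventually_le_const (by norm_num : (1 : ℝ) < 2), self_mem_nhdsWithin,
    tendsto_norm_upper_zero.eventually (nhdsWithin_le_nhds (Iic_mem_nhds one_pos))] with z h3 h4 h6 h5
  refine ⟨h3, h4.trans ?_⟩
  rw [le_div_iff₀ (norm_pos_iff.2 h6.2)]
  linarith [show ‖z‖ ≤ 1 from h5]

/-- Factorization of a function on the upper half-plane with finitely many simple zeros on the
imaginary axis into a constant, a Blaschke product and an outer function. -/
theorem eq_blaschke_mul_exp {A : ℂ → ℂ} {a : ℂ} (ha : a ≠ 0) {N : ℕ} {η : Fin N → ℝ}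
    (hη : ∀ j, 0 < η j) (hinj : Function.Injective η)
    (hd : DifferentiableOn ℂ A {z | 0 < z.im})
    (hc : ContinuousOn A {z | 0 ≤ z.im ∧ z ≠ 0})
    (hzero : ∀ z : ℂ, 0 ≤ z.im → z ≠ 0 → A z = 0 → ∃ j, z = Complex.I * η j)
    (hA : ∀ j, A (Complex.I * η j) = 0)
    (hsimple : ∀ j, ∃ d ≠ 0, HasDerivAt A d (Complex.I * η j)) {C : ℝ}
    (hinf : ∀ z : ℂ, 0 ≤ z.im → z ≠ 0 → ‖A z - a‖ ≤ C / ‖z‖) {r : ℝ} (hr : 0 < r)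
    (hnear : ∀ᶠ z in 𝓝[{z | 0 ≤ z.im ∧ z ≠ 0}] 0, r ≤ ‖A z‖) {ζ : ℂ} (hζ : 0 < ζ.im) :
    Integrable (fun ξ : ℝ => (Real.log ‖A ξ / a‖ : ℂ) / ((ξ : ℂ) - ζ)) ∧
      A ζ = a * (∏ j, (ζ - Complex.I * η j) / (ζ + Complex.I * η j)) *
        Complex.exp (cauchyInt (fun ξ : ℝ => Real.log ‖A ξ / a‖) ζ) := by
  classical
  have hT : ∀ z : ℂ, 0 < z.im → z ≠ 0 := by rintro z hz rfl; simp at hz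
  have hη' : ∀ j, 0 < (Complex.I * η j : ℂ).im := fun j => by simpa using hη j
  have hop : IsOpen {z : ℂ | 0 < z.im} := isOpen_lt continuous_const Complex.continuous_im
  obtain ⟨h, hh1, hh2, hh3, hh4⟩ := exists_eq_prod_mul hop
    (T := {z : ℂ | 0 ≤ z.im ∧ z ≠ 0}) (fun z (hz : 0 < z.im) => ⟨hz.le, hT z hz⟩)
    (Finset.univ.image fun j => Complex.I * (η j : ℂ)) hd hc (by
      intro s hs
      obtain ⟨j, -, rfl⟩ := Finset.mem_image.1 hs
      exact ⟨hη' j, hA j, hsimple j⟩)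
  have hprod : ∀ z : ℂ, A z = (∏ j, (z - Complex.I * η j)) * h z := fun z => by
    rw [hh3, Finset.prod_image]
    intro i _ j _ hij
    exact hinj (Complex.ofReal_injective (mul_left_cancel₀ Complex.I_ne_zero hij))
  -- This is A/a divided by the Blaschke product, written with the factors z - iη already cancelled
  -- so that it is analytic and nonzero at the zeros of A.
  set g : ℂ → ℂ := fun z => h z * (∏ j, (z + Complex.I * η j)) / a with hg
  have hAg : ∀ z : ℂ, 0 ≤ z.im →
      A z / a = (∏ j, (z - Complex.I * η j) / (z + Complex.I * η j)) * g z := by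
    intro z hz
    have hne : (∏ j, (z + Complex.I * η j)) ≠ 0 :=
      Finset.prod_ne_zero_iff.2 fun j _ => add_I_mul_ne_zero (hη j) hz
    rw [hprod, hg, Finset.prod_div_distrib]
    field_simp
  have hgd : DifferentiableOn ℂ g {z | 0 < z.im} :=
    (hh1.mul (by fun_prop)).div_const a
  have hgc : ContinuousOn g {z | 0 ≤ z.im ∧ z ≠ 0} :=
    (hh2.mul (by fun_prop)).div_const a
  have hg0 : ∀ z : ℂ, 0 ≤ z.im → z ≠ 0 → g z ≠ 0 := by
    intro z hz hz0
    refine div_ne_zero (mul_ne_zero ?_ (Finset.prod_ne_zero_iff.2 fun j _ =>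
      add_I_mul_ne_zero (hη j) hz)) ha
    intro hhz
    obtain ⟨j, rfl⟩ := hzero z hz hz0 (by rw [hprod, hhz, mul_zero])
    exact hh4 _ (Finset.mem_image_of_mem _ (Finset.mem_univ j)) hhz
  set l := Bornology.cobounded ℂ ⊓ 𝓟 {z : ℂ | 0 ≤ z.im ∧ z ≠ 0} with hl
  have hlnorm : Tendsto (norm : ℂ → ℝ) l atTop := tendsto_norm_cobounded_atTop.mono_left inf_le_left
  have hlT : ∀ᶠ z in l, 0 ≤ z.im ∧ z ≠ 0 := mem_inf_of_right (mem_principal_self _)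
  set l₀ := 𝓝[{z : ℂ | 0 ≤ z.im ∧ z ≠ 0}] (0 : ℂ) with hl₀
  have hl₀T : ∀ᶠ z in l₀, 0 ≤ z.im ∧ z ≠ 0 := self_mem_nhdsWithin
  have hl₀norm : Tendsto (norm : ℂ → ℝ) l₀ (𝓝[>] 0) := tendsto_norm_upper_zero
  have hpa : 0 < ‖a‖ := norm_pos_iff.2 ha
  have hA1 : ∀ z : ℂ, 0 ≤ z.im → z ≠ 0 → ‖A z / a - 1‖ ≤ C / ‖a‖ / ‖z‖ := by
    intro z hz hz0
    rw [div_sub_one ha, norm_div, div_right_comm]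
    gcongr
    exact hinf z hz hz0
  have hb1 : ∀ j, ∀ z : ℂ, 0 ≤ z.im → z ≠ 0 →
      ‖(z - Complex.I * η j) / (z + Complex.I * η j) - 1‖ ≤ 2 * η j / ‖z‖ :=
    fun j z => norm_blaschke_sub_one_le (hη j)
  have hlog : ∀ z : ℂ, 0 ≤ z.im → z ≠ 0 → (∀ j, z ≠ Complex.I * η j) → Real.log ‖g z‖ =
      Real.log ‖A z / a‖ - ∑ j, Real.log ‖(z - Complex.I * η j) / (z + Complex.I * η j)‖ := by
    intro z hz hz0 hzj
    have hbj : ∀ j, (z - Complex.I * η j) / (z + Complex.I * η j) ≠ 0 := fun j =>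
      div_ne_zero (sub_ne_zero.2 (hzj j)) (add_I_mul_ne_zero (hη j) hz)
    rw [hAg z hz, norm_mul, Real.log_mul
      (norm_ne_zero_iff.2 (Finset.prod_ne_zero_iff.2 fun j _ => hbj j))
      (norm_ne_zero_iff.2 (hg0 z hz hz0)), norm_prod,
      Real.log_prod fun j _ => norm_ne_zero_iff.2 (hbj j)]
    ring
  have hj_inf : ∀ᶠ z in l, ∀ j, z ≠ Complex.I * η j := by
    rw [eventually_all]
    intro j
    filter_upwards [hlnorm.eventually_gt_atTop ‖Complex.I * η j‖] with z hz h
    rw [h] at hz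
    exact lt_irrefl _ hz
  have hj_zero : ∀ᶠ z in l₀, ∀ j, z ≠ Complex.I * η j := by
    rw [eventually_all]
    intro j
    exact nhdsWithin_le_nhds (isOpen_ne.mem_nhds (hT _ (hη' j)).symm)
  have hbig_inf : (fun z => Real.log ‖g z‖) =O[l] fun z => 1 / √‖z‖ := by
    have h1 := isBigO_log_norm_atInfty hlnorm (f := fun z => A z / a)
      (hlT.mono fun z hz => hA1 z hz.1 hz.2)
    have h2 := Asymptotics.IsBigO.sum (s := Finset.univ) fun j _ => isBigO_log_norm_atInfty hlnorm
      (f := fun z => (z - Complex.I * η j) / (z + Complex.I * η j))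
      (hlT.mono fun z hz => hb1 j z hz.1 hz.2)
    refine (h1.sub h2).congr' ?_ EventuallyEq.rfl
    filter_upwards [hlT, hj_inf] with z hz hzj
    rw [hlog z hz.1 hz.2 hzj, Finset.sum_apply]
  have hbig_zero : (fun z => Real.log ‖g z‖) =O[l₀] fun z => 1 / √‖z‖ := by
    have hle1 : ∀ᶠ z in l₀, ‖z‖ ≤ 1 :=
      hl₀norm.eventually (nhdsWithin_le_nhds (Iic_mem_nhds one_pos))
    -- A may have a pole-like growth at 0. The extra 1 in the constant absorbs the 1 in |A/a| ≤ 1 +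
    -- |A/a - 1|, since 1 ≤ 1/|z| there.
    have h1 := isBigO_log_norm_zero hl₀norm (f := fun z => A z / a) (r := r / ‖a‖)
      (C := C / ‖a‖ + 1) (by positivity) (by
        filter_upwards [hl₀T, hnear, hle1] with z hz hz1 hz2
        have hzp : 0 < ‖z‖ := norm_pos_iff.2 hz.2
        constructor
        · rw [norm_div]; gcongr
        · have h3 := norm_le_norm_add_norm_sub' (A z / a) 1
          rw [norm_one] at h3
          have h4 := hA1 z hz.1 hz.2
          have h5 : (1 : ℝ) ≤ 1 / ‖z‖ := by rwa [le_div_iff₀ hzp, one_mul]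
          rw [add_div]
          linarith)
    have h2 := Asymptotics.IsBigO.sum (s := Finset.univ) fun j _ => isBigO_log_blaschke_zero (hη j)
    refine (h1.sub h2).congr' ?_ EventuallyEq.rfl
    filter_upwards [hl₀T, hj_zero] with z hz hzj
    rw [hlog z hz.1 hz.2 hzj, Finset.sum_apply]
  obtain ⟨K, hK⟩ := exists_le_div_sqrt
    (hgc.norm.log fun z hz => norm_ne_zero_iff.2 (hg0 z hz.1 hz.2)) hbig_inf hbig_zero
  have hB : Tendsto (fun z : ℂ => ∏ j, (z - Complex.I * η j) / (z + Complex.I * η j)) l (𝓝 1) := by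
    rw [show (1 : ℂ) = ∏ _j : Fin N, 1 by simp]
    refine tendsto_finsetProd _ fun j _ => tendsto_iff_norm_sub_tendsto_zero.2 ?_
    refine squeeze_zero' (Eventually.of_forall fun _ => norm_nonneg _)
      (hlT.mono fun z hz => hb1 j z hz.1 hz.2) ?_
    exact tendsto_const_nhds.div_atTop hlnorm
  have hAlim : Tendsto (fun z => A z / a) l (𝓝 1) := by
    refine tendsto_iff_norm_sub_tendsto_zero.2 ?_
    refine squeeze_zero' (Eventually.of_forall fun _ => norm_nonneg _)
      (hlT.mono fun z hz => hA1 z hz.1 hz.2) ?_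
    exact tendsto_const_nhds.div_atTop hlnorm
  have hglim : Tendsto g l (𝓝 1) := by
    have h1 := hAlim.div hB one_ne_zero
    rw [div_one] at h1
    refine h1.congr' ?_
    filter_upwards [hlT, hj_inf] with z hz hzj
    have hbne : (∏ j, (z - Complex.I * η j) / (z + Complex.I * η j)) ≠ 0 :=
      Finset.prod_ne_zero_iff.2 fun j _ =>
        div_ne_zero (sub_ne_zero.2 (hzj j)) (add_I_mul_ne_zero (hη j) hz.1)
    rw [Pi.div_apply, hAg z hz.1, mul_div_cancel_left₀ _ hbne]
  have hIt : Tendsto (fun t : ℝ => (Complex.I * t : ℂ)) atTop l := by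
    refine tendsto_inf.2 ⟨?_, tendsto_principal.2 ?_⟩
    · rw [← tendsto_norm_atTop_iff_cobounded]
      refine tendsto_id.congr' ?_
      filter_upwards [eventually_ge_atTop 0] with t ht
      simp [abs_of_nonneg ht]
    · filter_upwards [eventually_gt_atTop 0] with t ht
      exact ⟨by simpa using ht.le, by simp [ht.ne']⟩
  obtain ⟨hint, hexp⟩ := eq_exp_cauchyInt hgd hgc hg0 hK (hglim.comp hIt) hζ
  -- Blaschke factors have modulus one on the real axis, so g and A/a share their boundary modulus.
  have hmod : ∀ ξ : ℝ, ‖g ξ‖ = ‖A ξ / a‖ := by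
    intro ξ
    have h1 : ∀ j, ‖((ξ : ℂ) - Complex.I * η j) / (ξ + Complex.I * η j)‖ = 1 := fun j => by
      have e : (starRingEnd ℂ) ((ξ : ℂ) + Complex.I * η j) = ξ - Complex.I * η j := by
        simp [sub_eq_add_neg]
      rw [norm_div, ← e, RCLike.norm_conj]
      exact div_self (norm_ne_zero_iff.2 (add_I_mul_ne_zero (hη j) (by simp)))
    rw [hAg ξ (by simp), norm_mul, norm_prod, Finset.prod_congr rfl fun j _ => h1 j]
    simp
  simp only [hmod] at hint hexp
  refine ⟨hint, ?_⟩
  rw [← hexp, mul_assoc, ← hAg ζ hζ.le, mul_div_cancel₀ _ ha]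

end Blaschke

/-! ### Determination of the transfer matrix and of the coefficient `A` -/

section Main

variable {q : ℝ → ℝ} {M : Matrix (Fin 2) (Fin 2) ℝ}

theorem diag_eq_inv (hdet : M.det = 1) (hM : M 0 1 = 0) : M 0 0 ≠ 0 ∧ M 1 1 = (M 0 0)⁻¹ := by
  have h : M 0 0 * M 1 1 = 1 := by exact_mod_cast diag_mul_eq_one hdet hM
  exact ⟨left_ne_zero_of_mul (h.trans_ne one_ne_zero), eq_inv_of_mul_eq_one_right h⟩

theorem sub_inv_div_add_inv {a : ℝ} (ha : a ≠ 0) :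
    (a - a⁻¹) / (a + a⁻¹) = 1 - 2 / (a ^ 2 + 1) := by
  have h : a ^ 2 + 1 ≠ 0 := by positivity
  have h2 : a + a⁻¹ = (a ^ 2 + 1) / a := by field_simp
  rw [h2]
  field_simp
  ring

theorem sign_mul_abs_eq {a : ℝ} (ha : a ≠ 0) :
    ∃ ε : ℝ, (ε = 1 ∨ ε = -1) ∧ a = ε * |a| ∧ a⁻¹ = ε * |a|⁻¹ := by
  rcases lt_or_gt_of_ne ha with h | h
  · refine ⟨-1, Or.inr rfl, ?_, ?_⟩ <;> rw [abs_of_neg h] <;> simp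
  · exact ⟨1, Or.inl rfl, by rw [abs_of_pos h, one_mul], by rw [abs_of_pos h, one_mul]⟩

/-- Both logarithms are of inverse squares, |1 - C²| = a⁻² and 1 - |R|² = |A|⁻², so their difference
is 2 log|A/a|. The factor 2 is what turns 1/(πi) into 1/(2πi). -/
theorem cauchyIntegrand_ae_eq (hq : AdmissiblePotential q) (hdet : M.det = 1) (hM : M 0 1 = 0)
    {a C : ℝ} (ha : a ≠ 0) (haC : |1 - C ^ 2| = (a ^ 2)⁻¹) (ζ : ℂ) :
    (fun ξ : ℝ => 2 * ((Real.log ‖extA q M ξ / a‖ : ℂ) / ((ξ : ℂ) - ζ))) =ᵐ[volume]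
      cauchyIntegrand (reflectionCoeff q M) C ζ := by
  filter_upwards [Measure.ae_ne volume (0 : ℝ)] with ξ hξ
  have h1 := one_le_norm_coeffA hq hdet hM hξ
  have h2 : ‖coeffA q M ξ‖ ≠ 0 := (one_pos.trans_le h1).ne'
  have h3 : extA q M ξ = coeffA q M ξ := (coeffA_eq hq hdet hM hξ).symm
  have h4 : Real.log |1 - C ^ 2| - Real.log (1 - ‖reflectionCoeff q M ξ‖ ^ 2) =
      2 * Real.log ‖extA q M ξ / a‖ := by
    rw [haC, one_sub_norm_reflectionCoeff_sq hq hdet hM hξ, Real.log_inv, Real.log_inv,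
      Real.log_pow, Real.log_pow, h3, norm_div, Complex.norm_real, Real.norm_eq_abs,
      Real.log_div h2 (abs_ne_zero.2 ha), Real.log_abs]
    push_cast
    ring
  rw [cauchyIntegrand, h4]
  push_cast
  ring

/-- The factorization of `A` in the upper half-plane. -/
theorem extA_eq (hq : AdmissiblePotential q) (hdet : M.det = 1) (hM : M 0 1 = 0) {a C : ℝ}
    (ha : a = (M 0 0 + M 1 1) / 2) (haC : |1 - C ^ 2| = (a ^ 2)⁻¹) {N : ℕ} {η : Fin N → ℝ}
    (hinj : Function.Injective η) (hrange : range η = jostZeros q M) {ζ : ℂ} (hζ : 0 < ζ.im) :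
    Integrable (cauchyIntegrand (reflectionCoeff q M) C ζ) volume ∧
      extA q M ζ = a * (∏ j : Fin N, (ζ - Complex.I * (η j : ℂ)) / (ζ + Complex.I * (η j : ℂ))) *
        Complex.exp (1 / (2 * (Real.pi : ℂ) * Complex.I) *
          ∫ ξ : ℝ, cauchyIntegrand (reflectionCoeff q M) C ζ ξ) := by
  have ha0 : a ≠ 0 := ha ▸ div_ne_zero (add_diag_ne_zero hdet hM) two_ne_zero
  have hac : (a : ℂ) = (M 0 0 + M 1 1) / 2 := by rw [ha]; push_cast; rfl
  have hext := isUpperExtension_extA hq hdet hM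
  have hmem : ∀ j, η j ∈ jostZeros q M := fun j => hrange ▸ mem_range_self j
  have hη : ∀ j, 0 < η j := fun j => (hmem j).1
  obtain ⟨K, hK⟩ := exists_bound_extA (M := M) hq
  obtain ⟨r, hr, hnear⟩ := exists_le_norm_extA_near_zero hq hdet hM
  have hset : ({z : ℂ | 0 ≤ z.im} \ {0}) = {z | 0 ≤ z.im ∧ z ≠ 0} := rfl
  rw [hset] at hnear
  have hI : ∀ j, (Complex.I * η j : ℂ) ≠ 0 := fun j => by simp [(hη j).ne']
  obtain ⟨hint, heq⟩ := eq_blaschke_mul_exp (A := extA q M) (Complex.ofReal_ne_zero.2 ha0) hη hinj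
    hext.analytic hext.continuousOn
    (by
      intro z hz hz0 hz1
      rcases hz.lt_or_eq with him | him
      · obtain ⟨t, ht, rfl⟩ := exists_mem_jostZeros hq hdet hM him ((extA_eq_zero_iff hz0).1 hz1)
        rw [← hrange] at ht
        obtain ⟨j, rfl⟩ := ht
        exact ⟨j, rfl⟩
      -- Real zeros are excluded by |A| ≥ 1 on ℝ \ {0}.
      · have hre : ((z.re : ℝ) : ℂ) = z := Complex.ext (by simp) (by simp [← him])
        have hre0 : z.re ≠ 0 := fun h => hz0 (by rw [← hre, h, Complex.ofReal_zero])
        have h1 := one_le_norm_coeffA hq hdet hM hre0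
        rw [← hext.boundary _ hre0, hre, hz1, norm_zero] at h1
        exact absurd h1 (by norm_num))
    (fun j => (extA_eq_zero_iff (hI j)).2 (hmem j).2)
    (fun j => by
      obtain ⟨d, hd, hder⟩ := exists_hasDerivAt_jostW hq hdet hM (hη j) (hmem j).2
      have h2 : (2 * Complex.I * (Complex.I * η j) : ℂ) ≠ 0 :=
        mul_ne_zero (mul_ne_zero two_ne_zero Complex.I_ne_zero) (hI j)
      refine ⟨_, ?_, hder.div ((hasDerivAt_id _).const_mul (2 * Complex.I)) h2⟩
      rw [(hmem j).2, zero_mul, sub_zero]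
      exact div_ne_zero (mul_ne_zero hd h2) (pow_ne_zero 2 h2))
    (fun z hz hz0 => hac ▸ hK z hz hz0) hr hnear hζ
  have hae := cauchyIntegrand_ae_eq hq hdet hM ha0 haC ζ
  refine ⟨(hint.const_mul 2).congr hae, ?_⟩
  rw [heq, cauchyInt, ← integral_congr_ae hae, integral_const_mul]
  congr 2
  have hpi : (Real.pi : ℂ) ≠ 0 := Complex.ofReal_ne_zero.2 Real.pi_ne_zero
  field_simp

/-- The limit of R at infinity is 1 - 2/(m₁₁² + 1), an injective function of m₁₁², and m₂₂ = 1/m₁₁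
inherits the sign. -/
theorem diag_eq_of_reflectionCoeff_eq (hq : AdmissiblePotential q) (hdet : M.det = 1)
    (hM : M 0 1 = 0) {q' : ℝ → ℝ} (hq' : AdmissiblePotential q') {M' : Matrix (Fin 2) (Fin 2) ℝ}
    (hdet' : M'.det = 1) (hM' : M' 0 1 = 0)
    (hR : ∀ ξ : ℝ, ξ ≠ 0 → reflectionCoeff q' M' ξ = reflectionCoeff q M ξ) :
    ∃ ε : ℝ, (ε = 1 ∨ ε = -1) ∧ M' 0 0 = ε * M 0 0 ∧ M' 1 1 = ε * M 1 1 := by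
  obtain ⟨h0, h1⟩ := diag_eq_inv hdet hM
  obtain ⟨h0', h1'⟩ := diag_eq_inv hdet' hM'
  have hlim := tendsto_reflectionCoeff hq hdet hM
  have hlim' := tendsto_reflectionCoeff hq' hdet' hM'
  have hev : reflectionCoeff q' M' =ᶠ[cocompact ℝ] reflectionCoeff q M := by
    filter_upwards [(isCompact_singleton (x := (0 : ℝ))).compl_mem_cocompact] with ξ hξ
    exact hR ξ hξ
  have h := Complex.ofReal_injective (tendsto_nhds_unique (hlim'.congr' hev) hlim)
  rw [h1, h1', sub_inv_div_add_inv h0, sub_inv_div_add_inv h0', sub_right_inj] at h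
  have hp : (0 : ℝ) < M 0 0 ^ 2 + 1 := by positivity
  have hp' : (0 : ℝ) < M' 0 0 ^ 2 + 1 := by positivity
  rw [div_eq_div_iff hp'.ne' hp.ne'] at h
  have hsq : M' 0 0 ^ 2 = M 0 0 ^ 2 := by linarith
  rw [h1, h1']
  rcases sq_eq_sq_iff_eq_or_eq_neg.1 hsq with e | e
  · exact ⟨1, Or.inl rfl, by rw [e, one_mul], by rw [e, one_mul]⟩
  · exact ⟨-1, Or.inr rfl, by rw [e, neg_one_mul], by rw [e, neg_one_mul, inv_neg]⟩

end Main

theorem theorem3p2 (q : ℝ → ℝ) (hq : AdmissiblePotential q)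
    (M : Matrix (Fin 2) (Fin 2) ℝ) (hdet : M.det = 1) (hM : M 0 1 = 0) :
    (∃ C₂ : ℝ, -1 < C₂ ∧ C₂ < 1 ∧
      Tendsto (reflectionCoeff q M) (cocompact ℝ) (𝓝 (C₂ : ℂ)) ∧
      (∀ ξ : ℝ, ξ ≠ 0 → ‖reflectionCoeff q M ξ‖ < 1) ∧
      ∃ ε : ℝ, (ε = 1 ∨ ε = -1) ∧
        M 0 0 = ε * √((1 + C₂) / (1 - C₂)) ∧
        M 1 1 = ε * √((1 - C₂) / (1 + C₂)) ∧
        ∃ (N : ℕ) (η : Fin N → ℝ), StrictMono η ∧ (∀ j, 0 < η j) ∧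
          eigenvalueSet q M = Set.range (fun j => -((η j : ℂ)) ^ 2) ∧
          ∃ A : ℂ → ℂ, IsUpperExtension (coeffA q M) A ∧
            ∀ ζ : ℂ, 0 < ζ.im →
              Integrable (cauchyIntegrand (reflectionCoeff q M) C₂ ζ) volume ∧
              A ζ = ((ε / √(1 - C₂ ^ 2) : ℝ) : ℂ) *
                (∏ j : Fin N, (ζ - Complex.I * (η j : ℂ)) / (ζ + Complex.I * (η j : ℂ))) *
                Complex.exp (1 / (2 * (Real.pi : ℂ) * Complex.I) *
                  ∫ ξ : ℝ, cauchyIntegrand (reflectionCoeff q M) C₂ ζ ξ)) ∧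
    (∀ q' : ℝ → ℝ, AdmissiblePotential q' →
      ∀ M' : Matrix (Fin 2) (Fin 2) ℝ, M'.det = 1 → M' 0 1 = 0 →
        (∀ ξ : ℝ, ξ ≠ 0 → reflectionCoeff q' M' ξ = reflectionCoeff q M ξ) →
        eigenvalueSet q' M' = eigenvalueSet q M →
        ∃ ε : ℝ, (ε = 1 ∨ ε = -1) ∧ M' 0 0 = ε * M 0 0 ∧ M' 1 1 = ε * M 1 1) := by
  refine ⟨?_, fun q' hq' M' hdet' hM' hR _ =>
    diag_eq_of_reflectionCoeff_eq hq hdet hM hq' hdet' hM' hR⟩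
  obtain ⟨h0, h1⟩ := diag_eq_inv hdet hM
  obtain ⟨ε, hε, e1, e2⟩ := sign_mul_abs_eq h0
  have hp : (0 : ℝ) < M 0 0 ^ 2 + 1 := by positivity
  have hsq : 0 < M 0 0 ^ 2 := by positivity
  have hlim := tendsto_reflectionCoeff hq hdet hM
  rw [h1, sub_inv_div_add_inv h0] at hlim
  set C₂ : ℝ := 1 - 2 / (M 0 0 ^ 2 + 1) with hC
  have hd1 : 1 - C₂ = 2 / (M 0 0 ^ 2 + 1) := by rw [hC]; ring
  have hd2 : 1 + C₂ = 2 * M 0 0 ^ 2 / (M 0 0 ^ 2 + 1) := by rw [hC]; field_simp; ring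
  have hq1 : (1 + C₂) / (1 - C₂) = |M 0 0| ^ 2 := by rw [hd1, hd2, sq_abs]; field_simp
  have hq2 : (1 - C₂) / (1 + C₂) = (|M 0 0|⁻¹) ^ 2 := by
    rw [hd1, hd2, inv_pow, sq_abs]; field_simp
  have hb1 : 0 < 1 - C₂ := by rw [hd1]; positivity
  have hb2 : 0 < 1 + C₂ := by rw [hd2]; positivity
  set a : ℝ := (M 0 0 + M 1 1) / 2 with ha
  have hprod : 1 - C₂ ^ 2 = (a ^ 2)⁻¹ := by
    have h3 : a = (M 0 0 ^ 2 + 1) / (2 * M 0 0) := by rw [ha, h1]; field_simp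
    have h4 : 1 - C₂ ^ 2 = (1 - C₂) * (1 + C₂) := by ring
    rw [h4, hd1, hd2, h3]
    field_simp
  -- Here a = (m₁₁ + 1/m₁₁)/2 carries the sign of m₁₁, and a² = 1/(1 - C₂²); so the ε of the
  -- diagonal entries is also the sign in front of A.
  have hapos : (ε / √(1 - C₂ ^ 2) : ℝ) = a := by
    have h3 : a = ε * ((|M 0 0| + |M 0 0|⁻¹) / 2) := by rw [ha, h1, e2]; nth_rewrite 1 [e1]; ring
    have h4 : 0 < (|M 0 0| + |M 0 0|⁻¹) / 2 := by positivity
    have h5 : a ^ 2 = ((|M 0 0| + |M 0 0|⁻¹) / 2) ^ 2 := by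
      rw [h3, mul_pow]
      rcases hε with rfl | rfl <;> norm_num
    rw [hprod, h5, ← inv_pow, Real.sqrt_sq (by positivity), div_inv_eq_mul, h3]
  have hfin := finite_jostZeros hq hdet hM
  set S := hfin.toFinset with hS
  have hrange : range (S.orderEmbOfFin rfl) = jostZeros q M := by
    rw [Finset.range_orderEmbOfFin, hS, hfin.coe_toFinset]
  refine ⟨C₂, by linarith, by linarith, hlim, fun ξ hξ => norm_reflectionCoeff_lt_one hq hdet hM hξ,
    ε, hε, ?_, ?_, S.card, S.orderEmbOfFin rfl, (S.orderEmbOfFin rfl).strictMono, ?_, ?_, extA q M,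
    isUpperExtension_extA hq hdet hM, fun ζ hζ => ?_⟩
  · rw [hq1, Real.sqrt_sq (abs_nonneg _)]; exact e1
  · rw [hq2, Real.sqrt_sq (by positivity), h1]; exact e2
  · intro j
    have : S.orderEmbOfFin rfl j ∈ jostZeros q M := hrange ▸ mem_range_self j
    exact this.1
  · rw [eigenvalueSet_eq hq hdet hM, ← hrange, ← range_comp]
    rfl
  · rw [hapos]
    refine extA_eq hq hdet hM ha ?_ (S.orderEmbOfFin rfl).injective hrange hζ
    rw [abs_of_pos (by nlinarith), hprod]
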